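/- \textbf{Conventions.} Graphs are finite and simple; a marked graph is a pair $(G,R)$ with $R\subseteq V(G)$. All $*$-algebras are complex and unital, $\otimes$ is the algebraic tensor product. A magic unitary is a matrix $U=(u_{ij})$ over a $*$-algebra whose coefficients are self-adjoint idempotents, with distinct coefficients in the same row or column having product $0$, and with every row and every column summing to $1$. A quantum permutation group is a pair $(A,U)$ where $A$ is a $*$-algebra generated by the coefficients of a (square) magic unitary $U$ and there is a unital $*$-morphism $\Delta\colon A\to A\otimes A$ with $\Delta(u_{ij})=\sum_k u_{ik}\otimes u_{kj}$; a morphism $(A,U)\to(B,V)$ is a unital $*$-morphism $A\to B$ intertwining the comultiplications. $\mathrm{Qu}(G)$ is given by the universal unital $*$-algebra generated by the coefficients of a magic unitary $U$ indexed by $V(G)$ that commutes with the adjacency matrix of $G$, and $\mathrm{Qu}(G,R)$ by adding the relations $u_{xy}=0$ whenever exactly one of $x,y$ is in $R$. $S_n^+$ is $\mathrm{Qu}$ of the edgeless graph on $n$ vertices. The free product $\ast_l(A_l,U_l)$ is the free product of the unital $*$-algebras $A_l$ with the block diagonal matrix formed by the $U_l$. For $S_n^+=(B,(s_{ij}))$,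 the free wreath product $(A,U)\wr_* S_n^+$ is the quotient of the free product of $B$ and of $n$ copies $\nu_i(A)$ of $A$ by the relations $\nu_i(a)s_{ij}=s_{ij}\nu_i(a)$, with fundamental representation $(s_{ij}\,\nu_i(u_{xy}))_{(x,i),(y,j)}$. Marked graphs $(G,R)$ and $(H,S)$ are quantum isomorphic, $(G,R)\cong_q(H,S)$, if over some nonzero unital $C^*$-algebra there is a magic unitary $U$ indexed by $V(H)\times V(G)$ with $U\,\mathrm{Adj}(G)=\mathrm{Adj}(H)\,U$ and $u_{ax}=0$ unless ($a\in S\Leftrightarrow x\in R$). They are isomorphic, $(G,R)\simeq(H,S)$, if there is a graph isomorphism mapping $R$ onto $S$. Let $G$ be a connected graph. A cut vertex is a vertex whose deletion increases the number of connected components (the vertex of a one-vertex graph counts as a cut vertex); a block is (the vertex set of) a maximal connected subgraph that stays connected after the deletion of any one of its vertices. An anchor of $G$ is a set $Q\subseteq V(G)$ that is either $\{r\}$ with $r$ a cut vertex, or a block. The canonical anchor is the centre $Z(G)$ (the set of vertices of minimum eccentricity) if it consists of one cut vertex, and otherwise the unique block containing $Z(G)$. The marked graph $\Psi(G,Q)$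 is defined as follows: if $Q=\{r\}$ with $r$ a cut vertex, it is the disjoint union, over the connected components $C$ of $G\setminus\{r\}$, of the graphs $G[C\cup\{r\}]$, with the copies of $r$ as marks; if $Q$ is a block, it is $G$ with all the edges inside $Q$ removed, with $Q$ as set of marks. Let $(G_i,r_i)$, $i\in I$, be the connected components of $\Psi(G,Q)$ with their roots, and let $J_1,\dots,J_m$ be the classes of $I$ for the relation $(G_i,r_i)\cong_q(G_j,r_j)$. \textbf{Theorem.} Let $G$ be a connected graph. (1) For every anchor $Q$ of $G$ there is a surjective morphism of quantum groups $$\varphi\colon \mathop{\ast}_{l=1}^m \mathrm{Qu}\Big(\bigoplus_{j\in J_l}(G_j,r_j)\Big)\to \mathrm{Qu}(G,Q),$$ which is an isomorphism when $Q$ induces a complete graph. Moreover, if $(G_i,r_i)\simeq(G_j,r_j)$ whenever $(G_i,r_i)\cong_q(G_j,r_j)$, then for every choice of representatives $i_l\in J_l$ there is an isomorphism of quantum groups $$\theta\colon\mathop{\ast}_{l=1}^m \mathrm{Qu}(G_{i_l},r_{i_l})\wr_* S^+_{|J_l|}\to\mathop{\ast}_{l=1}^m \mathrm{Qu}\Big(\bigoplus_{j\in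 J_l}(G_j,r_j)\Big),$$ so that $\varphi\circ\theta$ is a surjective morphism of quantum groups onto $\mathrm{Qu}(G,Q)$, and is an isomorphism when $Q$ induces a complete graph. (2) $G$ has exactly one canonical anchor $Q$, and for this $Q$ the same statement holds with $\mathrm{Qu}(G)$ in place of $\mathrm{Qu}(G,Q)$. -/

import Mathlib

open scoped TensorProduct

universe u v

set_option linter.unusedSectionVars false

namespace QuantumAut

noncomputable section

/-! ### Free unital `*`-algebras and quotients by relations -/

/-- The free unital complex `*`-algebra on `X`; `Sum.inl x` is the generator `x` and `Sum.inr x`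
its adjoint. -/
def FreeStarAlgebra (X : Type u) : Type u := FreeAlgebra ℂ (X ⊕ X)

namespace FreeStarAlgebra

variable {X : Type u}

instance : Ring (FreeStarAlgebra X) := inferInstanceAs (Ring (FreeAlgebra ℂ (X ⊕ X)))

instance : Algebra ℂ (FreeStarAlgebra X) :=
  inferInstanceAs (Algebra ℂ (FreeAlgebra ℂ (X ⊕ X)))

/-- The opposite algebra, on which complex scalars act through their conjugates. -/
def ConjOp (B : Type v) : Type v := Bᵐᵒᵖ

instance (B : Type v) [Ring B] : Ring (ConjOp B) := inferInstanceAs (Ring Bᵐᵒᵖ)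

instance (B : Type v) [Ring B] [Algebra ℂ B] : Algebra ℂ (ConjOp B) :=
  ((algebraMap ℂ Bᵐᵒᵖ).comp (starRingEnd ℂ)).toAlgebra'
    (fun c x => Algebra.commutes (A := Bᵐᵒᵖ) ((starRingEnd ℂ) c) x)

/-- The conjugate linear antimultiplicative map that exchanges the generators with their
adjoints. -/
def starHom (X : Type u) : FreeAlgebra ℂ (X ⊕ X) →ₐ[ℂ] ConjOp (FreeAlgebra ℂ (X ⊕ X)) :=
  FreeAlgebra.lift ℂ (fun y => MulOpposite.op (FreeAlgebra.ι ℂ y.swap))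

/-- `starHom` as a ring morphism to the opposite ring. -/
def starAux (X : Type u) : FreeAlgebra ℂ (X ⊕ X) →+* (FreeAlgebra ℂ (X ⊕ X))ᵐᵒᵖ :=
  (starHom X).toRingHom

theorem starAux_ι (y : X ⊕ X) :
    starAux X (FreeAlgebra.ι ℂ y) = MulOpposite.op (FreeAlgebra.ι ℂ y.swap) :=
  FreeAlgebra.lift_ι_apply (A := ConjOp (FreeAlgebra ℂ (X ⊕ X))) _ y

theorem starAux_algebraMap (c : ℂ) :
    starAux X (algebraMap ℂ _ c) = MulOpposite.op (algebraMap ℂ _ (star c)) :=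
  (starHom X).commutes' c

theorem starAux_starAux (a : FreeAlgebra ℂ (X ⊕ X)) :
    (starAux X (starAux X a).unop).unop = a := by
  induction a using FreeAlgebra.induction with
  | grade0 c => simp [starAux_algebraMap]
  | grade1 y => simp [starAux_ι]
  | mul a b ha hb => simp [ha, hb]
  | add a b ha hb => simp [ha, hb]

instance : StarRing (FreeStarAlgebra X) where
  star a := (starAux X a).unop
  star_involutive := starAux_starAux
  star_mul a b := by
    change (starAux X _).unop = _
    erw [map_mul]; rfl
  star_add a b := by
    change (starAux X _).unop = _
    erw [map_add]; rfl

instance : StarModule ℂ (FreeStarAlgebra X) where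
  star_smul c a := by
    rw [Algebra.smul_def, Algebra.smul_def, star_mul, Algebra.commutes (star c)]
    congr 1
    exact congrArg MulOpposite.unop (starAux_algebraMap c)

/-- The generators of the free `*`-algebra. -/
def gen (x : X) : FreeStarAlgebra X := FreeAlgebra.ι ℂ (Sum.inl x)

theorem star_gen (x : X) : star (gen x) = (FreeAlgebra.ι ℂ (Sum.inr x) : FreeAlgebra ℂ (X ⊕ X)) :=
  congrArg MulOpposite.unop (starAux_ι (Sum.inl x))

theorem induction {p : FreeStarAlgebra X → Prop} (hc : ∀ c : ℂ, p (algebraMap ℂ _ c))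
    (hg : ∀ x, p (gen x)) (hs : ∀ x, p (star (gen x)))
    (hm : ∀ a b, p a → p b → p (a * b)) (ha : ∀ a b, p a → p b → p (a + b)) (a) : p a := by
  refine FreeAlgebra.induction ℂ (X ⊕ X) (motive := p) hc ?_ hm ha a
  rintro (x | x)
  · exact hg x
  · rw [← star_gen]; exact hs x

variable {B : Type v} [Ring B] [StarRing B] [Algebra ℂ B] [StarModule ℂ B]

/-- The algebra morphism underlying `lift`. -/
def liftAux (f : X → B) : FreeStarAlgebra X →ₐ[ℂ] B :=
  FreeAlgebra.lift ℂ (Sum.elim f (fun x => star (f x)))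

theorem liftAux_gen (f : X → B) (x : X) : liftAux f (gen x) = f x :=
  FreeAlgebra.lift_ι_apply _ _

theorem liftAux_star_gen (f : X → B) (x : X) : liftAux f (star (gen x)) = star (f x) := by
  rw [star_gen]; exact FreeAlgebra.lift_ι_apply _ _

/-- The universal property of the free `*`-algebra. -/
def lift (f : X → B) : FreeStarAlgebra X →⋆ₐ[ℂ] B :=
  { liftAux f with
    map_star' := fun a => by
      change liftAux f (star a) = star (liftAux f a)
      induction a using FreeStarAlgebra.induction with
      | hc c => rw [← algebraMap_star_comm, AlgHom.commutes, AlgHom.commutes, algebraMap_star_comm]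
      | hg x => rw [liftAux_star_gen, liftAux_gen]
      | hs x => rw [star_star, liftAux_star_gen, liftAux_gen, star_star]
      | hm a b ha hb => simp [ha, hb]
      | ha a b ha hb => simp [ha, hb] }

@[simp] theorem lift_gen (f : X → B) (x : X) : lift f (gen x) = f x := liftAux_gen f x

end FreeStarAlgebra

section StarQuot

variable {B : Type u} [Ring B] [StarRing B] [Algebra ℂ B] [StarModule ℂ B]

/-- The relation `r` together with its adjoint. -/
def starClosure (r : B → B → Prop) (a b : B) : Prop := r a b ∨ r (star a) (star b)

theorem starClosure_star (r : B → B → Prop) (a b : B) (h : starClosure r a b) :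
    starClosure r (star a) (star b) := by
  rcases h with h | h
  · exact Or.inr (by simpa using h)
  · exact Or.inl h

/-- The quotient of a `*`-algebra by the two-sided `*`-ideal generated by the differences `a - b`
with `r a b`. -/
def StarQuot (r : B → B → Prop) : Type u := RingQuot (starClosure r)

namespace StarQuot

variable (r : B → B → Prop)

instance : Ring (StarQuot r) := inferInstanceAs (Ring (RingQuot (starClosure r)))

instance : Algebra ℂ (StarQuot r) := inferInstanceAs (Algebra ℂ (RingQuot (starClosure r)))

instance : StarRing (StarQuot r) := RingQuot.starRing (starClosure r) (starClosure_star r)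

/-- The algebra morphism underlying the quotient map. -/
def mkAux : B →ₐ[ℂ] StarQuot r := RingQuot.mkAlgHom ℂ (starClosure r)

theorem mkAux_surjective : Function.Surjective (mkAux r) :=
  RingQuot.mkAlgHom_surjective ℂ (starClosure r)

theorem mkAux_star (b : B) : mkAux r (star b) = star (mkAux r b) := by
  simp only [mkAux, RingQuot.mkAlgHom, RingQuot.mkRingHom]; rfl

instance : StarModule ℂ (StarQuot r) where
  star_smul c a := by
    obtain ⟨b, rfl⟩ := mkAux_surjective r a
    rw [← map_smul, ← mkAux_star, star_smul, map_smul, mkAux_star]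

/-- The quotient map. -/
def mk : B →⋆ₐ[ℂ] StarQuot r := { mkAux r with map_star' := mkAux_star r }

theorem mk_surjective : Function.Surjective (mk r) := mkAux_surjective r

variable {r}

theorem mk_eq {a b : B} (h : r a b) : mk r a = mk r b :=
  RingQuot.mkAlgHom_rel ℂ (s := starClosure r) (Or.inl h)

variable {C : Type v} [Ring C] [StarRing C] [Algebra ℂ C] [StarModule ℂ C]

/-- The algebra morphism underlying `lift`. -/
def liftAux (f : B →⋆ₐ[ℂ] C) (h : ∀ a b, r a b → f a = f b) : StarQuot r →ₐ[ℂ] C :=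
  RingQuot.liftAlgHom ℂ ⟨f.toAlgHom, by
    rintro a b (hab | hab)
    · exact h a b hab
    · have := h _ _ hab
      rw [map_star, map_star] at this
      exact star_injective this⟩

theorem liftAux_mk (f : B →⋆ₐ[ℂ] C) (h : ∀ a b, r a b → f a = f b) (b : B) :
    liftAux f h (mk r b) = f b :=
  RingQuot.liftAlgHom_mkAlgHom_apply ℂ f.toAlgHom _ b

/-- The universal property of the quotient. -/
def lift (f : B →⋆ₐ[ℂ] C) (h : ∀ a b, r a b → f a = f b) : StarQuot r →⋆ₐ[ℂ] C :=
  { liftAux f h with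
    map_star' := fun a => by
      change liftAux f h (star a) = star (liftAux f h a)
      obtain ⟨b, rfl⟩ := mk_surjective r a
      rw [← map_star, liftAux_mk, liftAux_mk, map_star] }

@[simp] theorem lift_mk (f : B →⋆ₐ[ℂ] C) (h : ∀ a b, r a b → f a = f b) (b : B) :
    lift f h (mk r b) = f b := liftAux_mk f h b

end StarQuot

end StarQuot

/-! ### Tensor products of `*`-morphisms -/

section Tensor

variable {A B C D : Type u} [Ring A] [StarRing A] [Algebra ℂ A] [StarModule ℂ A]
  [Ring B] [StarRing B] [Algebra ℂ B] [StarModule ℂ B]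
  [Ring C] [StarRing C] [Algebra ℂ C] [StarModule ℂ C]
  [Ring D] [StarRing D] [Algebra ℂ D] [StarModule ℂ D]

/-- The tensor product `f ⊗ g` of two unital `*`-morphisms. -/
def tensorMap (f : A →⋆ₐ[ℂ] C) (g : B →⋆ₐ[ℂ] D) : A ⊗[ℂ] B →⋆ₐ[ℂ] C ⊗[ℂ] D :=
  { Algebra.TensorProduct.map f.toAlgHom g.toAlgHom with
    map_star' := fun x => by
      change Algebra.TensorProduct.map f.toAlgHom g.toAlgHom (star x) =
        star (Algebra.TensorProduct.map f.toAlgHom g.toAlgHom x)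
      induction x using TensorProduct.induction_on with
      | zero => simp
      | tmul a b =>
        rw [TensorProduct.star_tmul, Algebra.TensorProduct.map_tmul,
          Algebra.TensorProduct.map_tmul, TensorProduct.star_tmul]
        exact congrArg₂ _ (map_star f a) (map_star g b)
      | add x y hx hy => rw [star_add, map_add, map_add, star_add, hx, hy] }

@[simp] theorem tensorMap_tmul (f : A →⋆ₐ[ℂ] C) (g : B →⋆ₐ[ℂ] D) (a : A) (b : B) :
    tensorMap f g (a ⊗ₜ b) = f a ⊗ₜ g b := rfl

/-- The inclusion `a ↦ a ⊗ 1`. -/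
def tensorInl (A B : Type u) [Ring A] [StarRing A] [Algebra ℂ A] [StarModule ℂ A]
    [Ring B] [StarRing B] [Algebra ℂ B] [StarModule ℂ B] : A →⋆ₐ[ℂ] A ⊗[ℂ] B :=
  { (Algebra.TensorProduct.includeLeft : A →ₐ[ℂ] A ⊗[ℂ] B) with
    map_star' := fun a => by
      change star a ⊗ₜ[ℂ] (1 : B) = star (a ⊗ₜ[ℂ] (1 : B))
      rw [TensorProduct.star_tmul, star_one] }

/-- The inclusion `b ↦ 1 ⊗ b`. -/
def tensorInr (A B : Type u) [Ring A] [StarRing A] [Algebra ℂ A] [StarModule ℂ A]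
    [Ring B] [StarRing B] [Algebra ℂ B] [StarModule ℂ B] : B →⋆ₐ[ℂ] A ⊗[ℂ] B :=
  { (Algebra.TensorProduct.includeRight : B →ₐ[ℂ] A ⊗[ℂ] B) with
    map_star' := fun a => by
      change (1 : A) ⊗ₜ[ℂ] star a = star ((1 : A) ⊗ₜ[ℂ] a)
      rw [TensorProduct.star_tmul, star_one] }

theorem tensorInl_apply (a : A) : tensorInl A B a = a ⊗ₜ 1 := rfl

theorem tensorInr_apply (b : B) : tensorInr A B b = 1 ⊗ₜ b := rfl

end Tensor

/-! ### Magic unitaries -/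

/-- A magic unitary: the coefficients are projections, two distinct coefficients in the same row
or column are orthogonal, and every row and every column sums up to `1`. -/
structure IsMagic {I J A : Type*} [Fintype I] [Fintype J] [Ring A] [StarRing A]
    (U : Matrix I J A) : Prop where
  idem : ∀ i j, U i j * U i j = U i j
  selfadj : ∀ i j, star (U i j) = U i j
  row_orth : ∀ i j k, j ≠ k → U i j * U i k = 0
  col_orth : ∀ i k j, i ≠ k → U i j * U k j = 0
  row_sum : ∀ i, ∑ j, U i j = 1
  col_sum : ∀ j, ∑ i, U i j = 1

section Magic

variable {I J K : Type*} [Fintype I] [Fintype J] [Fintype K]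
  {A B : Type*} [Ring A] [StarRing A] [Ring B] [StarRing B]

theorem IsMagic.map [Algebra ℂ A] [Algebra ℂ B] {U : Matrix I J A} (hU : IsMagic U)
    (f : A →⋆ₐ[ℂ] B) : IsMagic (U.map f) where
  idem i j := by simp [← map_mul, hU.idem]
  selfadj i j := by simp [← map_star, hU.selfadj]
  row_orth i j k h := by simp [← map_mul, hU.row_orth i j k h]
  col_orth i k j h := by simp [← map_mul, hU.col_orth i k j h]
  row_sum i := by simp [← map_sum, hU.row_sum]
  col_sum i := by simp [← map_sum, hU.col_sum]

theorem IsMagic.mul {U : Matrix I J A} {V : Matrix J K A} (hU : IsMagic U) (hV : IsMagic V)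
    (h : ∀ i j k l, Commute (U i j) (V k l)) : IsMagic (U * V) := by
  have key : ∀ i i' k k', (U * V) i k * (U * V) i' k' =
      ∑ j, ∑ j', (U i j * U i' j') * (V j k * V j' k') := by
    intro i i' k k'
    rw [Matrix.mul_apply, Matrix.mul_apply, Finset.sum_mul_sum]
    refine Finset.sum_congr rfl fun j _ => Finset.sum_congr rfl fun j' _ => ?_
    rw [mul_assoc, ← mul_assoc (V j k), ← (h i' j' j k).eq, mul_assoc, mul_assoc]
  refine ⟨fun i k => ?_, fun i k => ?_, fun i k k' hk => ?_, fun i i' k hi => ?_,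
    fun i => ?_, fun k => ?_⟩
  · rw [key, Matrix.mul_apply]
    refine Finset.sum_congr rfl fun j _ => ?_
    rw [Finset.sum_eq_single j, hU.idem, hV.idem]
    · intro j' _ hj
      rw [hU.row_orth i j j' hj.symm, zero_mul]
    · simp
  · rw [Matrix.mul_apply, star_sum]
    refine Finset.sum_congr rfl fun j _ => ?_
    rw [star_mul, hU.selfadj, hV.selfadj, (h i j j k).eq]
  · rw [key]
    refine Finset.sum_eq_zero fun j _ => Finset.sum_eq_zero fun j' _ => ?_
    by_cases hj : j = j'
    · rw [← hj, hV.row_orth j k k' hk, mul_zero]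
    · rw [hU.row_orth i j j' hj, zero_mul]
  · rw [key]
    refine Finset.sum_eq_zero fun j _ => Finset.sum_eq_zero fun j' _ => ?_
    by_cases hj : j = j'
    · rw [← hj, hU.col_orth i i' j hi, zero_mul]
    · rw [hV.col_orth j j' k hj, mul_zero]
  · simp only [Matrix.mul_apply]
    rw [Finset.sum_comm]
    simp [← Finset.mul_sum, hV.row_sum, hU.row_sum]
  · simp only [Matrix.mul_apply]
    rw [Finset.sum_comm]
    simp [← Finset.sum_mul, hV.col_sum, hU.col_sum]

end Magic

section TensorMul

variable {A : Type u} [Ring A] [StarRing A] [Algebra ℂ A] [StarModule ℂ A]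
  {I : Type u} [Fintype I]

/-- The matrix with coefficients `∑ k, U i k ⊗ U k j`. -/
def tensorMul (U : Matrix I I A) : Matrix I I (A ⊗[ℂ] A) :=
  Matrix.of fun i j => ∑ k, U i k ⊗ₜ[ℂ] U k j

theorem tensorMul_eq (U : Matrix I I A) :
    tensorMul U = U.map (tensorInl A A) * U.map (tensorInr A A) := by
  ext i j
  simp [tensorMul, Matrix.mul_apply, tensorInl_apply, tensorInr_apply]

theorem IsMagic.tensorMul {U : Matrix I I A} (hU : IsMagic U) : IsMagic (tensorMul U) := by
  rw [tensorMul_eq]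
  refine (hU.map _).mul (hU.map _) fun i j k l => ?_
  simp [Commute, SemiconjBy, tensorInl_apply, tensorInr_apply]

end TensorMul

/-! ### Quantum permutation groups -/

/-- A quantum permutation group: a unital `*`-algebra generated by the coefficients of a magic
unitary `U`, such that there is a unital `*`-morphism `Δ : A → A ⊗ A` with
`Δ (U i j) = ∑ k, U i k ⊗ U k j`. -/
structure QuantumPermutationGroup : Type (u + 1) where
  /-- the underlying `*`-algebra -/
  A : Type u
  [ring : Ring A]
  [starRing : StarRing A]
  [algebra : Algebra ℂ A]
  [starModule : StarModule ℂ A]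
  /-- the finite set on which the quantum group acts -/
  ι : Type u
  [fintype : Fintype ι]
  /-- the fundamental representation -/
  U : Matrix ι ι A
  magic : IsMagic U
  generates : StarAlgebra.adjoin ℂ (Set.range fun p : ι × ι => U p.1 p.2) = ⊤
  exists_comul : ∃ Δ : A →⋆ₐ[ℂ] A ⊗[ℂ] A, ∀ i j, Δ (U i j) = ∑ k, U i k ⊗ₜ[ℂ] U k j

namespace QuantumPermutationGroup

attribute [instance] ring starRing algebra starModule fintype

/-- The comultiplication. -/
def comul (P : QuantumPermutationGroup.{u}) : P.A →⋆ₐ[ℂ] P.A ⊗[ℂ] P.A := P.exists_comul.choose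

theorem comul_U (P : QuantumPermutationGroup.{u}) (i j : P.ι) :
    P.comul (P.U i j) = ∑ k, P.U i k ⊗ₜ[ℂ] P.U k j := P.exists_comul.choose_spec i j

theorem hom_ext {P : QuantumPermutationGroup.{u}} {B : Type v} [Ring B] [StarRing B]
    [Algebra ℂ B] [StarModule ℂ B] {f g : P.A →⋆ₐ[ℂ] B}
    (h : ∀ i j, f (P.U i j) = g (P.U i j)) : f = g := by
  refine StarAlgHom.ext_of_adjoin_eq_top P.generates ?_
  rintro _ ⟨⟨i, j⟩, rfl⟩
  exact h i j

/-- The comultiplication is the only `*`-morphism with the prescribed values on `U`. -/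
theorem comul_unique (P : QuantumPermutationGroup.{u}) (Δ : P.A →⋆ₐ[ℂ] P.A ⊗[ℂ] P.A)
    (h : ∀ i j, Δ (P.U i j) = ∑ k, P.U i k ⊗ₜ[ℂ] P.U k j) : Δ = P.comul :=
  hom_ext fun i j => by rw [h, comul_U]

/-- A morphism of quantum groups: a unital `*`-morphism that intertwines the
comultiplications. -/
structure Hom (P Q : QuantumPermutationGroup.{u}) where
  /-- the underlying `*`-morphism -/
  toStarAlgHom : P.A →⋆ₐ[ℂ] Q.A
  intertwines : ∀ a, tensorMap toStarAlgHom toStarAlgHom (P.comul a) = Q.comul (toStarAlgHom a)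

instance (P Q : QuantumPermutationGroup.{u}) : CoeFun (Hom P Q) (fun _ => P.A → Q.A) :=
  ⟨fun f => f.toStarAlgHom⟩

end QuantumPermutationGroup

/-! ### Marked graphs and their quantum automorphism groups -/

/-- A marked graph `(G, R)`: a finite simple graph with a set of vertices. -/
structure MarkedGraph : Type (u + 1) where
  /-- the vertices -/
  V : Type u
  [fintype : Fintype V]
  /-- the graph -/
  graph : SimpleGraph V
  /-- the marked vertices -/
  mark : Set V

attribute [instance] MarkedGraph.fintype

namespace MarkedGraph

/-- The adjacency matrix with coefficients in a ring. -/
def adj (X : MarkedGraph.{u}) (A : Type v) [Ring A] : Matrix X.V X.V A :=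
  letI := Classical.decRel X.graph.Adj
  X.graph.adjMatrix A

theorem adj_map (X : MarkedGraph.{u}) {A B : Type*} [Ring A] [Ring B] [Algebra ℂ A]
    [Algebra ℂ B] [StarRing A] [StarRing B] (f : A →⋆ₐ[ℂ] B) : (X.adj A).map f = X.adj B := by
  ext x y
  simp only [adj, Matrix.map_apply, SimpleGraph.adjMatrix_apply]
  split_ifs <;> simp

/-- `U` is a quantum isomorphism of marked graphs from `X = (G, R)` to `Y = (H, S)` with
coefficients in `A`: a magic unitary indexed by `V(H) × V(G)` that intertwines the adjacency
matrices and preserves the marks. -/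
structure IsQuantumIso (X Y : MarkedGraph.{u}) {A : Type v} [Ring A] [StarRing A]
    (U : Matrix Y.V X.V A) : Prop where
  magic : IsMagic U
  intertwines : U * X.adj A = Y.adj A * U
  mark : ∀ a x, ¬ (a ∈ Y.mark ↔ x ∈ X.mark) → U a x = 0

/-- Two marked graphs are quantum isomorphic if there is a quantum isomorphism between them with
coefficients in a nonzero unital `C*`-algebra. -/
def QuantumIsomorphic (X Y : MarkedGraph.{u}) : Prop :=
  ∃ (A : Type u) (_ : CStarAlgebra A) (_ : Nontrivial A) (U : Matrix Y.V X.V A),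
    IsQuantumIso X Y U

/-- Two marked graphs are isomorphic if there is a graph isomorphism that preserves the marks. -/
def Isomorphic (X Y : MarkedGraph.{u}) : Prop :=
  ∃ f : X.graph ≃g Y.graph, ∀ x, f x ∈ Y.mark ↔ x ∈ X.mark

/-- The matrix of free generators indexed by the pairs of vertices. -/
def genMatrix (X : MarkedGraph.{u}) : Matrix X.V X.V (FreeStarAlgebra (X.V × X.V)) :=
  Matrix.of fun x y => FreeStarAlgebra.gen (x, y)

theorem genMatrix_apply (X : MarkedGraph.{u}) (x y : X.V) :
    X.genMatrix x y = FreeStarAlgebra.gen (x, y) := rfl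

/-- The defining relations of the quantum automorphism group of a marked graph `(G, R)`: the
matrix of generators is a magic unitary, commutes with the adjacency matrix of `G`, and
stabilises `R`. -/
inductive QuRel (X : MarkedGraph.{u}) :
    FreeStarAlgebra (X.V × X.V) → FreeStarAlgebra (X.V × X.V) → Prop
  | idem (x y) : QuRel X (X.genMatrix x y * X.genMatrix x y) (X.genMatrix x y)
  | selfadj (x y) : QuRel X (star (X.genMatrix x y)) (X.genMatrix x y)
  | row_orth (x y z) : y ≠ z → QuRel X (X.genMatrix x y * X.genMatrix x z) 0
  | col_orth (x z y) : x ≠ z → QuRel X (X.genMatrix x y * X.genMatrix z y) 0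
  | row_sum (x) : QuRel X (∑ y, X.genMatrix x y) 1
  | col_sum (y) : QuRel X (∑ x, X.genMatrix x y) 1
  | commute (x y) : QuRel X
      ((X.genMatrix * X.adj _ : Matrix X.V X.V (FreeStarAlgebra (X.V × X.V))) x y)
      ((X.adj _ * X.genMatrix : Matrix X.V X.V (FreeStarAlgebra (X.V × X.V))) x y)
  | mark (x y) : ¬ (x ∈ X.mark ↔ y ∈ X.mark) → QuRel X (X.genMatrix x y) 0

/-- The universal unital `*`-algebra of the quantum automorphism group. -/
abbrev QuAlgebra (X : MarkedGraph.{u}) : Type u := StarQuot X.QuRel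

/-- The matrix of generators of the universal algebra. -/
def quU (X : MarkedGraph.{u}) : Matrix X.V X.V X.QuAlgebra :=
  X.genMatrix.map (StarQuot.mk X.QuRel)

theorem quU_isQuantumIso (X : MarkedGraph.{u}) : IsQuantumIso X X X.quU where
  magic :=
    { idem := fun x y => by simpa [quU] using StarQuot.mk_eq (QuRel.idem (X := X) x y)
      selfadj := fun x y => by
        have := StarQuot.mk_eq (QuRel.selfadj (X := X) x y)
        rwa [map_star] at this
      row_orth := fun x y z h => by simpa [quU] using StarQuot.mk_eq (QuRel.row_orth (X := X) x y z h)
      col_orth := fun x z y h => by simpa [quU] using StarQuot.mk_eq (QuRel.col_orth (X := X) x z y h)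
      row_sum := fun x => by simpa [quU] using StarQuot.mk_eq (QuRel.row_sum (X := X) x)
      col_sum := fun x => by simpa [quU] using StarQuot.mk_eq (QuRel.col_sum (X := X) x) }
  intertwines := by
    rw [← X.adj_map (StarQuot.mk X.QuRel)]
    ext x y
    have := StarQuot.mk_eq (QuRel.commute (X := X) x y)
    simpa [Matrix.mul_apply, quU] using this
  mark := fun a x h => by simpa [quU] using StarQuot.mk_eq (QuRel.mark (X := X) a x h)

section lift

variable {X : MarkedGraph.{u}} {B : Type v} [Ring B] [StarRing B] [Algebra ℂ B]
  [StarModule ℂ B]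

/-- The universal property of the quantum automorphism group. -/
def quLift (V : Matrix X.V X.V B) (hV : IsQuantumIso X X V) : X.QuAlgebra →⋆ₐ[ℂ] B :=
  StarQuot.lift (FreeStarAlgebra.lift fun p => V p.1 p.2) (by
    intro a b h
    induction h with
    | idem x y => simp [genMatrix_apply, hV.magic.idem]
    | selfadj x y => rw [map_star]; simp [genMatrix_apply, hV.magic.selfadj]
    | row_orth x y z h => simp [genMatrix_apply, hV.magic.row_orth x y z h]
    | col_orth x y z h => simp [genMatrix_apply, hV.magic.col_orth x y z h]
    | row_sum x => simp [genMatrix_apply, hV.magic.row_sum]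
    | col_sum x => simp [genMatrix_apply, hV.magic.col_sum]
    | commute x y =>
      have := congrFun (congrFun hV.intertwines x) y
      rw [← X.adj_map (FreeStarAlgebra.lift fun p : X.V × X.V => V p.1 p.2)] at this
      simpa [genMatrix_apply, Matrix.mul_apply] using this
    | mark x y h => simp [genMatrix_apply, hV.mark x y h])

@[simp] theorem quLift_quU (V : Matrix X.V X.V B) (hV : IsQuantumIso X X V) (x y : X.V) :
    quLift V hV (X.quU x y) = V x y :=
  (StarQuot.lift_mk _ _ _).trans (FreeStarAlgebra.lift_gen _ _)

end lift

theorem IsQuantumIso.tensorMul {X : MarkedGraph.{u}} {A : Type u} [Ring A] [StarRing A]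
    [Algebra ℂ A] [StarModule ℂ A] {U : Matrix X.V X.V A} (hU : IsQuantumIso X X U) :
    IsQuantumIso X X (tensorMul U) where
  magic := hU.magic.tensorMul
  intertwines := by
    have key : ∀ f : A →⋆ₐ[ℂ] A ⊗[ℂ] A, U.map f * X.adj _ = X.adj _ * U.map f := by
      intro f
      have := congrArg (fun M => Matrix.map M f) hU.intertwines
      have hm : ∀ M N : Matrix X.V X.V A, (M * N).map f = M.map f * N.map f := by
        intro M N
        ext x y
        simp [Matrix.mul_apply]
      simpa only [hm, adj_map] using this
    rw [tensorMul_eq, Matrix.mul_assoc, key, ← Matrix.mul_assoc, key, Matrix.mul_assoc]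
  mark := fun a x h => by
    refine Finset.sum_eq_zero fun z _ => ?_
    by_cases hz : a ∈ X.mark ↔ z ∈ X.mark
    · rw [hU.mark z x (by tauto), TensorProduct.tmul_zero]
    · rw [hU.mark a z hz, TensorProduct.zero_tmul]

/-- The quantum automorphism group `Qu(G, R)` of a marked graph, that is, the stabiliser of `R`
in the quantum automorphism group of `G`. -/
def Qu (X : MarkedGraph.{u}) : QuantumPermutationGroup.{u} where
  A := X.QuAlgebra
  ι := X.V
  U := X.quU
  magic := X.quU_isQuantumIso.magic
  generates := by
    rw [eq_top_iff]
    rintro a -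
    obtain ⟨b, rfl⟩ := StarQuot.mk_surjective _ a
    have hg : ∀ p, StarQuot.mk X.QuRel (FreeStarAlgebra.gen p) ∈
        StarAlgebra.adjoin ℂ (Set.range fun p : X.V × X.V => X.quU p.1 p.2) :=
      fun p => StarAlgebra.subset_adjoin ℂ _ ⟨p, rfl⟩
    induction b using FreeStarAlgebra.induction with
    | hc c => rw [AlgHomClass.commutes]; exact algebraMap_mem _ c
    | hg p => exact hg p
    | hs p => rw [map_star]; exact star_mem (hg p)
    | hm a b ha hb => rw [map_mul]; exact mul_mem ha hb
    | ha a b ha hb => rw [map_add]; exact add_mem ha hb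
  exists_comul := ⟨quLift _ X.quU_isQuantumIso.tensorMul, fun i j => quLift_quU _ _ i j⟩

end MarkedGraph

/-! ### Free products -/

section FreeProd

variable {L : Type u} (A : L → Type u) [∀ l, Ring (A l)] [∀ l, StarRing (A l)]
  [∀ l, Algebra ℂ (A l)] [∀ l, StarModule ℂ (A l)]

/-- The relations of the free product: the inclusion of each factor is a unital `*`-morphism. -/
inductive FreeProdRel : FreeStarAlgebra (Σ l, A l) → FreeStarAlgebra (Σ l, A l) → Prop
  | add (l) (a b : A l) : FreeProdRel
      (FreeStarAlgebra.gen ⟨l, a + b⟩) (FreeStarAlgebra.gen ⟨l, a⟩ + FreeStarAlgebra.gen ⟨l, b⟩)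
  | mul (l) (a b : A l) : FreeProdRel
      (FreeStarAlgebra.gen ⟨l, a * b⟩) (FreeStarAlgebra.gen ⟨l, a⟩ * FreeStarAlgebra.gen ⟨l, b⟩)
  | scalar (l) (c : ℂ) : FreeProdRel
      (FreeStarAlgebra.gen ⟨l, algebraMap ℂ (A l) c⟩) (algebraMap ℂ _ c)
  | star (l) (a : A l) : FreeProdRel
      (FreeStarAlgebra.gen ⟨l, Star.star a⟩) (Star.star (FreeStarAlgebra.gen ⟨l, a⟩))

/-- The free product (coproduct) of a family of unital `*`-algebras. -/
abbrev FreeProd : Type u := StarQuot (FreeProdRel A)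

namespace FreeProd

variable {A}

/-- The algebra morphism underlying `inc`. -/
def incAux (l : L) : A l →ₐ[ℂ] FreeProd A :=
  AlgHom.ofLinearMap
    { toFun := fun a => StarQuot.mk (FreeProdRel A) (FreeStarAlgebra.gen ⟨l, a⟩)
      map_add' := fun a b => by
        rw [StarQuot.mk_eq (FreeProdRel.add l a b), map_add]
      map_smul' := fun c a => by
        rw [Algebra.smul_def, StarQuot.mk_eq (FreeProdRel.mul l _ a), map_mul,
          StarQuot.mk_eq (FreeProdRel.scalar l c), AlgHomClass.commutes, ← Algebra.smul_def]
        rfl }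
    (by
      have := StarQuot.mk_eq (FreeProdRel.scalar (A := A) l 1)
      simpa using this)
    (fun a b => by
      have := StarQuot.mk_eq (FreeProdRel.mul l a b)
      simpa using this)

/-- The inclusion of a factor. -/
def inc (l : L) : A l →⋆ₐ[ℂ] FreeProd A :=
  { incAux l with
    map_star' := fun a => (StarQuot.mk_eq (FreeProdRel.star l a)).trans (map_star _ _) }

theorem inc_apply (l : L) (a : A l) :
    inc l a = StarQuot.mk (FreeProdRel A) (FreeStarAlgebra.gen ⟨l, a⟩) := rfl

/-- The universal property of the free product. -/
def lift {B : Type v} [Ring B] [StarRing B] [Algebra ℂ B] [StarModule ℂ B]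
    (f : ∀ l, A l →⋆ₐ[ℂ] B) : FreeProd A →⋆ₐ[ℂ] B :=
  StarQuot.lift (FreeStarAlgebra.lift fun p : (Σ l, A l) => f p.1 p.2) (by
    intro a b h
    induction h with
    | add l a b => simp
    | mul l a b => simp
    | scalar l c =>
      rw [AlgHomClass.commutes, FreeStarAlgebra.lift_gen, AlgHomClass.commutes]
    | star l a => rw [map_star]; simp [map_star])

@[simp] theorem lift_inc {B : Type v} [Ring B] [StarRing B] [Algebra ℂ B] [StarModule ℂ B]
    (f : ∀ l, A l →⋆ₐ[ℂ] B) (l : L) (a : A l) : lift f (inc l a) = f l a := by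
  rw [inc_apply]
  exact (StarQuot.lift_mk _ _ _).trans (FreeStarAlgebra.lift_gen _ _)

/-- A `*`-subalgebra that contains all the factors is the whole free product. -/
theorem mem_of_inc (S : StarSubalgebra ℂ (FreeProd A)) (h : ∀ l a, inc l a ∈ S)
    (x : FreeProd A) : x ∈ S := by
  obtain ⟨b, rfl⟩ := StarQuot.mk_surjective _ x
  induction b using FreeStarAlgebra.induction with
  | hc c => rw [AlgHomClass.commutes]; exact algebraMap_mem _ c
  | hg p => exact h p.1 p.2
  | hs p => rw [map_star]; exact star_mem (h p.1 p.2)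
  | hm a b ha hb => rw [map_mul]; exact mul_mem ha hb
  | ha a b ha hb => rw [map_add]; exact add_mem ha hb

end FreeProd

end FreeProd

namespace QuantumPermutationGroup

/-- If a `*`-subalgebra contains the images of the coefficients of the fundamental
representation, then it contains the whole image. -/
theorem map_mem (P : QuantumPermutationGroup.{u}) {B : Type v} [Ring B] [StarRing B]
    [Algebra ℂ B] [StarModule ℂ B] (f : P.A →⋆ₐ[ℂ] B) (S : StarSubalgebra ℂ B)
    (h : ∀ i j, f (P.U i j) ∈ S) (a : P.A) : f a ∈ S := by
  have : a ∈ StarAlgebra.adjoin ℂ (Set.range fun p : P.ι × P.ι => P.U p.1 p.2) := by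
    rw [P.generates]; trivial
  have hle : StarAlgebra.adjoin ℂ (Set.range fun p : P.ι × P.ι => P.U p.1 p.2) ≤ S.comap f := by
    refine StarAlgebra.adjoin_le ?_
    rintro _ ⟨p, rfl⟩
    exact h p.1 p.2
  exact hle this

section freeProd

variable {L : Type u} [Fintype L] (P : L → QuantumPermutationGroup.{u})

/-- The inclusion of a factor in the free product. -/
abbrev factorInc (l : L) : (P l).A →⋆ₐ[ℂ] FreeProd fun l => (P l).A :=
  FreeProd.inc (A := fun l => (P l).A) l

/-- The block diagonal matrix formed by the fundamental representations of the factors. -/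
def freeProdU : Matrix (Σ l, (P l).ι) (Σ l, (P l).ι) (FreeProd fun l => (P l).A) :=
  letI := Classical.decEq L
  Matrix.blockDiagonal' fun l => (P l).U.map (factorInc P l)

theorem freeProdU_same (l : L) (x y : (P l).ι) :
    freeProdU P ⟨l, x⟩ ⟨l, y⟩ = factorInc P l ((P l).U x y) := by
  simp [freeProdU, Matrix.blockDiagonal'_apply_eq]

theorem freeProdU_ne {l m : L} (h : l ≠ m) (x : (P l).ι) (y : (P m).ι) :
    freeProdU P ⟨l, x⟩ ⟨m, y⟩ = 0 := by
  let _ := Classical.decEq L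
  exact Matrix.blockDiagonal'_apply_ne _ _ _ h

theorem freeProdU_magic : IsMagic (freeProdU P) where
  idem := by
    rintro ⟨l, x⟩ ⟨m, y⟩
    by_cases h : l = m
    · subst h; rw [freeProdU_same, ← map_mul, (P l).magic.idem]
    · rw [freeProdU_ne P h, mul_zero]
  selfadj := by
    rintro ⟨l, x⟩ ⟨m, y⟩
    by_cases h : l = m
    · subst h; rw [freeProdU_same, ← map_star, (P l).magic.selfadj]
    · rw [freeProdU_ne P h, star_zero]
  row_orth := by
    rintro ⟨l, x⟩ ⟨m, y⟩ ⟨n, z⟩ hne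
    by_cases h : l = m
    · subst h
      by_cases h' : l = n
      · subst h'
        rw [freeProdU_same, freeProdU_same, ← map_mul,
          (P l).magic.row_orth x y z (fun e => hne (by rw [e])), map_zero]
      · rw [freeProdU_ne P h', mul_zero]
    · rw [freeProdU_ne P h, zero_mul]
  col_orth := by
    rintro ⟨l, x⟩ ⟨m, y⟩ ⟨n, z⟩ hne
    by_cases h : l = n
    · subst h
      by_cases h' : m = l
      · subst h'
        rw [freeProdU_same, freeProdU_same, ← map_mul,
          (P m).magic.col_orth x y z (fun e => hne (by rw [e])), map_zero]
      · rw [freeProdU_ne P h', mul_zero]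
    · rw [freeProdU_ne P h, zero_mul]
  row_sum := by
    rintro ⟨l, x⟩
    rw [Fintype.sum_sigma, Finset.sum_eq_single l]
    · simp only [freeProdU_same]
      rw [← map_sum, (P l).magic.row_sum, map_one]
    · intro m _ hm
      exact Finset.sum_eq_zero fun y _ => freeProdU_ne P hm.symm x y
    · simp
  col_sum := by
    rintro ⟨l, x⟩
    rw [Fintype.sum_sigma, Finset.sum_eq_single l]
    · simp only [freeProdU_same]
      rw [← map_sum, (P l).magic.col_sum, map_one]
    · intro m _ hm
      exact Finset.sum_eq_zero fun y _ => freeProdU_ne P hm y x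
    · simp

/-- The free product of a finite family of quantum permutation groups: the free product of the
algebras with the block diagonal fundamental representation. -/
def freeProd : QuantumPermutationGroup.{u} where
  A := FreeProd fun l => (P l).A
  ι := Σ l, (P l).ι
  U := freeProdU P
  magic := freeProdU_magic P
  generates := by
    rw [eq_top_iff]
    rintro a -
    refine FreeProd.mem_of_inc _ (fun l a => (P l).map_mem (factorInc P l) _ ?_ a) a
    intro x y
    exact StarAlgebra.subset_adjoin ℂ _ ⟨(⟨l, x⟩, ⟨l, y⟩), freeProdU_same P l x y⟩
  exists_comul := by
    refine ⟨FreeProd.lift fun l =>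
      (tensorMap (factorInc P l) (factorInc P l)).comp (P l).comul, ?_⟩
    rintro ⟨l, x⟩ ⟨m, y⟩
    rw [Fintype.sum_sigma]
    by_cases h : l = m
    · subst h
      rw [Finset.sum_eq_single l]
      · simp [freeProdU_same, comul_U]
      · intro m _ hm
        refine Finset.sum_eq_zero fun z _ => ?_
        rw [freeProdU_ne P hm.symm, TensorProduct.zero_tmul]
      · simp
    · rw [freeProdU_ne P h, map_zero]
      refine (Finset.sum_eq_zero fun n _ => Finset.sum_eq_zero fun z _ => ?_).symm
      by_cases h' : l = n
      · subst h'
        rw [freeProdU_ne P h, TensorProduct.tmul_zero]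
      · rw [freeProdU_ne P h', TensorProduct.zero_tmul]

end freeProd

end QuantumPermutationGroup

/-! ### Free wreath products -/

section glue

variable {A : Type u} {D : Type v} [Ring A] [StarRing A] [Algebra ℂ A] [StarModule ℂ A]
  [Ring D] [StarRing D] [Algebra ℂ D] [StarModule ℂ D] {K : Type*} [Fintype K]

/-- The `*`-morphism `a ↦ ∑ k, f k a * e k`, for orthogonal projections `e k` with sum `1` such
that `e k` commutes with the image of `f k`. -/
def glue (f : K → A →⋆ₐ[ℂ] D) (e : K → D) (idem : ∀ k, e k * e k = e k)
    (selfadj : ∀ k, star (e k) = e k) (orth : ∀ k l, k ≠ l → e k * e l = 0)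
    (sum_eq : ∑ k, e k = 1) (comm : ∀ k a, Commute (f k a) (e k)) : A →⋆ₐ[ℂ] D where
  toFun a := ∑ k, f k a * e k
  map_zero' := by simp
  map_one' := by simp [sum_eq]
  map_add' a b := by simp [add_mul, Finset.sum_add_distrib]
  map_mul' a b := by
    rw [Finset.sum_mul_sum]
    refine Finset.sum_congr rfl fun k _ => ?_
    have h : ∀ l, f k a * e k * (f l b * e l) = f k a * (e k * e l) * f l b := by
      intro l
      rw [(comm l b).eq]
      simp only [mul_assoc]
    rw [Finset.sum_eq_single k]
    · rw [h, idem, map_mul, mul_assoc, mul_assoc, (comm k b).eq]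
    · intro l _ hl
      rw [h, orth k l hl.symm, mul_zero, zero_mul]
    · simp
  commutes' c := by
    simp only [AlgHomClass.commutes]
    rw [← Finset.mul_sum, sum_eq, mul_one]
  map_star' a := by
    rw [star_sum]
    refine Finset.sum_congr rfl fun k _ => ?_
    rw [star_mul, selfadj, ← map_star, (comm k _).eq]

theorem glue_apply (f : K → A →⋆ₐ[ℂ] D) (e : K → D) (h1 h2 h3 h4 h5) (a : A) :
    glue f e h1 h2 h3 h4 h5 a = ∑ k, f k a * e k := rfl

end glue

namespace QuantumPermutationGroup

section wreath

variable (P S : QuantumPermutationGroup.{u})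

/-- One copy of `S`, and one copy of `P` for each point on which `S` acts. -/
abbrev wreathFamily : Option S.ι → QuantumPermutationGroup.{u} := fun o => o.elim S fun _ => P

/-- The free product of `S` and of the copies of `P`. -/
abbrev WreathFree : Type u := FreeProd fun o => (wreathFamily P S o).A

/-- The copy of `P` with index `i`. -/
abbrev preNu (i : S.ι) : P.A →⋆ₐ[ℂ] WreathFree P S :=
  FreeProd.inc (A := fun o => (wreathFamily P S o).A) (some i)

/-- The copy of `S`. -/
abbrev preSigma : S.A →⋆ₐ[ℂ] WreathFree P S :=
  FreeProd.inc (A := fun o => (wreathFamily P S o).A) none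

/-- The relations of the free wreath product: the `i`th copy of `P` commutes with the `i`th row
of the fundamental representation of `S`. -/
inductive WreathRel : WreathFree P S → WreathFree P S → Prop
  | commute (i j : S.ι) (a : P.A) : WreathRel
      (preNu P S i a * preSigma P S (S.U i j)) (preSigma P S (S.U i j) * preNu P S i a)

/-- The algebra of the free wreath product. -/
abbrev WreathAlgebra : Type u := StarQuot (WreathRel P S)

/-- The inclusion of the `i`th copy of `P`. -/
def nu (i : S.ι) : P.A →⋆ₐ[ℂ] WreathAlgebra P S := (StarQuot.mk _).comp (preNu P S i)

/-- The inclusion of `S`. -/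
def sigma : S.A →⋆ₐ[ℂ] WreathAlgebra P S := (StarQuot.mk _).comp (preSigma P S)

theorem nu_commute (i j : S.ι) (a : P.A) : Commute (nu P S i a) (sigma P S (S.U i j)) := by
  have := StarQuot.mk_eq (WreathRel.commute (P := P) (S := S) i j a)
  rwa [map_mul, map_mul] at this

/-- The `*`-morphism on the free product that underlies `wreathLift`. -/
def wreathPreLift {B : Type v} [Ring B] [StarRing B] [Algebra ℂ B] [StarModule ℂ B]
    (f : S.ι → P.A →⋆ₐ[ℂ] B) (g : S.A →⋆ₐ[ℂ] B) : WreathFree P S →⋆ₐ[ℂ] B :=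
  FreeProd.lift (A := fun o => (wreathFamily P S o).A) (fun o => match o with
    | none => g
    | some i => f i)

theorem wreathPreLift_nu {B : Type v} [Ring B] [StarRing B] [Algebra ℂ B] [StarModule ℂ B]
    (f : S.ι → P.A →⋆ₐ[ℂ] B) (g : S.A →⋆ₐ[ℂ] B) (i : S.ι) (a : P.A) :
    wreathPreLift P S f g (preNu P S i a) = f i a := FreeProd.lift_inc _ _ _

theorem wreathPreLift_sigma {B : Type v} [Ring B] [StarRing B] [Algebra ℂ B] [StarModule ℂ B]
    (f : S.ι → P.A →⋆ₐ[ℂ] B) (g : S.A →⋆ₐ[ℂ] B) (a : S.A) :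
    wreathPreLift P S f g (preSigma P S a) = g a := FreeProd.lift_inc _ _ _

/-- The universal property of the free wreath product. -/
def wreathLift {B : Type v} [Ring B] [StarRing B] [Algebra ℂ B] [StarModule ℂ B]
    (f : S.ι → P.A →⋆ₐ[ℂ] B) (g : S.A →⋆ₐ[ℂ] B)
    (h : ∀ i j a, Commute (f i a) (g (S.U i j))) : WreathAlgebra P S →⋆ₐ[ℂ] B :=
  StarQuot.lift (wreathPreLift P S f g) (by
    rintro _ _ ⟨i, j, a⟩
    rw [map_mul, map_mul, wreathPreLift_nu, wreathPreLift_sigma]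
    exact h i j a)

section lift

variable {P S} {B : Type v} [Ring B] [StarRing B] [Algebra ℂ B] [StarModule ℂ B]
    (f : S.ι → P.A →⋆ₐ[ℂ] B) (g : S.A →⋆ₐ[ℂ] B)
    (h : ∀ i j a, Commute (f i a) (g (S.U i j)))

@[simp] theorem wreathLift_nu (i : S.ι) (a : P.A) :
    wreathLift P S f g h (nu P S i a) = f i a :=
  (StarQuot.lift_mk _ _ _).trans (wreathPreLift_nu _ _ _ _ _ _)

@[simp] theorem wreathLift_sigma (a : S.A) :
    wreathLift P S f g h (sigma P S a) = g a :=
  (StarQuot.lift_mk _ _ _).trans (wreathPreLift_sigma _ _ _ _ _)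

end lift

/-- The fundamental representation of the free wreath product, with coefficients
`s i j * ν i (u x y)`. -/
def wreathU : Matrix (P.ι × S.ι) (P.ι × S.ι) (WreathAlgebra P S) :=
  Matrix.of fun p q => sigma P S (S.U p.2 q.2) * nu P S p.2 (P.U p.1 q.1)

theorem wreathU_apply (p q : P.ι × S.ι) :
    wreathU P S p q = sigma P S (S.U p.2 q.2) * nu P S p.2 (P.U p.1 q.1) := rfl

theorem wreathU_magic : IsMagic (wreathU P S) where
  idem := by
    rintro ⟨x, i⟩ ⟨y, j⟩
    simp only [wreathU_apply]
    rw [mul_assoc, ← mul_assoc (nu P S i _), (nu_commute P S i j _).eq, mul_assoc, ← map_mul,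
      P.magic.idem, ← mul_assoc, ← map_mul, S.magic.idem]
  selfadj := by
    rintro ⟨x, i⟩ ⟨y, j⟩
    simp only [wreathU_apply]
    rw [star_mul, ← map_star, ← map_star, P.magic.selfadj, S.magic.selfadj,
      (nu_commute P S i j _).eq]
  row_orth := by
    rintro ⟨x, i⟩ ⟨y, j⟩ ⟨z, k⟩ h
    simp only [wreathU_apply]
    rw [mul_assoc, ← mul_assoc (nu P S i _), (nu_commute P S i k _).eq, mul_assoc, ← map_mul,
      ← mul_assoc, ← map_mul]
    by_cases hj : j = k
    · subst hj
      rw [P.magic.row_orth x y z (fun e => h (by rw [e])), map_zero, mul_zero]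
    · rw [S.magic.row_orth i j k hj, map_zero, zero_mul]
  col_orth := by
    rintro ⟨x, i⟩ ⟨z, k⟩ ⟨y, j⟩ h
    simp only [wreathU_apply]
    by_cases hj : i = k
    · subst hj
      rw [mul_assoc, ← mul_assoc (nu P S i _), (nu_commute P S i j _).eq, mul_assoc, ← map_mul,
        P.magic.col_orth x z y (fun e => h (by rw [e])), map_zero, mul_zero, mul_zero]
    · rw [← (nu_commute P S i j _).eq, mul_assoc, ← mul_assoc (sigma P S _), ← map_mul,
        S.magic.col_orth i k j hj, map_zero, zero_mul, mul_zero]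
  row_sum := by
    rintro ⟨x, i⟩
    simp only [wreathU_apply]
    rw [Fintype.sum_prod_type_right]
    simp only [← Finset.mul_sum, ← map_sum, P.magic.row_sum, map_one, mul_one, S.magic.row_sum]
  col_sum := by
    rintro ⟨y, j⟩
    simp only [wreathU_apply]
    rw [Fintype.sum_prod_type_right]
    simp only [← Finset.mul_sum, ← map_sum, P.magic.col_sum, map_one, mul_one, S.magic.col_sum]

/-- The `*`-morphism `a ↦ ∑ k, (ν i ⊗ ν k) (Δ a) * (s i k ⊗ 1)`. -/
def wreathComulNu (i : S.ι) : P.A →⋆ₐ[ℂ] WreathAlgebra P S ⊗[ℂ] WreathAlgebra P S :=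
  glue (fun k : S.ι => (tensorMap (nu P S i) (nu P S k)).comp P.comul)
    (fun k => sigma P S (S.U i k) ⊗ₜ 1)
    (fun k => by rw [Algebra.TensorProduct.tmul_mul_tmul, ← map_mul, S.magic.idem, mul_one])
    (fun k => by rw [TensorProduct.star_tmul, ← map_star, S.magic.selfadj, star_one])
    (fun k l h => by
      rw [Algebra.TensorProduct.tmul_mul_tmul, ← map_mul, S.magic.row_orth i k l h, map_zero,
        TensorProduct.zero_tmul])
    (by rw [← TensorProduct.sum_tmul, ← map_sum, S.magic.row_sum, map_one]; rfl)
    (fun k a => by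
      rw [StarAlgHom.comp_apply]
      induction P.comul a using TensorProduct.induction_on with
      | zero => simp
      | tmul a b =>
        rw [tensorMap_tmul, Commute, SemiconjBy, Algebra.TensorProduct.tmul_mul_tmul,
          Algebra.TensorProduct.tmul_mul_tmul, (nu_commute P S i k a).eq, mul_one, one_mul]
      | add x y hx hy => rw [map_add]; exact hx.add_left hy)

theorem sum_tmul_mul_tmul (i j k : S.ι) :
    (∑ l, sigma P S (S.U i l) ⊗ₜ[ℂ] sigma P S (S.U l j)) * (sigma P S (S.U i k) ⊗ₜ[ℂ] 1) =
      sigma P S (S.U i k) ⊗ₜ[ℂ] sigma P S (S.U k j) := by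
  rw [Finset.sum_mul, Finset.sum_eq_single k]
  · rw [Algebra.TensorProduct.tmul_mul_tmul, ← map_mul, S.magic.idem, mul_one]
  · intro l _ hl
    rw [Algebra.TensorProduct.tmul_mul_tmul, ← map_mul, S.magic.row_orth i l k hl, map_zero,
      TensorProduct.zero_tmul]
  · simp

theorem tmul_mul_sum_tmul (i j k : S.ι) :
    (sigma P S (S.U i k) ⊗ₜ[ℂ] 1) * (∑ l, sigma P S (S.U i l) ⊗ₜ[ℂ] sigma P S (S.U l j)) =
      sigma P S (S.U i k) ⊗ₜ[ℂ] sigma P S (S.U k j) := by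
  rw [Finset.mul_sum, Finset.sum_eq_single k]
  · rw [Algebra.TensorProduct.tmul_mul_tmul, ← map_mul, S.magic.idem, one_mul]
  · intro l _ hl
    rw [Algebra.TensorProduct.tmul_mul_tmul, ← map_mul, S.magic.row_orth i k l hl.symm, map_zero,
      TensorProduct.zero_tmul]
  · simp

theorem tensorMap_nu_commute (i j k : S.ι) (x : P.A ⊗[ℂ] P.A) :
    Commute (tensorMap (nu P S i) (nu P S k) x)
      (sigma P S (S.U i k) ⊗ₜ[ℂ] sigma P S (S.U k j)) := by
  induction x using TensorProduct.induction_on with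
  | zero => simp
  | tmul a b =>
    rw [tensorMap_tmul, Commute, SemiconjBy, Algebra.TensorProduct.tmul_mul_tmul,
      Algebra.TensorProduct.tmul_mul_tmul, (nu_commute P S i k a).eq, (nu_commute P S k j b).eq]
  | add x y hx hy => rw [map_add]; exact hx.add_left hy

theorem comul_sigma (i j : S.ι) :
    (tensorMap (sigma P S) (sigma P S)).comp S.comul (S.U i j) =
      ∑ l, sigma P S (S.U i l) ⊗ₜ[ℂ] sigma P S (S.U l j) := by
  rw [StarAlgHom.comp_apply, comul_U, map_sum]
  rfl

theorem wreathComulNu_mul (i j : S.ι) (a : P.A) :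
    wreathComulNu P S i a * (∑ l, sigma P S (S.U i l) ⊗ₜ[ℂ] sigma P S (S.U l j)) =
      ∑ k, tensorMap (nu P S i) (nu P S k) (P.comul a) *
        (sigma P S (S.U i k) ⊗ₜ[ℂ] sigma P S (S.U k j)) := by
  rw [wreathComulNu, glue_apply, Finset.sum_mul]
  refine Finset.sum_congr rfl fun k _ => ?_
  rw [mul_assoc, tmul_mul_sum_tmul]
  rfl

theorem mul_wreathComulNu (i j : S.ι) (a : P.A) :
    (∑ l, sigma P S (S.U i l) ⊗ₜ[ℂ] sigma P S (S.U l j)) * wreathComulNu P S i a =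
      ∑ k, (sigma P S (S.U i k) ⊗ₜ[ℂ] sigma P S (S.U k j)) *
        tensorMap (nu P S i) (nu P S k) (P.comul a) := by
  rw [wreathComulNu, glue_apply, Finset.mul_sum]
  refine Finset.sum_congr rfl fun k _ => ?_
  have h : Commute (tensorMap (nu P S i) (nu P S k) (P.comul a))
      (sigma P S (S.U i k) ⊗ₜ[ℂ] (1 : WreathAlgebra P S)) := by
    induction P.comul a using TensorProduct.induction_on with
    | zero => simp
    | tmul a b =>
      rw [tensorMap_tmul, Commute, SemiconjBy, Algebra.TensorProduct.tmul_mul_tmul,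
        Algebra.TensorProduct.tmul_mul_tmul, (nu_commute P S i k a).eq, mul_one, one_mul]
    | add x y hx hy => rw [map_add]; exact hx.add_left hy
  rw [StarAlgHom.comp_apply, h.eq, ← mul_assoc, sum_tmul_mul_tmul]

theorem wreathComul_commute (i j : S.ι) (a : P.A) :
    Commute (wreathComulNu P S i a)
      ((tensorMap (sigma P S) (sigma P S)).comp S.comul (S.U i j)) := by
  rw [comul_sigma, Commute, SemiconjBy, wreathComulNu_mul, mul_wreathComulNu]
  exact Finset.sum_congr rfl fun k _ => (tensorMap_nu_commute P S i j k _).eq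

/-- The comultiplication of the free wreath product. -/
def wreathComul : WreathAlgebra P S →⋆ₐ[ℂ] WreathAlgebra P S ⊗[ℂ] WreathAlgebra P S :=
  wreathLift P S (wreathComulNu P S) ((tensorMap (sigma P S) (sigma P S)).comp S.comul)
    (wreathComul_commute P S)

theorem wreathComul_U (p q : P.ι × S.ι) :
    wreathComul P S (wreathU P S p q) = ∑ r, wreathU P S p r ⊗ₜ[ℂ] wreathU P S r q := by
  obtain ⟨x, i⟩ := p
  obtain ⟨y, j⟩ := q
  rw [wreathU_apply, map_mul, wreathComul, wreathLift_nu, wreathLift_sigma, comul_sigma,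
    mul_wreathComulNu, Fintype.sum_prod_type_right]
  refine Finset.sum_congr rfl fun k _ => ?_
  rw [comul_U, map_sum, Finset.mul_sum]
  refine Finset.sum_congr rfl fun z _ => ?_
  rw [tensorMap_tmul, Algebra.TensorProduct.tmul_mul_tmul]
  rfl

/-- The free wreath product of `P` with `S`: the quotient of the free product of `S` and of the
copies `ν i` of `P`, one for each point `i` on which `S` acts, by the relations
`ν i (a) * s i j = s i j * ν i (a)`. Its fundamental representation is
`(s i j * ν i (u x y))`. -/
def wreath [Nonempty P.ι] : QuantumPermutationGroup.{u} where
  A := WreathAlgebra P S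
  ι := P.ι × S.ι
  U := wreathU P S
  magic := wreathU_magic P S
  generates := by
    set T := StarAlgebra.adjoin ℂ
      (Set.range fun p : (P.ι × S.ι) × (P.ι × S.ι) => wreathU P S p.1 p.2) with hT
    have hU : ∀ p q, wreathU P S p q ∈ T := fun p q => StarAlgebra.subset_adjoin ℂ _ ⟨(p, q), rfl⟩
    have hs : ∀ i j, sigma P S (S.U i j) ∈ T := by
      intro i j
      obtain ⟨x⟩ := ‹Nonempty P.ι›
      have h : sigma P S (S.U i j) = ∑ y, wreathU P S (x, i) (y, j) := by
        simp only [wreathU_apply]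
        rw [← Finset.mul_sum, ← map_sum, P.magic.row_sum, map_one, mul_one]
      rw [h]
      exact sum_mem fun y _ => hU _ _
    have hn : ∀ i x y, nu P S i (P.U x y) ∈ T := by
      intro i x y
      have h : nu P S i (P.U x y) = ∑ j, wreathU P S (x, i) (y, j) := by
        simp only [wreathU_apply]
        rw [← Finset.sum_mul, ← map_sum, S.magic.row_sum, map_one, one_mul]
      rw [h]
      exact sum_mem fun y _ => hU _ _
    rw [eq_top_iff]
    rintro a -
    obtain ⟨b, rfl⟩ := StarQuot.mk_surjective _ a
    refine FreeProd.mem_of_inc (T.comap (StarQuot.mk (WreathRel P S))) ?_ b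
    rintro (_ | i) a
    · exact S.map_mem (sigma P S) T hs a
    · exact P.map_mem (nu P S i) T (hn i) a
  exists_comul := ⟨wreathComul P S, wreathComul_U P S⟩

end wreath

end QuantumPermutationGroup

/-! ### Blocks, anchors and the operation `Ψ` -/

section Graph

variable {V : Type u} (G : SimpleGraph V)

/-- The set `S` induces a 2-connected subgraph: it is connected and stays so when a vertex is
removed. -/
def IsTwoConnected (S : Set V) : Prop :=
  (G.induce S).Connected ∧ ∀ v ∈ S, (G.induce (S \ {v})).Preconnected

/-- `B` is the vertex set of a block of `G`, that is, of a maximal 2-connected subgraph (such a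
subgraph is induced). -/
def IsBlock (B : Set V) : Prop := Maximal (IsTwoConnected G) B

/-- `v` is a cut vertex of the finite graph `G`: deleting it increases the number of connected
components. By convention the vertex of a graph with one vertex is a cut vertex. -/
def IsCutVertex (v : V) : Prop :=
  Nat.card V = 1 ∨ Nat.card G.ConnectedComponent < Nat.card (G.induce {v}ᶜ).ConnectedComponent

/-- `Q` is an anchor of the connected graph `G`: a cut vertex or a block. -/
def IsAnchor (Q : Set V) : Prop := (∃ r, IsCutVertex G r ∧ Q = {r}) ∨ IsBlock G Q

/-- `Q` is the canonical anchor of the connected graph `G`: the centre of `G` if it consists of a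
cut vertex, and otherwise a block that contains the centre. -/
def IsCanonicalAnchor (Q : Set V) : Prop :=
  (∃ r, IsCutVertex G r ∧ G.center = {r} ∧ Q = {r}) ∨
    ((¬ ∃ r, IsCutVertex G r ∧ G.center = {r}) ∧ IsBlock G Q ∧ G.center ⊆ Q)

end Graph

/-- The quantum automorphism group `Qu(G)` of a graph: marking all the vertices imposes no
condition on the magic unitary. -/
def quGraph {V : Type u} [Fintype V] (G : SimpleGraph V) : QuantumPermutationGroup.{u} :=
  MarkedGraph.Qu ⟨V, G, Set.univ⟩

/-- The quantum permutation group `S⁺` of a finite set: the quantum automorphism group of the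
graph without edges. -/
def sPlus (J : Type u) [Fintype J] : QuantumPermutationGroup.{u} := quGraph (⊥ : SimpleGraph J)

namespace MarkedGraph

/-- Adjacency in a disjoint union. -/
inductive SumAdj {I : Type u} (X : I → MarkedGraph.{u}) : (Σ i, (X i).V) → (Σ i, (X i).V) → Prop
  | mk (i : I) (x y : (X i).V) : (X i).graph.Adj x y → SumAdj X ⟨i, x⟩ ⟨i, y⟩

/-- The disjoint union of a finite family of marked graphs. -/
def sum {I : Type u} [Fintype I] (X : I → MarkedGraph.{u}) : MarkedGraph.{u} where
  V := Σ i, (X i).V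
  graph :=
    { Adj := SumAdj X
      symm := ⟨by rintro _ _ ⟨i, x, y, h⟩; exact ⟨i, y, x, h.symm⟩⟩
      loopless := ⟨by rintro _ ⟨i, x, _, h⟩; exact (X i).graph.loopless.irrefl x h⟩ }
  mark := {p | p.2 ∈ (X p.1).mark}

/-- `Ψ(G, {r})` for a cut vertex `r`: the disjoint union, over the connected components `C` of
`G \ {r}`, of the graphs `G[C ∪ {r}]` with the mark `r`. -/
def psiCut {V : Type u} [Fintype V] (G : SimpleGraph V) (r : V) : MarkedGraph.{u} :=
  letI : Fintype (G.induce {r}ᶜ).ConnectedComponent := Fintype.ofFinite _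
  sum fun c : (G.induce {r}ᶜ).ConnectedComponent =>
    { V := ((Subtype.val '' c.supp ∪ {r} : Set V) : Type u)
      fintype := Fintype.ofFinite _
      graph := G.induce (Subtype.val '' c.supp ∪ {r})
      mark := {x | x.1 = r} }

/-- `Ψ(G, Q)` for a block `Q`: remove from `G` all the edges in `Q`. -/
def psiBlock (X : MarkedGraph.{u}) : MarkedGraph.{u} where
  V := X.V
  graph := X.graph.deleteEdges {e | ∀ v ∈ e, v ∈ X.mark}
  mark := X.mark

open scoped Classical in
/-- The rooted graph `Ψ(G, Q)` of an anchored graph `(G, Q)`. -/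
def psi (X : MarkedGraph.{u}) : MarkedGraph.{u} :=
  if h : ∃ r, IsCutVertex X.graph r ∧ X.mark = {r} then psiCut X.graph h.choose else psiBlock X

section components

variable (X : MarkedGraph.{u})

/-- A connected component of a marked graph. -/
def component (c : X.graph.ConnectedComponent) : MarkedGraph.{u} where
  V := c.supp
  fintype := Fintype.ofFinite _
  graph := X.graph.induce c.supp
  mark := {x | x.1 ∈ X.mark}

/-- The set of quantum isomorphism classes of connected components of `X`: the quotient by
quantum isomorphism, which is an equivalence relation. -/
def QIClass : Type u :=
  Quot fun c d : X.graph.ConnectedComponent => QuantumIsomorphic (X.component c) (X.component d)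

/-- The quantum isomorphism class of a connected component. -/
def qiClass (c : X.graph.ConnectedComponent) : X.QIClass := Quot.mk _ c

instance : Fintype X.graph.ConnectedComponent := Fintype.ofFinite _

instance : Finite X.QIClass := Finite.of_surjective X.qiClass Quot.mk_surjective

instance : Fintype X.QIClass := Fintype.ofFinite _

/-- The set `J_l` of the connected components in the class `l`. -/
abbrev classMembers (l : X.QIClass) : Type u := {c // X.qiClass c = l}

instance (l : X.QIClass) : Fintype (X.classMembers l) := Fintype.ofFinite _

instance (c : X.graph.ConnectedComponent) : Nonempty (Qu (X.component c)).ι :=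
  c.nonempty_supp.to_subtype

/-- The free product, over the quantum isomorphism classes `l`, of the quantum automorphism groups
of the disjoint unions of the connected components in `l`. -/
def classFreeProd : QuantumPermutationGroup.{u} :=
  QuantumPermutationGroup.freeProd fun l : X.QIClass =>
    Qu (sum fun c : X.classMembers l => X.component c.1)

/-- The free product, over the quantum isomorphism classes `l`, of the free wreath products
`Qu(G_i, r_i) ≀ S⁺_{J_l}`, where `(G_i, r_i)` is the representative of `l` chosen by `rep`. -/
def wreathFreeProd (rep : X.QIClass → X.graph.ConnectedComponent) :
    QuantumPermutationGroup.{u} :=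
  QuantumPermutationGroup.freeProd fun l : X.QIClass =>
    QuantumPermutationGroup.wreath (Qu (X.component (rep l))) (sPlus (X.classMembers l))

end components

end MarkedGraph

end

end QuantumAut

open QuantumAut

namespace QuantumAut

noncomputable section

/-! ### Morphisms of quantum permutation groups -/

/-! A product `u a x * u b y` of coefficients of a magic unitary vanishes unless the scalar matrices
that it intertwines have equal entries at `(a, b)` and `(x, y)`. For powers of adjacency matrices
this says that a nonzero product forces `(a, b)` and `(x, y)` to be joined by equally many walks of
every length. Conversely, the vanishing relations for adjacency alone give the intertwining relation
back, so nearly every commutation to be checked becomes a list of vanishing products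
(`IsQuantumIso.mul_eq_zero`, `intertwines_of_mul_eq_zero`).

Walk counts determine distances, hence eccentricities and the centre. They also determine
separation: the generating series of the walks from `x` to `y` that avoid `v` can be computed from
the walk series among `x`, `y`, `v` (`powSeries_eraseCol_mul`). The blocks of a connected graph are
the maximal sets of vertices that are pairwise separated by no other vertex, and the centre is a set
of this kind. This gives the existence and uniqueness of the canonical anchor `Q` and describes it
in terms that quantum automorphisms preserve, whence `Qu(G) = Qu(G, Q)`.

Every component of `Ψ(G, Q)` has exactly one mark. If `Q` is a block, the relations survive the
deletion of the edges inside `Q`, and these edges can be restored when `Q` is complete. If `Q =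
{r}`, the copies of `r` carry the magic unitary of the action on the components of `G \ {r}`, which
is already determined by the other coefficients (`cutHom_bijective`).

It remains to split the quantum group of a rooted graph as a free product (`IsRooted.matching`).
Vertices `x` of one component have the same sum of `u x y` over the vertices `y` of a component, so
the rows and columns of each block indexed by two components sum up to a projection `q`, the
coefficient at the two roots. If `q ≠ 0`, restriction to the range of `q` in a Hilbert space
representation that does not kill `q` turns the block into a quantum isomorphism of the two
components. Hence the blocks between different quantum isomorphism classes vanish.

The analytic point is that such a representation exists although the algebra is only given by
generators and relations. A Haar functional is built on one corepresentation at a time, from a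
projection in the finite dimensional `*`-algebra of values of functionals, and then globally by
linear separation. It is positive, it does not vanish on nonzero coefficients `u x y`, and the GNS
representation is bounded because the algebra is generated by projections.

Finally, for a union of copies of a connected rooted graph, the coefficients at the roots form a
magic unitary `s i j`, the sums over the target copies are the `ν i (u x y)`, and the original
coefficients are the commuting products `s i j * ν i (u x y)` (`wreathMatching`). -/

theorem tensorMap_comp {A B C A' B' C' : Type u} [Ring A] [StarRing A] [Algebra ℂ A]
    [StarModule ℂ A] [Ring B] [StarRing B] [Algebra ℂ B] [StarModule ℂ B] [Ring C] [StarRing C]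
    [Algebra ℂ C] [StarModule ℂ C] [Ring A'] [StarRing A'] [Algebra ℂ A'] [StarModule ℂ A']
    [Ring B'] [StarRing B'] [Algebra ℂ B'] [StarModule ℂ B'] [Ring C'] [StarRing C']
    [Algebra ℂ C'] [StarModule ℂ C']
    (g : B →⋆ₐ[ℂ] C) (f : A →⋆ₐ[ℂ] B) (g' : B' →⋆ₐ[ℂ] C') (f' : A' →⋆ₐ[ℂ] B') (x : A ⊗[ℂ] A') :
    tensorMap (g.comp f) (g'.comp f') x = tensorMap g g' (tensorMap f f' x) := by
  induction x using TensorProduct.induction_on with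
  | zero => simp
  | tmul a b => simp
  | add x y hx hy => rw [map_add, map_add, map_add, hx, hy]

namespace QuantumPermutationGroup

/-- A unital `*`-morphism that is compatible with the comultiplications on the coefficients of the
fundamental representation is a morphism of quantum groups. -/
def Hom.ofGenerators {P Q : QuantumPermutationGroup.{u}} (f : P.A →⋆ₐ[ℂ] Q.A)
    (h : ∀ i j, Q.comul (f (P.U i j)) = ∑ k, f (P.U i k) ⊗ₜ[ℂ] f (P.U k j)) : Hom P Q where
  toStarAlgHom := f
  intertwines a := by
    have : (tensorMap f f).comp P.comul = Q.comul.comp f := hom_ext fun i j => by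
      rw [StarAlgHom.comp_apply, StarAlgHom.comp_apply, comul_U, h, map_sum]
      rfl
    exact DFunLike.congr_fun this a

/-- The composition of morphisms. -/
def Hom.comp {P Q R : QuantumPermutationGroup.{u}} (g : Hom Q R) (f : Hom P Q) : Hom P R where
  toStarAlgHom := g.toStarAlgHom.comp f.toStarAlgHom
  intertwines a := by
    rw [tensorMap_comp, f.intertwines, g.intertwines]
    rfl

/-- A `*`-morphism whose range contains the coefficients of the fundamental representation is
surjective. -/
theorem surjective_of_range {P : QuantumPermutationGroup.{u}} {B : Type v} [Ring B] [StarRing B]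
    [Algebra ℂ B] [StarModule ℂ B] (f : B →⋆ₐ[ℂ] P.A)
    (h : ∀ i j, ∃ b, f b = P.U i j) : Function.Surjective f := by
  intro a
  have : a ∈ f.range := P.map_mem (StarAlgHom.id ℂ P.A) f.range (fun i j => h i j) a
  exact this

/-- An identification of the quantum permutation groups `P` and `Q`, with their fundamental
representations. -/
structure Matching (P Q : QuantumPermutationGroup.{u}) where
  /-- the bijection between the sets on which the quantum groups act -/
  e : P.ι ≃ Q.ι
  /-- the morphism from `P` to `Q` -/
  toHom : P.A →⋆ₐ[ℂ] Q.A
  /-- the morphism from `Q` to `P` -/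
  invHom : Q.A →⋆ₐ[ℂ] P.A
  toHom_U : ∀ i j, toHom (P.U i j) = Q.U (e i) (e j)
  invHom_U : ∀ i j, invHom (Q.U (e i) (e j)) = P.U i j

namespace Matching

variable {P Q : QuantumPermutationGroup.{u}} (m : Matching P Q)

theorem left_inv (a : P.A) : m.invHom (m.toHom a) = a := by
  have : m.invHom.comp m.toHom = StarAlgHom.id ℂ P.A := hom_ext fun i j => by
    rw [StarAlgHom.comp_apply, m.toHom_U, m.invHom_U]; rfl
  exact DFunLike.congr_fun this a

theorem right_inv (a : Q.A) : m.toHom (m.invHom a) = a := by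
  have : m.toHom.comp m.invHom = StarAlgHom.id ℂ Q.A := hom_ext fun i j => by
    obtain ⟨i, rfl⟩ := m.e.surjective i
    obtain ⟨j, rfl⟩ := m.e.surjective j
    rw [StarAlgHom.comp_apply, m.invHom_U, m.toHom_U]; rfl
  exact DFunLike.congr_fun this a

/-- The morphism of quantum groups underlying an identification. -/
def hom : Hom P Q := Hom.ofGenerators m.toHom fun i j => by
  rw [m.toHom_U, comul_U, ← m.e.sum_comp]
  simp only [m.toHom_U]

theorem hom_bijective : Function.Bijective m.hom :=
  Function.bijective_iff_has_inverse.mpr ⟨m.invHom, m.left_inv, m.right_inv⟩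

/-- The composition of identifications. -/
def trans {R : QuantumPermutationGroup.{u}} (n : Matching Q R) : Matching P R where
  e := m.e.trans n.e
  toHom := n.toHom.comp m.toHom
  invHom := m.invHom.comp n.invHom
  toHom_U i j := by
    rw [StarAlgHom.comp_apply, m.toHom_U, n.toHom_U]
    rfl
  invHom_U i j := by
    rw [Equiv.trans_apply, Equiv.trans_apply, StarAlgHom.comp_apply, n.invHom_U, m.invHom_U]

/-- Identifications of the factors of free products. -/
def freeProd {L : Type u} [Fintype L] {P Q : L → QuantumPermutationGroup.{u}}
    (m : ∀ l, Matching (P l) (Q l)) :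
    Matching (QuantumPermutationGroup.freeProd P) (QuantumPermutationGroup.freeProd Q) where
  e := Equiv.sigmaCongrRight fun l => (m l).e
  toHom := FreeProd.lift fun l => (factorInc Q l).comp (m l).toHom
  invHom := FreeProd.lift fun l => (factorInc P l).comp (m l).invHom
  toHom_U := by
    rintro ⟨l, x⟩ ⟨k, y⟩
    change FreeProd.lift _ (freeProdU P _ _) = freeProdU Q ⟨l, (m l).e x⟩ ⟨k, (m k).e y⟩
    by_cases h : l = k
    · subst h
      rw [freeProdU_same, freeProdU_same, FreeProd.lift_inc, StarAlgHom.comp_apply, (m l).toHom_U]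
    · rw [freeProdU_ne _ h, freeProdU_ne _ h, map_zero]
  invHom_U := by
    rintro ⟨l, x⟩ ⟨k, y⟩
    change FreeProd.lift _ (freeProdU Q ⟨l, (m l).e x⟩ ⟨k, (m k).e y⟩) = freeProdU P _ _
    by_cases h : l = k
    · subst h
      rw [freeProdU_same, freeProdU_same, FreeProd.lift_inc, StarAlgHom.comp_apply, (m l).invHom_U]
    · rw [freeProdU_ne _ h, freeProdU_ne _ h, map_zero]

end Matching

end QuantumPermutationGroup

/-! ### Products of coefficients of quantum isomorphisms -/

section entries

variable {I J A : Type*} [Fintype I] [Fintype J] [Ring A] [StarRing A] [Algebra ℂ A]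

/-- If a magic unitary `U` intertwines two scalar matrices `M` and `N`, then
`u i j * u k l = 0` unless `M k i = N l j`. -/
theorem IsMagic.smul_mul_eq_zero {U : Matrix I J A} (hU : IsMagic U) {M : Matrix I I ℂ}
    {N : Matrix J J ℂ} (h : M.map (algebraMap ℂ A) * U = U * N.map (algebraMap ℂ A))
    (i k : I) (j l : J) : (M i k - N j l) • (U i j * U k l) = 0 := by
  have h1 := congrFun (congrFun h i) l
  simp only [Matrix.mul_apply, Matrix.map_apply] at h1
  -- Between `u i j` and `u k l`, the entry `(i, l)` of `M U = U N` loses all but one term on each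
  -- side: column orthogonality leaves only the index `k`, row orthogonality only the index `j`.
  have h2 := congrArg (fun x => U i j * x * U k l) h1
  simp only [Finset.mul_sum, Finset.sum_mul] at h2
  rw [Finset.sum_eq_single k, Finset.sum_eq_single j] at h2
  · rw [sub_smul, sub_eq_zero]
    calc M i k • (U i j * U k l) = U i j * (algebraMap ℂ A (M i k) * U k l) * U k l := by
          rw [← Algebra.smul_def, mul_smul_comm, smul_mul_assoc, mul_assoc, hU.idem]
      _ = U i j * (U i j * algebraMap ℂ A (N j l)) * U k l := h2
      _ = N j l • (U i j * U k l) := by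
          rw [← Algebra.commutes, ← Algebra.smul_def, mul_smul_comm, smul_mul_assoc, hU.idem]
  · intro j' _ hj
    rw [← mul_assoc, hU.row_orth i j j' hj.symm, zero_mul, zero_mul]
  · simp
  · intro i' _ hi
    rw [mul_assoc, mul_assoc, hU.col_orth i' k l hi, mul_zero, mul_zero]
  · simp

theorem IsMagic.mul_eq_zero_of_ne {U : Matrix I J A} (hU : IsMagic U) {M : Matrix I I ℂ}
    {N : Matrix J J ℂ} (h : M.map (algebraMap ℂ A) * U = U * N.map (algebraMap ℂ A))
    {i k : I} {j l : J} (hne : M i k ≠ N j l) : U i j * U k l = 0 := by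
  have := hU.smul_mul_eq_zero h i k j l
  exact (smul_eq_zero.mp this).resolve_left (sub_ne_zero.mpr hne)

/-- The coefficients of a column may be inserted into a nonzero product. -/
theorem IsMagic.exists_mul_mul_ne_zero {U : Matrix I J A}
    (hU : IsMagic U) {a b : I} {x y : J} (h : U a x * U b y ≠ 0) (z : J) :
    ∃ c, U a x * U c z * U b y ≠ 0 := by
  by_contra! hc
  refine h ?_
  rw [← mul_one (U a x), ← hU.col_sum z, Finset.mul_sum, Finset.sum_mul]
  exact Finset.sum_eq_zero fun c _ => hc c

end entries

namespace MarkedGraph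

variable {X Y : MarkedGraph.{u}} {A : Type v} [Ring A] [StarRing A] [Algebra ℂ A]

theorem adj_apply_of_adj {x y : X.V} (h : X.graph.Adj x y) : X.adj A x y = 1 := by
  simp [adj, h]

theorem adj_apply_of_not_adj {x y : X.V} (h : ¬ X.graph.Adj x y) : X.adj A x y = 0 := by
  simp [adj, h]

theorem adj_map_algebraMap : (X.adj ℂ).map (algebraMap ℂ A) = X.adj A := by
  ext x y
  by_cases h : X.graph.Adj x y
  · simp [adj_apply_of_adj h]
  · simp [adj_apply_of_not_adj h]

theorem IsQuantumIso.pow {U : Matrix Y.V X.V A} (hU : IsQuantumIso X Y U) [DecidableEq X.V]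
    [DecidableEq Y.V] (k : ℕ) :
    ((Y.adj ℂ) ^ k).map (algebraMap ℂ A) * U = U * ((X.adj ℂ) ^ k).map (algebraMap ℂ A) := by
  have hX := map_pow (algebraMap ℂ A).mapMatrix (X.adj ℂ) k
  have hY := map_pow (algebraMap ℂ A).mapMatrix (Y.adj ℂ) k
  simp only [RingHom.mapMatrix_apply, adj_map_algebraMap] at hX hY
  rw [hX, hY]
  induction k with
  | zero => simp
  | succ k ih =>
    specialize ih (map_pow (algebraMap ℂ A).mapMatrix (X.adj ℂ) k |>.trans (by
      simp [adj_map_algebraMap])) (map_pow (algebraMap ℂ A).mapMatrix (Y.adj ℂ) k |>.trans (by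
      simp [adj_map_algebraMap]))
    rw [pow_succ, pow_succ, Matrix.mul_assoc, ← hU.intertwines, ← Matrix.mul_assoc, ih,
      Matrix.mul_assoc]

/-- Entries of powers of the adjacency matrix count walks, so a nonzero product transports every
invariant of a pair of vertices that can be expressed through walk counts. -/
theorem IsQuantumIso.pow_eq {U : Matrix Y.V X.V A} (hU : IsQuantumIso X Y U) [DecidableEq X.V]
    [DecidableEq Y.V] {a b : Y.V} {x y : X.V} (h : U a x * U b y ≠ 0) (k : ℕ) :
    ((Y.adj ℂ) ^ k) a b = ((X.adj ℂ) ^ k) x y := by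
  by_contra hne
  exact h (hU.magic.mul_eq_zero_of_ne (hU.pow k) hne)

theorem IsQuantumIso.mul_eq_zero {U : Matrix Y.V X.V A} (hU : IsQuantumIso X Y U)
    {a b : Y.V} {x y : X.V} (h : ¬ (Y.graph.Adj a b ↔ X.graph.Adj x y)) : U a x * U b y = 0 := by
  classical
  refine hU.magic.mul_eq_zero_of_ne (M := Y.adj ℂ) (N := X.adj ℂ) ?_ ?_
  · simpa using hU.pow 1
  · by_cases hab : Y.graph.Adj a b <;> by_cases hxy : X.graph.Adj x y
    · simp [hab, hxy] at h
    · simp [adj_apply_of_adj hab, adj_apply_of_not_adj hxy]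
    · simp [adj_apply_of_not_adj hab, adj_apply_of_adj hxy]
    · simp [hab, hxy] at h

/-- A magic unitary intertwines the adjacency matrices as soon as its coefficients satisfy
the relations `u a x * u b y = 0` when exactly one of `a ~ b` and `x ~ y` holds. -/
theorem intertwines_of_mul_eq_zero {U : Matrix Y.V X.V A} (hU : IsMagic U)
    (h : ∀ a b x y, ¬ (Y.graph.Adj a b ↔ X.graph.Adj x y) → U a x * U b y = 0) :
    U * X.adj A = Y.adj A * U := by
  ext a y
  -- With `∑ b, u b y = 1` inserted on the right of one product and `∑ x, u a x = 1` on the left of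
  -- the other, both become double sums of `u a x * (scalar) * u b y`, to be compared term by term.
  have h1 : (U * X.adj A) a y = ∑ b, ∑ x, U a x * X.adj A x y * U b y := by
    simp only [Matrix.mul_apply]
    rw [← mul_one (∑ x, U a x * X.adj A x y), ← hU.col_sum y, Finset.sum_mul_sum, Finset.sum_comm]
  have h2 : (Y.adj A * U) a y = ∑ b, ∑ x, U a x * Y.adj A a b * U b y := by
    simp only [Matrix.mul_apply]
    refine Finset.sum_congr rfl fun b _ => ?_
    rw [← Finset.sum_mul, ← Finset.sum_mul, hU.row_sum, one_mul]
  rw [h1, h2]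
  refine Finset.sum_congr rfl fun b _ => Finset.sum_congr rfl fun x _ => ?_
  by_cases hab : Y.graph.Adj a b <;> by_cases hxy : X.graph.Adj x y
  · simp [adj_apply_of_adj hab, adj_apply_of_adj hxy]
  · simp [adj_apply_of_adj hab, adj_apply_of_not_adj hxy, h a b x y (by simp [hab, hxy])]
  · simp [adj_apply_of_not_adj hab, adj_apply_of_adj hxy, h a b x y (by simp [hab, hxy])]
  · simp [adj_apply_of_not_adj hab, adj_apply_of_not_adj hxy]

end MarkedGraph

end

end QuantumAut

namespace QuantumAut

noncomputable section

/-! ### Inseparable vertices and blocks -/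

section Graph

variable {V : Type u} (G : SimpleGraph V)

/-- There is a walk from `x` to `y` that avoids `v`. -/
def ReachAvoiding (v x y : V) : Prop := ∃ p : G.Walk x y, v ∉ p.support

/-- No vertex separates `x` from `y`. -/
def Inseparable (x y : V) : Prop := ∀ v, v ≠ x → v ≠ y → ReachAvoiding G v x y

variable {G}

theorem ReachAvoiding.symm {v x y : V} (h : ReachAvoiding G v x y) : ReachAvoiding G v y x := by
  obtain ⟨p, hp⟩ := h
  exact ⟨p.reverse, by simpa using hp⟩

theorem ReachAvoiding.trans {v x y z : V} (h : ReachAvoiding G v x y)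
    (h' : ReachAvoiding G v y z) : ReachAvoiding G v x z := by
  obtain ⟨p, hp⟩ := h
  obtain ⟨q, hq⟩ := h'
  exact ⟨p.append q, by simp [SimpleGraph.Walk.mem_support_append_iff, hp, hq]⟩

theorem Inseparable.symm {x y : V} (h : Inseparable G x y) : Inseparable G y x :=
  fun v hy hx => (h v hx hy).symm

theorem Inseparable.refl (x : V) : Inseparable G x x :=
  fun v hv _ => ⟨.nil, by simpa using hv⟩

/-- A walk inside `S` from a walk in the induced subgraph. -/
theorem exists_walk_of_induce_reachable {S : Set V} {x y : S} (h : (G.induce S).Reachable x y) :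
    ∃ p : G.Walk x.1 y.1, ∀ z ∈ p.support, z ∈ S := by
  obtain ⟨p⟩ := h
  refine ⟨p.map (SimpleGraph.Embedding.induce S).toHom, fun z hz => ?_⟩
  erw [SimpleGraph.Walk.support_map, List.mem_map] at hz
  obtain ⟨w, -, rfl⟩ := hz
  exact w.2

theorem ReachAvoiding.of_induce {S : Set V} {v : V} (hv : v ∉ S) {x y : S}
    (h : (G.induce S).Reachable x y) : ReachAvoiding G v x.1 y.1 := by
  obtain ⟨p, hp⟩ := exists_walk_of_induce_reachable h
  exact ⟨p, fun h => hv (hp v h)⟩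

theorem IsTwoConnected.inseparable {S : Set V} (hS : IsTwoConnected G S) {x y : V} (hx : x ∈ S)
    (hy : y ∈ S) : Inseparable G x y := by
  intro v hvx hvy
  by_cases hv : v ∈ S
  · exact ReachAvoiding.of_induce (S := S \ {v}) (by simp)
      (hS.2 v hv ⟨x, hx, fun h => hvx h.symm⟩ ⟨y, hy, fun h => hvy h.symm⟩)
  · exact ReachAvoiding.of_induce hv (hS.1.preconnected ⟨x, hx⟩ ⟨y, hy⟩)

variable (G) in
/-- The vertices of `K` are pairwise inseparable. -/
def IsInseparableSet (K : Set V) : Prop := ∀ x ∈ K, ∀ y ∈ K, Inseparable G x y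

/-- Two inseparable sets with two common vertices have an inseparable union. -/
theorem IsInseparableSet.union {K L : Set V} (hK : IsInseparableSet G K)
    (hL : IsInseparableSet G L) {x y : V} (hxy : x ≠ y) (hx : x ∈ K ∩ L) (hy : y ∈ K ∩ L) :
    IsInseparableSet G (K ∪ L) := by
  have key : ∀ z ∈ K, ∀ w ∈ L, Inseparable G z w := by
    intro z hz w hw v hvz hvw
    -- At least one of the two common vertices differs from `v`, and the walk is routed through that
    -- one.
    by_cases hvx : v = x
    · have hvy : v ≠ y := hvx ▸ hxy
      exact (hK z hz y hy.1 v hvz hvy).trans (hL y hy.2 w hw v hvy hvw)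
    · exact (hK z hz x hx.1 v hvz hvx).trans (hL x hx.2 w hw v hvx hvw)
  rintro z (hz | hz) w (hw | hw)
  · exact hK z hz w hw
  · exact key z hz w hw
  · exact (key w hw z hz).symm
  · exact hL z hz w hw

theorem Maximal.eq_of_inseparable_union {K L : Set V} (hK : Maximal (IsInseparableSet G) K)
    (hL : Maximal (IsInseparableSet G) L) (h : IsInseparableSet G (K ∪ L)) : K = L :=
  (hK.eq_of_subset h Set.subset_union_left).trans
    (hL.eq_of_subset h Set.subset_union_right).symm

/-- A path between two vertices of a maximal inseparable set stays in it. -/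
theorem mem_of_isPath {K : Set V} (hK : Maximal (IsInseparableSet G) K) {z w t : V} (hz : z ∈ K)
    (hw : w ∈ K) {p : G.Walk z w} (hp : p.IsPath) (ht : t ∈ p.support) : t ∈ K := by
  obtain ⟨q, r, -, -, rfl⟩ := hp.mem_support_iff_exists_append.mp ht
  have key : ∀ x ∈ K, Inseparable G t x := by
    intro x hx v hvt hvx
    -- A vertex other than `t` lies on at most one side of `t` along a path. The other side leads
    -- from `t` to an end of the path, which is in `K`, and avoids `v`.
    have : v ∉ q.support ∨ v ∉ r.support := by
      by_contra! h
      exact hp.ne_of_mem_support_of_append hvt h.1 h.2 rfl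
    rcases this with h | h
    · have hvz : v ≠ z := fun e => h (e ▸ q.start_mem_support)
      exact ReachAvoiding.trans ⟨q.reverse, by simpa using h⟩ (hK.prop z hz x hx v hvz hvx)
    · have hvw : v ≠ w := fun e => h (e ▸ r.end_mem_support)
      exact ReachAvoiding.trans ⟨r, h⟩ (hK.prop w hw x hx v hvw hvx)
  have : IsInseparableSet G (insert t K) := by
    rintro x (rfl | hx) y (rfl | hy)
    · exact Inseparable.refl _
    · exact key y hy
    · exact (key x hx).symm
    · exact hK.prop x hx y hy
  rw [hK.eq_of_subset this (Set.subset_insert t K)]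
  exact Set.mem_insert t K

theorem Maximal.nonempty_of_inseparable [Nonempty V] {K : Set V}
    (hK : Maximal (IsInseparableSet G) K) : K.Nonempty := by
  rw [Set.nonempty_iff_ne_empty]
  rintro rfl
  obtain ⟨x⟩ := ‹Nonempty V›
  have : IsInseparableSet G {x} := by
    rintro _ rfl _ rfl
    exact Inseparable.refl _
  have := hK.eq_of_subset this (Set.empty_subset _)
  exact (Set.singleton_ne_empty x) this.symm

/-- Paths between vertices of `K` do not leave `K`, by `mem_of_isPath`. Thus both the connectedness
of `G` and the walks that avoid `v` are realised inside `K`, once walks have been shortened to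
paths. -/
theorem isTwoConnected_of_maximal (hG : G.Connected) {K : Set V}
    (hK : Maximal (IsInseparableSet G) K) : IsTwoConnected G K := by
  classical
  have := hG.nonempty
  have hne := Maximal.nonempty_of_inseparable hK
  refine ⟨(SimpleGraph.connected_iff _).mpr ⟨?_, hne.to_subtype⟩, ?_⟩
  · rintro ⟨x, hx⟩ ⟨y, hy⟩
    obtain ⟨p, hp⟩ := (hG.preconnected x y).exists_isPath
    exact ⟨p.induce K fun t ht => mem_of_isPath hK hx hy hp ht⟩
  · rintro v - ⟨x, hx, hxv⟩ ⟨y, hy, hyv⟩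
    obtain ⟨p, hp⟩ := hK.prop x hx y hy v (fun h => hxv h.symm) (fun h => hyv h.symm)
    refine ⟨p.bypass.induce (K \ {v}) fun t ht =>
      ⟨mem_of_isPath hK hx hy p.bypass_isPath ht, ?_⟩⟩
    rintro rfl
    exact hp (p.support_bypass_subset_support ht)

variable [Finite V]

/-- An inseparable set is contained in a maximal one. -/
theorem IsInseparableSet.exists_maximal {K : Set V} (hK : IsInseparableSet G K) :
    ∃ L, K ⊆ L ∧ Maximal (IsInseparableSet G) L :=
  (Set.toFinite {L : Set V | IsInseparableSet G L}).exists_le_maximal hK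

/-- Blocks are the maximal inseparable sets. -/
theorem isBlock_iff (hG : G.Connected) {B : Set V} :
    IsBlock G B ↔ Maximal (IsInseparableSet G) B := by
  have key : ∀ {S}, IsTwoConnected G S → IsInseparableSet G S :=
    fun h x hx y hy => h.inseparable hx hy
  constructor
  · intro h
    obtain ⟨L, hL, hmax⟩ := (key h.prop).exists_maximal
    rwa [h.eq_of_subset (isTwoConnected_of_maximal hG hmax) hL]
  · intro h
    refine ⟨isTwoConnected_of_maximal hG h, fun S hS hle => ?_⟩
    exact h.2 (key hS) hle

/-! ### The centre and the canonical anchor -/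

/-- The vertices of the centre are pairwise inseparable. -/
theorem isInseparableSet_center (hG : G.Connected) : IsInseparableSet G G.center := by
  classical
  -- Let `t` be farthest from `v`. If a geodesic from the central vertex `z` to `t` met `v`, then
  -- the eccentricity of `z` would be at least `1` plus that of `v`, hence larger than the radius.
  -- Two central vertices can therefore be joined through `t` without meeting `v`.
  have key : ∀ z ∈ G.center, ∀ v, v ≠ z → ∀ t, G.edist v t = G.eccent v →
      ReachAvoiding G v z t := by
    intro z hz v hvz t ht
    by_contra hno
    obtain ⟨p, hp⟩ := hG.exists_walk_length_eq_edist z t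
    have hv : v ∈ p.support := by
      by_contra h
      exact hno ⟨p, h⟩
    obtain ⟨q, r, rfl⟩ := p.mem_support_iff_exists_append.mp hv
    have h1 : 1 ≤ (q.length : ℕ∞) := by
      rw [Nat.one_le_cast]
      by_contra h
      exact hvz (SimpleGraph.Walk.eq_of_length_eq_zero (by omega : q.length = 0)).symm
    have h2 : G.eccent v ≤ r.length := by
      rw [← ht]; exact SimpleGraph.edist_le r
    have h3 : G.eccent z = G.radius := hz
    have h4 : G.radius ≤ G.eccent v := SimpleGraph.radius_le_eccent
    have h5 : G.edist z t ≤ G.eccent z := SimpleGraph.edist_le_eccent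
    rw [← hp, SimpleGraph.Walk.length_append, Nat.cast_add, h3] at h5
    have h6 := (add_le_add h1 h2).trans (h5.trans h4)
    -- Finiteness is what makes `1 + eccent v ≤ eccent v` absurd in `ℕ∞`.
    have h7 : G.eccent v ≠ ⊤ := ne_top_of_le_ne_top (ENat.natCast_ne_top r.length) h2
    revert h6
    lift G.eccent v to ℕ using h7 with n
    norm_cast
    omega
  intro z hz w hw v hvz hvw
  obtain ⟨t, ht⟩ := G.exists_edist_eq_eccent_of_finite v
  exact (key z hz v hvz t ht).trans (key w hw v hvw t ht).symm

theorem reachAvoiding_of_not_isCutVertex (hG : G.Connected) {r : V} (hr : ¬ IsCutVertex G r)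
    {x y : V} (hx : r ≠ x) (hy : r ≠ y) : ReachAvoiding G r x y := by
  have h1 : Nat.card G.ConnectedComponent = 1 := by
    have := hG.preconnected.subsingleton_connectedComponent
    have := hG.nonempty
    exact Nat.card_unique
  have h2 : Nat.card (G.induce {r}ᶜ).ConnectedComponent ≤ 1 := by
    rw [← h1]
    exact not_lt.mp fun h => hr (Or.inr h)
  have h3 : Subsingleton (G.induce {r}ᶜ).ConnectedComponent :=
    Finite.card_le_one_iff_subsingleton.mp h2
  have h4 : (G.induce {r}ᶜ).Reachable ⟨x, fun h => hx h.symm⟩ ⟨y, fun h => hy h.symm⟩ :=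
    SimpleGraph.ConnectedComponent.exact (Subsingleton.elim _ _)
  exact ReachAvoiding.of_induce (by simp) h4

/-- A vertex `v ≠ r` is avoided by passing through the common vertex `r`, and `r` itself separates
nothing because it is not a cut vertex. So the union of the two sets is still inseparable, and
maximality applies to both. -/
theorem eq_of_mem_of_not_isCutVertex (hG : G.Connected) {r : V} (hr : ¬ IsCutVertex G r)
    {K L : Set V} (hK : Maximal (IsInseparableSet G) K) (hL : Maximal (IsInseparableSet G) L)
    (hrK : r ∈ K) (hrL : r ∈ L) : K = L := by
  refine Maximal.eq_of_inseparable_union hK hL ?_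
  have key : ∀ z ∈ K, ∀ w ∈ L, Inseparable G z w := by
    intro z hz w hw v hvz hvw
    by_cases hvr : v = r
    · subst hvr
      exact reachAvoiding_of_not_isCutVertex hG hr hvz hvw
    · exact (hK.prop z hz r hrK v hvz hvr).trans (hL.prop r hrL w hw v hvr hvw)
  rintro z (hz | hz) w (hw | hw)
  · exact hK.prop z hz w hw
  · exact key z hz w hw
  · exact (key w hw z hz).symm
  · exact hL.prop z hz w hw

/-- Unless the centre is a cut vertex, it is contained in at most one block. -/
theorem eq_of_center_subset (hG : G.Connected)
    (hc : ¬ ∃ r, IsCutVertex G r ∧ G.center = {r}) {K L : Set V}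
    (hK : Maximal (IsInseparableSet G) K) (hL : Maximal (IsInseparableSet G) L)
    (hcK : G.center ⊆ K) (hcL : G.center ⊆ L) : K = L := by
  have := hG.nonempty
  obtain ⟨r, hr⟩ := G.center_nonempty
  -- Two central vertices are two common vertices of `K` and `L`. A single central vertex is not a
  -- cut vertex by `hc`, so one common vertex is enough.
  by_cases h : ∃ s ∈ G.center, r ≠ s
  · obtain ⟨s, hs, hrs⟩ := h
    exact Maximal.eq_of_inseparable_union hK hL
      (hK.prop.union hL.prop hrs ⟨hcK hr, hcL hr⟩ ⟨hcK hs, hcL hs⟩)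
  · push Not at h
    have hcr : G.center = {r} := Set.eq_singleton_iff_unique_mem.mpr ⟨hr, fun s hs => (h s hs).symm⟩
    exact eq_of_mem_of_not_isCutVertex hG (fun h => hc ⟨r, h, hcr⟩) hK hL (hcK hr) (hcL hr)

theorem existsUnique_isCanonicalAnchor (hG : G.Connected) : ∃! Q, IsCanonicalAnchor G Q := by
  by_cases hc : ∃ r, IsCutVertex G r ∧ G.center = {r}
  · obtain ⟨r, hr, hcr⟩ := hc
    refine ⟨{r}, Or.inl ⟨r, hr, hcr, rfl⟩, ?_⟩
    rintro Q (⟨s, -, hcs, rfl⟩ | ⟨h, -⟩)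
    · rw [← hcs, hcr]
    · exact absurd ⟨r, hr, hcr⟩ h
  · obtain ⟨B, hB, hmax⟩ := (isInseparableSet_center hG).exists_maximal
    refine ⟨B, Or.inr ⟨hc, (isBlock_iff hG).mpr hmax, hB⟩, ?_⟩
    rintro Q (⟨s, hs, hcs, rfl⟩ | ⟨-, hQ, hcQ⟩)
    · exact absurd ⟨s, hs, hcs⟩ hc
    · exact eq_of_center_subset hG hc ((isBlock_iff hG).mp hQ) hmax hcQ hB

theorem IsCanonicalAnchor.isAnchor {Q : Set V} (h : IsCanonicalAnchor G Q) : IsAnchor G Q := by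
  rcases h with ⟨r, hr, -, rfl⟩ | ⟨-, h, -⟩
  · exact Or.inl ⟨r, hr, rfl⟩
  · exact Or.inr h

/-- A canonical anchor that is a block consists of the vertices that no vertex separates from the
centre. -/
theorem mem_block_iff_of_center_subset (hG : G.Connected)
    (hc : ¬ ∃ r, IsCutVertex G r ∧ G.center = {r}) {K : Set V}
    (hK : Maximal (IsInseparableSet G) K) (hcK : G.center ⊆ K) (x : V) :
    x ∈ K ↔ ∀ z ∈ G.center, Inseparable G x z := by
  refine ⟨fun hx z hz => hK.prop x hx z (hcK hz), fun hx => ?_⟩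
  -- The centre together with `x` extends to a maximal inseparable set, which must be `K` by
  -- uniqueness.
  have : IsInseparableSet G (insert x G.center) := by
    rintro y (rfl | hy) z (rfl | hz)
    · exact Inseparable.refl _
    · exact hx z hz
    · exact (hx y hy).symm
    · exact isInseparableSet_center hG y hy z hz
  obtain ⟨L, hL, hmax⟩ := this.exists_maximal
  rw [eq_of_center_subset hG hc hK hmax hcK ((Set.subset_insert _ _).trans hL)]
  exact hL (Set.mem_insert _ _)

end Graph

end

end QuantumAut

namespace QuantumAut

noncomputable section

open scoped ComplexOrder

/-! ### Separation and the powers of the adjacency matrix -/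

section walks

variable {V : Type u} [Fintype V] [DecidableEq V]

/-- The matrix `M` with the column `v` replaced by zero. -/
def eraseCol (M : Matrix V V ℂ) (v : V) : Matrix V V ℂ :=
  Matrix.of fun x y => if y = v then 0 else M x y

/-- The generating series of the entries `(x, y)` of the powers of `M`. -/
def powSeries (M : Matrix V V ℂ) (x y : V) : PowerSeries ℂ := PowerSeries.mk fun k => (M ^ k) x y

/-- Erasing the column only forbids steps into `v`. From a start `x ≠ v` this amounts to avoiding
`v` altogether, so the row `v` need not be erased. -/
theorem eraseCol_pow_apply_self (M : Matrix V V ℂ) {v x : V} (hx : v ≠ x) (k : ℕ) :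
    ((eraseCol M v) ^ k) x v = 0 := by
  cases k with
  | zero => simp [hx.symm]
  | succ k => simp [pow_succ, Matrix.mul_apply, eraseCol]

/-- This is a telescoping sum over the position of the factor `M - N`. For `N = eraseCol M v` that
factor is the column `v`, and its position is the time of the first step into `v`. -/
theorem pow_succ_eq_add_sum {R : Type*} [Ring R] (M N : R) (k : ℕ) :
    M ^ (k + 1) = N ^ (k + 1) +
      ∑ p ∈ Finset.HasAntidiagonal.antidiagonal k, N ^ p.1 * (M - N) * M ^ p.2 := by
  induction k with
  | zero => simp
  | succ k ih =>
    rw [Finset.Nat.sum_antidiagonal_succ]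
    simp only [pow_zero, one_mul, pow_succ' N (_ + 1)]
    rw [pow_succ' M, show M * M ^ (k + 1) = N * M ^ (k + 1) + (M - N) * M ^ (k + 1) by noncomm_ring]
    nth_rewrite 1 [ih]
    rw [mul_add, Finset.mul_sum, add_assoc, add_comm (Finset.sum _ _)]
    congr 2
    exact Finset.sum_congr rfl fun p _ => by rw [pow_succ']; noncomm_ring

/-- Decomposition of walks according to the first passage through `v`. -/
theorem powSeries_eq (M : Matrix V V ℂ) (v x y : V) :
    powSeries M x y = powSeries (eraseCol M v) x y + PowerSeries.X *
      (PowerSeries.mk (fun k => ((eraseCol M v) ^ k * M) x v) * powSeries M v y) := by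
  have hE : ∀ z w, (M - eraseCol M v) z w = if w = v then M z v else 0 := by
    intro z w
    by_cases h : w = v
    · simp [eraseCol, h]
    · simp [eraseCol, h]
  ext k
  cases k with
  | zero => simp [powSeries]
  | succ k =>
    rw [map_add, PowerSeries.coeff_succ_X_mul, PowerSeries.coeff_mul]
    simp only [powSeries, PowerSeries.coeff_mk]
    rw [pow_succ_eq_add_sum M (eraseCol M v) k, Matrix.add_apply, Matrix.sum_apply]
    congr 1
    refine Finset.sum_congr rfl fun p _ => ?_
    rw [Matrix.mul_apply, Finset.sum_eq_single v]
    · simp [Matrix.mul_apply, hE]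
    · intro w _ hw
      simp [Matrix.mul_apply, hE, hw]
    · simp

/-- The series of the walks from `x` to `y` that avoid `v` is determined by the series of the
walks between the vertices `x`, `y` and `v`. -/
theorem powSeries_eraseCol_mul (M : Matrix V V ℂ) {v x : V} (hx : v ≠ x) (y : V) :
    powSeries (eraseCol M v) x y * powSeries M v v =
      powSeries M x y * powSeries M v v - powSeries M x v * powSeries M v y := by
  have h : powSeries (eraseCol M v) x v = 0 := by
    ext k
    simp [powSeries, eraseCol_pow_apply_self M hx]
  -- For `y = v` the walks that avoid `v` contribute nothing, so the series of first passages times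
  -- the series of returns to `v` is the series from `x` to `v`. This eliminates the first passages
  -- from the general formula.
  have h1 := powSeries_eq M v x v
  rw [h, zero_add] at h1
  rw [h1, powSeries_eq M v x y]
  ring

theorem powSeries_self_ne_zero (M : Matrix V V ℂ) (v : V) : powSeries M v v ≠ 0 := by
  intro h
  have := congrArg (PowerSeries.coeff 0) h
  simp [powSeries] at this

/-- Power series over `ℂ` have no zero divisors and the series of returns to `v` has constant
coefficient `1`. Hence separation by `v` becomes an identity between walk series, which quantum
isomorphisms transport. -/
theorem powSeries_eraseCol_eq_zero_iff (M : Matrix V V ℂ) {v x : V} (hx : v ≠ x) (y : V) :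
    powSeries (eraseCol M v) x y = 0 ↔
      powSeries M x y * powSeries M v v = powSeries M x v * powSeries M v y := by
  rw [← sub_eq_zero (a := _ * _), ← powSeries_eraseCol_mul M hx, mul_eq_zero,
    or_iff_left (powSeries_self_ne_zero M v)]

end walks

namespace MarkedGraph

variable {X Y : MarkedGraph.{u}}

theorem adj_nonneg (x y : X.V) : 0 ≤ X.adj ℂ x y := by
  by_cases h : X.graph.Adj x y
  · simp [adj_apply_of_adj h]
  · simp [adj_apply_of_not_adj h]

theorem eraseCol_nonneg [DecidableEq X.V] (v x y : X.V) : 0 ≤ eraseCol (X.adj ℂ) v x y := by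
  simp only [eraseCol, Matrix.of_apply]
  split_ifs
  · exact le_rfl
  · exact adj_nonneg x y

theorem eraseCol_pow_nonneg [DecidableEq X.V] (v x y : X.V) (k : ℕ) :
    0 ≤ (eraseCol (X.adj ℂ) v ^ k) x y := by
  induction k generalizing y with
  | zero => rw [pow_zero, Matrix.one_apply]; split_ifs <;> simp
  | succ k ih =>
    rw [pow_succ, Matrix.mul_apply]
    exact Finset.sum_nonneg fun z _ => mul_nonneg (ih z) (eraseCol_nonneg v z y)

/-- The entries of the powers of the adjacency matrix of `G - v` detect the walks that
avoid `v`. -/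
theorem reachAvoiding_iff [DecidableEq X.V] {v x : X.V} (hx : v ≠ x) (y : X.V) :
    ReachAvoiding X.graph v x y ↔ powSeries (eraseCol (X.adj ℂ) v) x y ≠ 0 := by
  constructor
  · rintro ⟨p, hp⟩
    suffices h : ∃ k, (eraseCol (X.adj ℂ) v ^ k) x y ≠ 0 by
      obtain ⟨k, hk⟩ := h
      exact fun h => hk (by simpa [powSeries] using congrArg (PowerSeries.coeff k) h)
    induction p using SimpleGraph.Walk.concatRec with
    | Hnil => exact ⟨0, by simp⟩
    | @Hconcat a b c p h ih =>
      rw [SimpleGraph.Walk.support_concat, List.mem_append, List.mem_singleton] at hp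
      push Not at hp
      obtain ⟨k, hk⟩ := ih hx hp.1
      refine ⟨k + 1, ?_⟩
      rw [pow_succ, Matrix.mul_apply]
      -- All entries are nonnegative, so one nonzero term cannot be cancelled by the others.
      refine ne_of_gt (lt_of_lt_of_le ?_ (Finset.single_le_sum (f := fun z =>
        (eraseCol (X.adj ℂ) v ^ k) a z * eraseCol (X.adj ℂ) v z c)
        (fun z _ => mul_nonneg (eraseCol_pow_nonneg v a z k) (eraseCol_nonneg v z c))
        (Finset.mem_univ b)))
      have : eraseCol (X.adj ℂ) v b c = 1 := by
        simp [eraseCol, hp.2.symm, adj_apply_of_adj h]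
      simp only [this, mul_one]
      exact lt_of_le_of_ne (eraseCol_pow_nonneg v a b k) hk.symm
  · intro h
    obtain ⟨k, hk⟩ : ∃ k, (eraseCol (X.adj ℂ) v ^ k) x y ≠ 0 := by
      by_contra! hc
      exact h (by ext k; simp [powSeries, hc])
    clear h
    induction k generalizing y with
    | zero =>
      have : x = y := by
        by_contra hne
        simp [hne] at hk
      subst this
      exact ⟨.nil, by simpa using hx⟩
    | succ k ih =>
      rw [pow_succ, Matrix.mul_apply] at hk
      obtain ⟨z, -, hz⟩ := Finset.exists_ne_zero_of_sum_ne_zero hk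
      obtain ⟨p, hp⟩ := ih z (left_ne_zero_of_mul hz)
      have h2 := right_ne_zero_of_mul hz
      have hyv : y ≠ v := by
        rintro rfl
        simp [eraseCol] at h2
      have hadj : X.graph.Adj z y := by
        by_contra hn
        simp [eraseCol, adj_apply_of_not_adj hn] at h2
      refine ⟨p.concat hadj, ?_⟩
      rw [SimpleGraph.Walk.support_concat, List.mem_append, List.mem_singleton]
      push Not
      exact ⟨hp, fun h => hyv h.symm⟩

/-! ### Transport of separation along quantum isomorphisms -/

variable {A : Type v} [Ring A] [StarRing A] [Algebra ℂ A]

theorem _root_.QuantumAut.IsMagic.transpose {I J : Type*} [Fintype I] [Fintype J] {U : Matrix I J A}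
    (hU : IsMagic U) : IsMagic U.transpose where
  idem i j := hU.idem j i
  selfadj i j := hU.selfadj j i
  row_orth i j k h := hU.col_orth j k i h
  col_orth i k j h := hU.row_orth j i k h
  row_sum i := hU.col_sum i
  col_sum j := hU.row_sum j

/-- The vanishing relations treat the two graphs symmetrically. Through this lemma each implication
between invariants of rows and columns yields its converse. -/
theorem IsQuantumIso.transpose {U : Matrix Y.V X.V A} (hU : IsQuantumIso X Y U) :
    IsQuantumIso Y X U.transpose where
  magic := hU.magic.transpose
  intertwines := intertwines_of_mul_eq_zero hU.magic.transpose fun _ _ _ _ h =>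
    hU.mul_eq_zero fun h' => h h'.symm
  mark x a h := hU.mark a x fun h' => h h'.symm

theorem IsQuantumIso.powSeries_eq [DecidableEq X.V] [DecidableEq Y.V] {U : Matrix Y.V X.V A}
    (hU : IsQuantumIso X Y U) {a b : Y.V} {x y : X.V} (h : U a x * U b y ≠ 0) :
    powSeries (Y.adj ℂ) a b = powSeries (X.adj ℂ) x y := by
  ext k
  simpa [powSeries] using hU.pow_eq h k

/-- Quantum isomorphisms preserve inseparability. -/
theorem IsQuantumIso.inseparable {U : Matrix Y.V X.V A} (hU : IsQuantumIso X Y U) {a b : Y.V}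
    {x y : X.V} (h : U a x * U b y ≠ 0) (hab : Inseparable Y.graph a b) :
    Inseparable X.graph x y := by
  classical
  intro v hvx hvy
  -- The column `v` sums up to `1`, so some `c` plays the part of `v` next to `a` and `b`: all four
  -- walk series in the criterion for separation agree on `x, y, v` and `a, b, c`.
  obtain ⟨c, hc⟩ := hU.magic.exists_mul_mul_ne_zero h v
  have h1 := left_ne_zero_of_mul hc
  have h2 : U c v * U b y ≠ 0 := by
    rw [mul_assoc] at hc
    exact right_ne_zero_of_mul hc
  have h3 : U c v * U c v ≠ 0 := by
    rw [hU.magic.idem]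
    exact left_ne_zero_of_mul h2
  have hca : c ≠ a := by
    rintro rfl
    exact h1 (hU.magic.row_orth _ _ _ hvx.symm)
  have hcb : c ≠ b := by
    rintro rfl
    exact h2 (hU.magic.row_orth _ _ _ hvy)
  rw [reachAvoiding_iff hvx, Ne, powSeries_eraseCol_eq_zero_iff _ hvx,
    ← hU.powSeries_eq h, ← hU.powSeries_eq h1, ← hU.powSeries_eq h2, ← hU.powSeries_eq h3,
    ← powSeries_eraseCol_eq_zero_iff _ hca]
  exact (reachAvoiding_iff hca b).mp (hab c hca hcb)

/-! ### Quantum automorphisms preserve the canonical anchor -/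

theorem adj_pow_apply_ne_zero_iff [DecidableEq X.V] (x y : X.V) (k : ℕ) :
    (X.adj ℂ ^ k) x y ≠ 0 ↔ ∃ p : X.graph.Walk x y, p.length = k := by
  classical
  rw [show X.adj ℂ = X.graph.adjMatrix ℂ by simp only [adj],
    SimpleGraph.adjMatrix_pow_apply_eq_card_walk, Nat.cast_ne_zero, ← Nat.pos_iff_ne_zero,
    Fintype.card_pos_iff, Set.nonempty_coe_sort]
  rfl

theorem IsQuantumIso.edist_eq {U : Matrix Y.V X.V A} (hU : IsQuantumIso X Y U) {a b : Y.V}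
    {x y : X.V} (h : U a x * U b y ≠ 0) : Y.graph.edist a b = X.graph.edist x y := by
  classical
  have : ∀ k, (∃ p : Y.graph.Walk a b, p.length = k) ↔ ∃ p : X.graph.Walk x y, p.length = k := by
    intro k
    rw [← adj_pow_apply_ne_zero_iff, ← adj_pow_apply_ne_zero_iff, hU.pow_eq h]
  rw [SimpleGraph.edist_eq_sInf, SimpleGraph.edist_eq_sInf]
  congr 1
  ext n
  constructor
  · rintro ⟨p, rfl⟩
    obtain ⟨q, hq⟩ := (this _).mp ⟨p, rfl⟩
    exact ⟨q, by simp [hq]⟩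
  · rintro ⟨p, rfl⟩
    obtain ⟨q, hq⟩ := (this _).mpr ⟨p, rfl⟩
    exact ⟨q, by simp [hq]⟩

/-- Since rows and columns sum up to `1`, every `b` has a partner `y` with `u a x * u b y ≠ 0`, and
conversely. Distances to `a` and distances to `x` thus take the same values. -/
theorem IsQuantumIso.eccent_eq {U : Matrix Y.V X.V A} (hU : IsQuantumIso X Y U) {a : Y.V}
    {x : X.V} (h : U a x ≠ 0) : Y.graph.eccent a = X.graph.eccent x := by
  apply le_antisymm
  · rw [SimpleGraph.eccent_le_iff]
    intro b
    obtain ⟨y, hy⟩ : ∃ y, U a x * U b y ≠ 0 := by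
      by_contra! hc
      refine h ?_
      rw [← mul_one (U a x), ← hU.magic.row_sum b, Finset.mul_sum]
      exact Finset.sum_eq_zero fun y _ => hc y
    rw [hU.edist_eq hy]
    exact SimpleGraph.edist_le_eccent
  · rw [SimpleGraph.eccent_le_iff]
    intro y
    obtain ⟨b, hb⟩ : ∃ b, U a x * U b y ≠ 0 := by
      by_contra! hc
      refine h ?_
      rw [← mul_one (U a x), ← hU.magic.col_sum y, Finset.mul_sum]
      exact Finset.sum_eq_zero fun b _ => hc b
    rw [← hU.edist_eq hb]
    exact SimpleGraph.edist_le_eccent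

theorem IsQuantumIso.mem_center_iff {U : Matrix X.V X.V A} (hU : IsQuantumIso X X U) {x y : X.V}
    (h : U x y ≠ 0) : x ∈ X.graph.center ↔ y ∈ X.graph.center := by
  rw [SimpleGraph.mem_center_iff, SimpleGraph.mem_center_iff, hU.eccent_eq h]

/-- The canonical anchor is preserved by quantum automorphisms. -/
theorem IsQuantumIso.mem_canonicalAnchor_iff {U : Matrix X.V X.V A} (hU : IsQuantumIso X X U)
    (hG : X.graph.Connected) {Q : Set X.V} (hQ : IsCanonicalAnchor X.graph Q) {x y : X.V}
    (h : U x y ≠ 0) : x ∈ Q ↔ y ∈ Q := by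
  rcases hQ with ⟨r, -, hc, rfl⟩ | ⟨hc, hB, hcQ⟩
  · rw [← hc]
    exact hU.mem_center_iff h
  -- Membership in the block is expressed through the centre and inseparability, both of which are
  -- preserved. One implication is proved for all quantum automorphisms, and the transpose gives the
  -- other.
  · have hmem := mem_block_iff_of_center_subset hG hc ((isBlock_iff hG).mp hB) hcQ
    have key : ∀ {W : Matrix X.V X.V A}, IsQuantumIso X X W → ∀ {x y}, W x y ≠ 0 →
        x ∈ Q → y ∈ Q := by
      intro W hW x y h hx
      rw [hmem] at hx ⊢
      intro z hz
      obtain ⟨w, hw⟩ : ∃ w, W x y * W w z ≠ 0 := by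
        by_contra! hc
        refine h ?_
        rw [← mul_one (W x y), ← hW.magic.col_sum z, Finset.mul_sum]
        exact Finset.sum_eq_zero fun b _ => hc b
      exact hW.inseparable hw (hx w ((hW.mem_center_iff (right_ne_zero_of_mul hw)).mpr hz))
    exact ⟨key hU h, key hU.transpose h⟩

end MarkedGraph

end

end QuantumAut

namespace QuantumAut

noncomputable section

open scoped ComplexOrder

/-! ### Corepresentations of compact quantum groups of Kac type -/

/-- A comultiplication, a counit and an involutive antipode on a `*`-algebra. -/
structure KacData (A : Type u) [Ring A] [StarRing A] [Algebra ℂ A] [StarModule ℂ A] where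
  /-- the comultiplication -/
  comul : A →⋆ₐ[ℂ] A ⊗[ℂ] A
  /-- the counit -/
  counit : A →⋆ₐ[ℂ] ℂ
  /-- the antipode -/
  antipode : A →⋆ₐ[ℂ] Aᵐᵒᵖ

namespace KacData

variable {A : Type u} [Ring A] [StarRing A] [Algebra ℂ A] [StarModule ℂ A] (H : KacData A)

/-- Finite dimensional unitary corepresentations. -/
structure IsCorep {N : Type u} [Fintype N] [DecidableEq N] (W : Matrix N N A) : Prop where
  comul : ∀ i j, H.comul (W i j) = ∑ k, W i k ⊗ₜ[ℂ] W k j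
  counit : W.map H.counit = 1
  antipode : ∀ i j, H.antipode (W i j) = MulOpposite.op (star (W j i))
  star_mul_self : W.conjTranspose * W = 1
  mul_star_self : W * W.conjTranspose = 1

variable {H} {N N' : Type u} [Fintype N] [DecidableEq N] [Fintype N'] [DecidableEq N']
  {W : Matrix N N A} {W' : Matrix N' N' A}

theorem isCorep_one : H.IsCorep (1 : Matrix N N A) where
  comul i j := by
    by_cases h : i = j
    · subst h
      rw [Matrix.one_apply_eq, map_one, Finset.sum_eq_single i]
      · rw [Matrix.one_apply_eq]; rfl
      · intro k _ hk
        rw [Matrix.one_apply_ne hk.symm, TensorProduct.zero_tmul]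
      · simp
    · rw [Matrix.one_apply_ne h, map_zero]
      refine (Finset.sum_eq_zero fun k _ => ?_).symm
      by_cases hk : i = k
      · subst hk
        rw [Matrix.one_apply_ne h, TensorProduct.tmul_zero]
      · rw [Matrix.one_apply_ne hk, TensorProduct.zero_tmul]
  counit := by simp
  antipode i j := by
    by_cases h : i = j
    · subst h; simp
    · simp [Matrix.one_apply_ne h, Matrix.one_apply_ne (Ne.symm h)]
  star_mul_self := by simp
  mul_star_self := by simp

theorem IsCorep.directSum (hW : H.IsCorep W) (hW' : H.IsCorep W') :
    H.IsCorep (Matrix.fromBlocks W 0 0 W') where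
  comul := by
    rintro (i | i) (j | j) <;> simp [hW.comul, hW'.comul]
  counit := by
    rw [Matrix.fromBlocks_map, hW.counit, hW'.counit]
    simp
  antipode := by
    rintro (i | i) (j | j) <;> simp [hW.antipode, hW'.antipode]
  star_mul_self := by
    simp [Matrix.fromBlocks_conjTranspose, Matrix.fromBlocks_multiply, hW.star_mul_self,
      hW'.star_mul_self]
  mul_star_self := by
    simp [Matrix.fromBlocks_conjTranspose, Matrix.fromBlocks_multiply, hW.mul_star_self,
      hW'.mul_star_self]

theorem IsCorep.sum_star_mul (hW : H.IsCorep W) (i j : N) :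
    ∑ k, star (W k i) * W k j = (1 : Matrix N N A) i j := by
  rw [← hW.star_mul_self, Matrix.mul_apply]
  rfl

theorem IsCorep.sum_mul_star (hW : H.IsCorep W) (i j : N) :
    ∑ k, W i k * star (W j k) = (1 : Matrix N N A) i j := by
  rw [← hW.mul_star_self, Matrix.mul_apply]
  rfl

theorem op_one_apply (i j : N) :
    H.antipode ((1 : Matrix N N A) i j) = MulOpposite.op ((1 : Matrix N N A) j i) := by
  by_cases h : i = j
  · subst h; simp
  · simp [Matrix.one_apply_ne h, Matrix.one_apply_ne (Ne.symm h)]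

/-- The antipode is antimultiplicative and compatible with the adjoint, so it turns unitarity of `W`
into unitarity of its entrywise conjugate. This is where the Kac property enters; in general the
conjugate of a unitary corepresentation need not be unitary. -/
theorem IsCorep.sum_mul_star' (hW : H.IsCorep W) (i j : N) :
    ∑ k, W k i * star (W k j) = (1 : Matrix N N A) i j := by
  have := congrArg H.antipode (hW.sum_mul_star j i)
  rw [op_one_apply, map_sum] at this
  simp only [map_mul, map_star, hW.antipode, ← MulOpposite.op_star, star_star,
    ← MulOpposite.op_mul] at this
  rw [← MulOpposite.op_injective.eq_iff, ← this]
  simp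

theorem IsCorep.sum_star_mul' (hW : H.IsCorep W) (i j : N) :
    ∑ k, star (W i k) * W j k = (1 : Matrix N N A) i j := by
  have := congrArg H.antipode (hW.sum_star_mul j i)
  rw [op_one_apply, map_sum] at this
  simp only [map_mul, map_star, hW.antipode, ← MulOpposite.op_star, star_star,
    ← MulOpposite.op_mul] at this
  rw [← MulOpposite.op_injective.eq_iff, ← this]
  simp

theorem IsCorep.conj (hW : H.IsCorep W) : H.IsCorep (W.map star) where
  comul i j := by
    simp only [Matrix.map_apply, map_star, hW.comul, star_sum, TensorProduct.star_tmul]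
  counit := by
    ext i j
    have := congrFun (congrFun hW.counit i) j
    simp only [Matrix.map_apply] at this ⊢
    rw [map_star, this]
    by_cases h : i = j
    · subst h; simp
    · simp [Matrix.one_apply_ne h]
  antipode i j := by simp [map_star, hW.antipode]
  star_mul_self := by
    ext i j
    rw [← hW.sum_mul_star', Matrix.mul_apply]
    simp
  mul_star_self := by
    ext i j
    rw [← hW.sum_star_mul', Matrix.mul_apply]
    simp

/-- The tensor product of two matrices. -/
def tensor (W : Matrix N N A) (W' : Matrix N' N' A) : Matrix (N × N') (N × N') A :=
  Matrix.of fun p q => W p.1 q.1 * W' p.2 q.2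

theorem tensor_apply (p q : N × N') : tensor W W' p q = W p.1 q.1 * W' p.2 q.2 := rfl

theorem one_mul_one (p q : N × N') :
    (1 : Matrix N N A) p.1 q.1 * (1 : Matrix N' N' A) p.2 q.2 = (1 : Matrix (N × N') _ A) p q := by
  simp [Matrix.one_apply, Prod.ext_iff, ← ite_and, and_comm]

theorem one_apply_mul (i j : N) (a : A) :
    (1 : Matrix N N A) i j * a = a * (1 : Matrix N N A) i j := by
  by_cases h : i = j
  · subst h; simp
  · simp [Matrix.one_apply_ne h]

theorem IsCorep.tensor (hW : H.IsCorep W) (hW' : H.IsCorep W') :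
    H.IsCorep (tensor W W') where
  comul p q := by
    simp only [tensor_apply, map_mul, hW.comul, hW'.comul, Finset.sum_mul_sum,
      Fintype.sum_prod_type, Algebra.TensorProduct.tmul_mul_tmul]
  counit := by
    ext p q
    have h := congrFun (congrFun hW.counit p.1) q.1
    have h' := congrFun (congrFun hW'.counit p.2) q.2
    simp only [Matrix.map_apply] at h h' ⊢
    rw [tensor_apply, map_mul, h, h']
    simp [Matrix.one_apply, Prod.ext_iff, ← ite_and, and_comm]
  antipode p q := by
    rw [tensor_apply, tensor_apply, map_mul, hW.antipode, hW'.antipode, ← MulOpposite.op_mul,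
      ← star_mul]
  star_mul_self := by
    ext p q
    rw [Matrix.mul_apply, ← one_mul_one, Fintype.sum_prod_type_right, ← hW'.sum_star_mul,
      Finset.mul_sum]
    refine Finset.sum_congr rfl fun n _ => ?_
    rw [← mul_assoc, one_apply_mul, ← hW.sum_star_mul, Finset.mul_sum, Finset.sum_mul]
    refine Finset.sum_congr rfl fun m _ => ?_
    simp only [Matrix.conjTranspose_apply, tensor_apply, star_mul, mul_assoc]
  mul_star_self := by
    ext p q
    rw [Matrix.mul_apply, ← one_mul_one, Fintype.sum_prod_type, ← hW.sum_mul_star,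
      Finset.sum_mul]
    refine Finset.sum_congr rfl fun n _ => ?_
    rw [mul_assoc, ← one_apply_mul, ← hW'.sum_mul_star, Finset.sum_mul, Finset.mul_sum]
    refine Finset.sum_congr rfl fun m _ => ?_
    simp only [Matrix.conjTranspose_apply, tensor_apply, star_mul, mul_assoc]

/-! ### Convolution of functionals -/

variable (H) in
/-- The convolution product of two functionals. -/
def conv (φ ψ : A →ₗ[ℂ] ℂ) : A →ₗ[ℂ] ℂ :=
  LinearMap.mul' ℂ ℂ ∘ₗ TensorProduct.map φ ψ ∘ₗ H.comul.toAlgHom.toLinearMap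

theorem conv_one (φ ψ : A →ₗ[ℂ] ℂ) : H.conv φ ψ 1 = φ 1 * ψ 1 := by
  have : H.comul 1 = (1 : A) ⊗ₜ[ℂ] (1 : A) := map_one _
  change LinearMap.mul' ℂ ℂ (TensorProduct.map φ ψ (H.comul 1)) = _
  rw [this]
  rfl

theorem IsCorep.map_conv (hW : H.IsCorep W) (φ ψ : A →ₗ[ℂ] ℂ) :
    W.map (H.conv φ ψ) = W.map φ * W.map ψ := by
  ext i j
  change LinearMap.mul' ℂ ℂ (TensorProduct.map φ ψ (H.comul (W i j))) = _
  rw [hW.comul, map_sum, map_sum, Matrix.mul_apply]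
  rfl

variable (H) in
/-- The counit as a functional. -/
def counitL : A →ₗ[ℂ] ℂ := H.counit.toAlgHom.toLinearMap

theorem counitL_one : H.counitL 1 = 1 := map_one H.counit

theorem IsCorep.map_counitL (hW : H.IsCorep W) : W.map H.counitL = 1 := hW.counit

variable (H) in
/-- The adjoint `a ↦ conj (φ (S a)*)` of a functional. -/
def adj (φ : A →ₗ[ℂ] ℂ) : A →ₗ[ℂ] ℂ where
  toFun a := star (φ (star (H.antipode a).unop))
  map_add' a b := by simp
  map_smul' c a := by simp

theorem adj_one (φ : A →ₗ[ℂ] ℂ) : H.adj φ 1 = star (φ 1) := by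
  simp [adj]

theorem IsCorep.map_adj (hW : H.IsCorep W) (φ : A →ₗ[ℂ] ℂ) :
    W.map (H.adj φ) = (W.map φ).conjTranspose := by
  ext i j
  simp [adj, hW.antipode]

/-- The functional `φ` is left invariant on the coefficients of `W`. -/
def IsLeftInv (φ : A →ₗ[ℂ] ℂ) (W : Matrix N N A) : Prop :=
  ∀ i j, ∑ k, φ (W i k) • W k j = φ (W i j) • (1 : A)

theorem IsLeftInv.of_directSum_left {φ : A →ₗ[ℂ] ℂ}
    (h : IsLeftInv φ (Matrix.fromBlocks W 0 0 W')) : IsLeftInv φ W := fun i j => by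
  simpa using h (Sum.inl i) (Sum.inl j)

theorem IsLeftInv.of_directSum_right {φ : A →ₗ[ℂ] ℂ}
    (h : IsLeftInv φ (Matrix.fromBlocks W 0 0 W')) : IsLeftInv φ W' := fun i j => by
  simpa using h (Sum.inr i) (Sum.inr j)

end KacData

/-! ### Matrices -/

section matrices

variable {N : Type u} [Fintype N] [DecidableEq N]

/-- A Hermitian matrix has the same kernel as its positive powers: `b ^ (r + 2) * a = 0` makes `M*
M` vanish for `M = b ^ (r + 1) * a`. -/
theorem mul_eq_zero_of_pow_mul_eq_zero {b a : Matrix N N ℂ} (hb : b.conjTranspose = b) (r : ℕ)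
    (h : b ^ r * a = 0) : b * a = 0 := by
  cases r with
  | zero =>
    rw [pow_zero, one_mul] at h
    rw [h, mul_zero]
  | succ r =>
    induction r with
    | zero => simpa using h
    | succ r ih =>
      refine ih ?_
      have h1 : (b ^ (r + 1) * a).conjTranspose * (b ^ (r + 1) * a) = 0 := by
        have h2 : (b ^ (r + 1) * a).conjTranspose = (b ^ r * a).conjTranspose * b := by
          rw [pow_succ', mul_assoc, Matrix.conjTranspose_mul, hb]
        rw [h2, mul_assoc, ← mul_assoc b, ← pow_succ', h, mul_zero]
      exact Matrix.conjTranspose_mul_self_eq_zero.mp h1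

/-- A Hermitian matrix is annihilated by a polynomial in it with constant term `1`. -/
theorem exists_polynomial_mul_eq_zero {b : Matrix N N ℂ} (hb : b.conjTranspose = b) :
    ∃ a ∈ Algebra.adjoin ℂ {b}, b * (1 + b * a) = 0 := by
  -- The minimal polynomial is `X ^ r * q` with `q(0) ≠ 0`. The factor `b ^ r` can be lowered to `b`
  -- because `b` is Hermitian, and `q(b) / q(0)` has the form `1 + b * a`.
  obtain ⟨q, hq, hq0⟩ := Polynomial.exists_eq_pow_rootMultiplicity_mul_and_not_dvd
    (minpoly ℂ b) (minpoly.ne_zero (Algebra.IsIntegral.isIntegral b)) 0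
  rw [map_zero, sub_zero, Polynomial.X_dvd_iff] at hq0
  have h := minpoly.aeval ℂ b
  rw [hq, map_zero, sub_zero, map_mul, map_pow, Polynomial.aeval_X] at h
  have h1 := mul_eq_zero_of_pow_mul_eq_zero hb _ h
  refine ⟨(q.coeff 0)⁻¹ • Polynomial.aeval b q.divX, ?_, ?_⟩
  · exact Subalgebra.smul_mem _ (Polynomial.aeval_mem_adjoin_singleton ℂ b) _
  · have h2 : 1 + b * ((q.coeff 0)⁻¹ • Polynomial.aeval b q.divX) =
        (q.coeff 0)⁻¹ • Polynomial.aeval b q := by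
      have h3 : Polynomial.aeval b q =
          b * Polynomial.aeval b q.divX + q.coeff 0 • (1 : Matrix N N ℂ) := by
        conv_lhs => rw [← Polynomial.X_mul_divX_add q]
        rw [map_add, map_mul, Polynomial.aeval_X, Polynomial.aeval_C,
          Algebra.algebraMap_eq_smul_one]
      rw [h3, smul_add, smul_smul, inv_mul_cancel₀ hq0, one_smul, add_comm, mul_smul_comm]
    rw [h2, mul_smul_comm, h1, smul_zero]

/-- If a sum of matrices of the form `M* M` vanishes, then so does each term. -/
theorem eq_zero_of_sum_conjTranspose_mul_self {ι : Type*} (s : Finset ι) (M : ι → Matrix N N ℂ)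
    (h : ∑ i ∈ s, (M i).conjTranspose * M i = 0) {i : ι} (hi : i ∈ s) : M i = 0 := by
  have h1 : ∑ i ∈ s, ((M i).conjTranspose * M i).trace = 0 := by
    rw [← Matrix.trace_sum, h, Matrix.trace_zero]
  rw [Finset.sum_eq_zero_iff_of_nonneg
    fun i _ => (Matrix.posSemidef_conjTranspose_mul_self (M i)).trace_nonneg] at h1
  exact Matrix.trace_conjTranspose_mul_self_eq_zero_iff.mp (h1 i hi)

end matrices


end

end QuantumAut

namespace QuantumAut

noncomputable section

open scoped ComplexOrder

/-! ### The Haar functional -/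

namespace KacData

variable {A : Type u} [Ring A] [StarRing A] [Algebra ℂ A] [StarModule ℂ A] {H : KacData A}
  {N N' : Type u} [Fintype N] [DecidableEq N] [Fintype N'] [DecidableEq N']
  {W : Matrix N N A} {W' : Matrix N' N' A}

variable (W) in
/-- Evaluation of a functional on a matrix. -/
def evalL : (A →ₗ[ℂ] ℂ) →ₗ[ℂ] Matrix N N ℂ where
  toFun φ := W.map φ
  map_add' _ _ := rfl
  map_smul' _ _ := rfl

variable (W) in
theorem evalL_apply (φ : A →ₗ[ℂ] ℂ) : evalL W φ = W.map φ := rfl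

variable (A) in
/-- The functionals that vanish at `1`. -/
def augmentation : Submodule ℂ (A →ₗ[ℂ] ℂ) where
  carrier := {φ | φ 1 = 0}
  add_mem' {φ ψ} (h : φ 1 = 0) (h' : ψ 1 = 0) := by
    change φ 1 + ψ 1 = 0
    rw [h, h', add_zero]
  zero_mem' := rfl
  smul_mem' c φ (h : φ 1 = 0) := by
    change c • φ 1 = 0
    rw [h, smul_zero]

/-- The matrices that are values of functionals on a corepresentation. -/
def IsCorep.dualAlgebra (hW : H.IsCorep W) : Subalgebra ℂ (Matrix N N ℂ) where
  carrier := Set.range (evalL W)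
  mul_mem' := by
    rintro _ _ ⟨φ, rfl⟩ ⟨ψ, rfl⟩
    exact ⟨H.conv φ ψ, hW.map_conv φ ψ⟩
  add_mem' := by
    rintro _ _ ⟨φ, rfl⟩ ⟨ψ, rfl⟩
    exact ⟨φ + ψ, map_add _ _ _⟩
  algebraMap_mem' c := ⟨c • H.counitL, by
    rw [map_smul, evalL_apply, hW.map_counitL, Algebra.algebraMap_eq_smul_one]⟩

/-- The existence of an invariant functional on the coefficients of a corepresentation. -/
theorem IsCorep.exists_isLeftInv (hW : H.IsCorep W) :
    ∃ φ : A →ₗ[ℂ] ℂ, φ 1 = 1 ∧ IsLeftInv φ W := by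
  -- `J` consists of the values at `W` of the functionals that vanish at `1`; it is closed under
  -- adjoints and is a right ideal in the algebra of all values. An `e ∈ 1 + J` with `e J = 0` is
  -- the value of a normalised functional, and that functional is left invariant on `W`.
  set J : Submodule ℂ (Matrix N N ℂ) := (augmentation A).map (evalL W) with hJ
  have hJstar : ∀ c ∈ J, c.conjTranspose ∈ J := by
    rintro _ ⟨ψ, hψ, rfl⟩
    refine ⟨H.adj ψ, ?_, hW.map_adj ψ⟩
    have h0 : ψ 1 = 0 := hψ
    change H.adj ψ 1 = 0
    rw [adj_one, h0, star_zero]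
  have hJmul : ∀ c ∈ J, ∀ a ∈ hW.dualAlgebra, c * a ∈ J := by
    rintro _ ⟨ψ, hψ, rfl⟩ _ ⟨φ, rfl⟩
    refine ⟨H.conv ψ φ, ?_, hW.map_conv ψ φ⟩
    have h0 : ψ 1 = 0 := hψ
    change H.conv ψ φ 1 = 0
    rw [conv_one, h0, zero_mul]
  have hJB : ∀ c ∈ J, c ∈ hW.dualAlgebra := by
    rintro _ ⟨ψ, -, rfl⟩
    exact ⟨ψ, rfl⟩
  obtain ⟨s, hs⟩ := IsNoetherian.noetherian J
  have hsJ : ∀ c ∈ s, c ∈ J := fun c hc => hs ▸ Submodule.subset_span hc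
  -- The sum `b` of `c* c` over generators of `J` detects all of `J`: if `b e = 0`, then `∑ (c e)*
  -- (c e) = e* b e = 0` forces `c e = 0` for each generator.
  set b : Matrix N N ℂ := ∑ c ∈ s, c.conjTranspose * c with hb
  have hbJ : b ∈ J := sum_mem fun c hc => hJmul _ (hJstar c (hsJ c hc)) c (hJB c (hsJ c hc))
  have hbb : b.conjTranspose = b := by
    rw [hb, Matrix.conjTranspose_sum]
    exact Finset.sum_congr rfl fun c _ => by
      rw [Matrix.conjTranspose_mul, Matrix.conjTranspose_conjTranspose]
  obtain ⟨a, ha, hba⟩ := exists_polynomial_mul_eq_zero hbb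
  have haB : a ∈ hW.dualAlgebra :=
    Algebra.adjoin_le (S := hW.dualAlgebra) (by
      rintro _ rfl; exact hJB _ hbJ) ha
  obtain ⟨ψ, hψ, hψe⟩ := hJmul b hbJ a haB
  have hψ0 : ψ 1 = 0 := hψ
  set e : Matrix N N ℂ := 1 + b * a with he
  have hJe : ∀ c ∈ J, c * e = 0 := by
    intro c hc
    rw [← hs] at hc
    induction hc using Submodule.span_induction with
    | mem c hc =>
      refine eq_zero_of_sum_conjTranspose_mul_self s (fun c => c * e) ?_ hc
      have : ∑ c ∈ s, (c * e).conjTranspose * (c * e) = e.conjTranspose * (b * e) := by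
        rw [hb, Finset.sum_mul, Finset.mul_sum]
        exact Finset.sum_congr rfl fun c _ => by
          rw [Matrix.conjTranspose_mul]; simp only [mul_assoc]
      rw [this, hba, mul_zero]
    | zero => rw [zero_mul]
    | add x y _ _ hx hy => rw [add_mul, hx, hy, add_zero]
    | smul r x _ hx => rw [smul_mul_assoc, hx, smul_zero]
  -- As `e - 1 ∈ J` and `J` is closed under adjoints, `J e = 0` gives `e* e = e`. Hence `e` is
  -- self-adjoint, and `e J = 0` follows from `J e = 0` by taking adjoints.
  have hee : e.conjTranspose = e := by
    have h1 : e.conjTranspose * e = e := by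
      conv_lhs => rw [he, Matrix.conjTranspose_add, Matrix.conjTranspose_one, add_mul, one_mul,
        ← he]
      rw [hJe _ (hJstar _ ⟨ψ, hψ, hψe⟩), add_zero]
    conv_lhs => rw [← h1, Matrix.conjTranspose_mul, Matrix.conjTranspose_conjTranspose, h1]
  have heJ : ∀ c ∈ J, e * c = 0 := by
    intro c hc
    rw [← Matrix.conjTranspose_eq_zero, Matrix.conjTranspose_mul, hee, hJe _ (hJstar c hc)]
  have heW : W.map (H.counitL + ψ) = e := by
    change evalL W (H.counitL + ψ) = e
    rw [map_add, hψe, evalL_apply, hW.map_counitL]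
  refine ⟨H.counitL + ψ, ?_, fun i j => ?_⟩
  · change H.counitL 1 + ψ 1 = 1
    rw [counitL_one, hψ0, add_zero]
  · rw [← sub_eq_zero, ← Module.forall_dual_apply_eq_zero_iff ℂ]
    intro θ
    -- Invariance is tested against a functional `θ`. Subtracting `θ(1)` times the counit puts its
    -- value into `J`, so `e θ(W) = θ(1) e`.
    have h1 : evalL W (θ - θ 1 • H.counitL) ∈ J := by
      refine ⟨_, ?_, rfl⟩
      change θ 1 - θ 1 • H.counitL 1 = 0
      rw [counitL_one, smul_eq_mul, mul_one, sub_self]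
    have h2 := heJ _ h1
    rw [map_sub, map_smul, evalL_apply, evalL_apply, hW.map_counitL, mul_sub, mul_smul_comm,
      mul_one, ← heW, sub_eq_zero] at h2
    have h3 := congrFun (congrFun h2 i) j
    rw [Matrix.mul_apply] at h3
    rw [map_sub, map_sum]
    simp only [map_smul, smul_eq_mul]
    simp only [Matrix.map_apply, Matrix.smul_apply, smul_eq_mul] at h3
    rw [h3]
    ring

/-- The slice map `a ↦ (id ⊗ ψ) (Δ a)`. -/
def slice (H : KacData A) (ψ : A →ₗ[ℂ] ℂ) : A →ₗ[ℂ] A :=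
  (TensorProduct.rid ℂ A).toLinearMap ∘ₗ TensorProduct.map LinearMap.id ψ ∘ₗ
    H.comul.toAlgHom.toLinearMap

theorem IsCorep.slice (hW : H.IsCorep W) (ψ : A →ₗ[ℂ] ℂ) (i j : N) :
    H.slice ψ (W i j) = ∑ k, ψ (W k j) • W i k := by
  change TensorProduct.rid ℂ A (TensorProduct.map LinearMap.id ψ (H.comul (W i j))) = _
  rw [hW.comul, map_sum, map_sum]
  rfl

variable (H) in
/-- `a` is a coefficient of a corepresentation. -/
def IsCoef (a : A) : Prop :=
  ∃ (N : Type u) (_ : Fintype N) (_ : DecidableEq N) (W : Matrix N N A) (_ : H.IsCorep W)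
    (v c : N → ℂ), a = ∑ i, ∑ j, (v i * c j) • W i j

theorem isCoef_algebraMap (z : ℂ) : H.IsCoef (algebraMap ℂ A z) :=
  ⟨PUnit, inferInstance, inferInstance, 1, isCorep_one, fun _ => z, fun _ => 1, by
    simp [Algebra.algebraMap_eq_smul_one]⟩

theorem IsCorep.isCoef (hW : H.IsCorep W) (i j : N) : H.IsCoef (W i j) :=
  ⟨N, inferInstance, inferInstance, W, hW, Pi.single i 1, Pi.single j 1, by
    rw [Finset.sum_eq_single i, Finset.sum_eq_single j]
    · simp
    · intro k _ hk; simp [hk]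
    · simp
    · intro k _ hk; simp [hk]
    · simp⟩

/-- The cross terms of `v ⊕ v'` and `c ⊕ c'` meet the zero blocks of the direct sum. This is why
sums with weights `v i * c j`, rather than arbitrary weights, suffice for the definition; that
special form is used in the proof of positivity. -/
theorem IsCoef.add {a b : A} (ha : H.IsCoef a) (hb : H.IsCoef b) : H.IsCoef (a + b) := by
  obtain ⟨N, _, _, W, hW, v, c, rfl⟩ := ha
  obtain ⟨N', _, _, W', hW', v', c', rfl⟩ := hb
  refine ⟨N ⊕ N', inferInstance, inferInstance, _, hW.directSum hW', Sum.elim v v',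
    Sum.elim c c', ?_⟩
  simp

theorem IsCoef.mul {a b : A} (ha : H.IsCoef a) (hb : H.IsCoef b) : H.IsCoef (a * b) := by
  obtain ⟨N, _, _, W, hW, v, c, rfl⟩ := ha
  obtain ⟨N', _, _, W', hW', v', c', rfl⟩ := hb
  refine ⟨N × N', inferInstance, inferInstance, _, hW.tensor hW', fun p => v p.1 * v' p.2,
    fun p => c p.1 * c' p.2, ?_⟩
  rw [Finset.sum_mul_sum, Fintype.sum_prod_type]
  refine Finset.sum_congr rfl fun i _ => Finset.sum_congr rfl fun i' _ => ?_
  rw [Finset.sum_mul_sum, Fintype.sum_prod_type]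
  refine Finset.sum_congr rfl fun j _ => Finset.sum_congr rfl fun j' _ => ?_
  rw [tensor_apply, smul_mul_smul_comm]
  congr 1
  ring

theorem IsCoef.star {a : A} (ha : H.IsCoef a) : H.IsCoef (star a) := by
  obtain ⟨N, _, _, W, hW, v, c, rfl⟩ := ha
  refine ⟨N, inferInstance, inferInstance, _, hW.conj, fun i => Star.star (v i),
    fun i => Star.star (c i), ?_⟩
  simp [star_sum]

variable (H) in
/-- The coefficients of corepresentations form a `*`-subalgebra. -/
def coefSubalgebra : StarSubalgebra ℂ A where
  carrier := {a | H.IsCoef a}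
  mul_mem' := IsCoef.mul
  add_mem' := IsCoef.add
  algebraMap_mem' := isCoef_algebraMap
  star_mem' := IsCoef.star

/-- The functional `h` is a Haar functional. -/
structure IsHaar (H : KacData A) (h : A →ₗ[ℂ] ℂ) : Prop where
  map_one : h 1 = 1
  leftInv : ∀ (N : Type u) [Fintype N] [DecidableEq N] (W : Matrix N N A), H.IsCorep W →
    IsLeftInv h W

/-- An invariant functional is one that kills the span `L` of the elements `(id ⊗ ψ)(Δ a) - ψ(1) a`.
For each element of `L` there is a single corepresentation such that every functional invariant on
it kills the element. Since some such functional has the value `1` at `1`, the unit is not in `L`,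
and linear algebra provides a functional that separates it from `L`. -/
theorem exists_isHaar (H : KacData A) (hA : ∀ a, H.IsCoef a) : ∃ h, H.IsHaar h := by
  set L : Submodule ℂ A :=
    Submodule.span ℂ {b | ∃ (ψ : A →ₗ[ℂ] ℂ) (a : A), b = H.slice ψ a - ψ 1 • a} with hL
  have key : ∀ b ∈ L, ∃ (N : Type u) (_ : Fintype N) (_ : DecidableEq N) (W : Matrix N N A)
      (_ : H.IsCorep W), ∀ φ, IsLeftInv φ W → φ b = 0 := by
    intro b hb
    induction hb using Submodule.span_induction with
    | mem b hb =>
      obtain ⟨ψ, a, rfl⟩ := hb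
      obtain ⟨N, _, _, W, hW, v, c, rfl⟩ := hA a
      refine ⟨N, inferInstance, inferInstance, W, hW, fun φ hφ => ?_⟩
      have h1 : ∀ i j, φ (H.slice ψ (W i j)) = ψ 1 * φ (W i j) := by
        intro i j
        have := congrArg ψ (hφ i j)
        rw [hW.slice, map_sum]
        rw [map_sum] at this
        simp only [map_smul, smul_eq_mul] at this ⊢
        rw [mul_comm (ψ 1), ← this]
        exact Finset.sum_congr rfl fun k _ => mul_comm _ _
      rw [map_sub, sub_eq_zero]
      simp only [map_sum, map_smul, h1, smul_eq_mul, Finset.mul_sum]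
      refine Finset.sum_congr rfl fun i _ => Finset.sum_congr rfl fun j _ => ?_
      ring
    | zero => exact ⟨PUnit, inferInstance, inferInstance, 1, isCorep_one, fun φ _ => map_zero φ⟩
    | add x y _ _ hx hy =>
      obtain ⟨N, _, _, W, hW, h1⟩ := hx
      obtain ⟨N', _, _, W', hW', h2⟩ := hy
      exact ⟨N ⊕ N', inferInstance, inferInstance, _, hW.directSum hW', fun φ hφ => by
        rw [map_add, h1 φ hφ.of_directSum_left, h2 φ hφ.of_directSum_right, add_zero]⟩
    | smul r x _ hx =>
      obtain ⟨N, _, _, W, hW, h1⟩ := hx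
      exact ⟨N, inferInstance, inferInstance, W, hW, fun φ hφ => by
        rw [map_smul, h1 φ hφ, smul_zero]⟩
  have h1 : (1 : A) ∉ L := by
    intro h
    obtain ⟨N, _, _, W, hW, h1⟩ := key 1 h
    obtain ⟨φ, hφ, hφW⟩ := hW.exists_isLeftInv
    exact one_ne_zero (hφ.symm.trans (h1 φ hφW))
  obtain ⟨f, hf1, hfL⟩ := Submodule.exists_dual_map_eq_bot_of_notMem h1 inferInstance
  have hf : ∀ b ∈ L, f b = 0 := fun b hb => by
    have : f b ∈ L.map f := Submodule.mem_map_of_mem hb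
    rwa [hfL, Submodule.mem_bot] at this
  refine ⟨(f 1)⁻¹ • f, ⟨inv_mul_cancel₀ hf1, ?_⟩⟩
  intro N _ _ W hW i j
  rw [← sub_eq_zero, ← Module.forall_dual_apply_eq_zero_iff ℂ]
  intro ψ
  have h2 := hf _ (Submodule.subset_span ⟨ψ, W i j, rfl⟩)
  rw [hW.slice, map_sub, map_sum, sub_eq_zero] at h2
  rw [map_sub, map_sum, sub_eq_zero]
  simp only [LinearMap.smul_apply, map_smul, smul_eq_mul] at h2 ⊢
  simp only [mul_assoc, ← Finset.mul_sum]
  rw [mul_comm _ (ψ 1), ← h2]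
  congr 1
  exact Finset.sum_congr rfl fun k _ => mul_comm _ _

end KacData

end

end QuantumAut

namespace QuantumAut

noncomputable section

open scoped ComplexOrder

theorem sum_sum_sum_sum_comm {N M : Type*} [Fintype N] [AddCommMonoid M] (f : N → N → N → N → M) :
    ∑ m, ∑ n, ∑ i, ∑ k, f m n i k = ∑ i, ∑ k, ∑ m, ∑ n, f m n i k := by
  have := Finset.sum_comm (s := Finset.univ) (t := Finset.univ)
    (f := fun p q : N × N => f p.1 p.2 q.1 q.2)
  simpa only [Fintype.sum_prod_type] using this

/-! ### Positivity of the Haar functional -/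

section positivity

open scoped MatrixOrder

/-- A criterion of positivity in terms of the commutant of the commutant. -/
theorem posSemidef_of_trace {N : Type*} [Fintype N] [DecidableEq N] {y : Matrix N N ℂ}
    (hy : y.IsHermitian) (u : N → ℂ)
    (h : ∀ d : Matrix N N ℂ, (∀ b, Commute y b → Commute d b) →
      (d * y).trace = star u ⬝ᵥ d.mulVec u) : y.PosSemidef := by
  have hsa : IsSelfAdjoint y := hy
  -- The negative part is a function of `y`, so it commutes with whatever commutes with `y` and may
  -- be taken for `d`. The trace of `y⁻ y = -(y⁻)²` is then both nonpositive and, by the hypothesis,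
  -- nonnegative.
  have h1 := h y⁻ fun b hb => by
    rw [CFC.negPart_def]
    exact hsa.commute_cfcₙ hb _
  have hn : (y⁻).PosSemidef := Matrix.nonneg_iff_posSemidef.mp (CFC.negPart_nonneg y)
  have h2 : y⁻ * y = - ((y⁻).conjTranspose * y⁻) := by
    rw [hn.isHermitian.eq]
    nth_rewrite 2 [← CFC.posPart_sub_negPart y hsa]
    rw [mul_sub, CFC.negPart_mul_posPart, zero_sub]
  have h3 : 0 ≤ star u ⬝ᵥ (y⁻).mulVec u := hn.dotProduct_mulVec_nonneg u
  rw [← h1, h2, Matrix.trace_neg] at h3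
  have h4 : ((y⁻).conjTranspose * y⁻).trace = 0 :=
    le_antisymm (neg_nonneg.mp h3) (Matrix.posSemidef_conjTranspose_mul_self _).trace_nonneg
  have h5 : y⁻ = 0 := Matrix.trace_conjTranspose_mul_self_eq_zero_iff.mp h4
  rw [← CFC.posPart_sub_negPart y hsa, h5, sub_zero]
  exact Matrix.nonneg_iff_posSemidef.mp (CFC.posPart_nonneg y)

end positivity

namespace KacData

variable {A : Type u} [Ring A] [StarRing A] [Algebra ℂ A] [StarModule ℂ A] {H : KacData A}
  {N : Type u} [Fintype N] [DecidableEq N] {W : Matrix N N A} {h : A →ₗ[ℂ] ℂ}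

/-- A left invariant and a right invariant functional agree. -/
theorem eq_of_leftInv_of_rightInv {f g : A →ₗ[ℂ] ℂ} (hf1 : f 1 = 1) (hg1 : g 1 = 1)
    (hf : IsLeftInv f W) (hg : ∀ i j, ∑ k, g (W k j) • W i k = g (W i j) • (1 : A)) (i j : N) :
    f (W i j) = g (W i j) := by
  have h1 := congrArg g (hf i j)
  have h2 := congrArg f (hg i j)
  simp only [map_sum, map_smul, smul_eq_mul, hf1, hg1, mul_one] at h1 h2
  rw [← h1, ← h2]
  exact Finset.sum_congr rfl fun k _ => mul_comm _ _

/-- The antipode reverses products of matrix indices, so it turns left invariance on the conjugate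
of `W` into right invariance of `h ∘ S` on `W`. -/
theorem IsHaar.rightInv_antipode (hh : H.IsHaar h) (hW : H.IsCorep W) (i j : N) :
    ∑ k, h (star (W j k)) • W i k = h (star (W j i)) • (1 : A) := by
  have h1 := congrArg H.antipode (hh.leftInv N _ hW.conj j i)
  simp only [Matrix.map_apply, map_sum, map_smul, map_star, hW.antipode,
    ← MulOpposite.op_star, star_star] at h1
  have h2 := congrArg MulOpposite.unop h1
  simpa using h2

variable (H) in
/-- The composition of a functional with the antipode. -/
def compAntipode (f : A →ₗ[ℂ] ℂ) : A →ₗ[ℂ] ℂ where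
  toFun a := f (H.antipode a).unop
  map_add' a b := by simp
  map_smul' c a := by simp

theorem IsCorep.compAntipode (hW : H.IsCorep W) (f : A →ₗ[ℂ] ℂ) (i j : N) :
    H.compAntipode f (W i j) = f (star (W j i)) := by
  simp [KacData.compAntipode, hW.antipode]

theorem compAntipode_one (f : A →ₗ[ℂ] ℂ) : H.compAntipode f 1 = f 1 := by
  simp [KacData.compAntipode]

/-- This is the invariance of `h` under the antipode `S`: `h` is left invariant, `h ∘ S` is right
invariant, both are normalised, and so they agree. -/
theorem IsHaar.apply_star_swap (hh : H.IsHaar h) (hW : H.IsCorep W) (i j : N) :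
    h (star (W j i)) = h (W i j) := by
  rw [← hW.compAntipode]
  refine (eq_of_leftInv_of_rightInv hh.map_one ((compAntipode_one h).trans hh.map_one)
    (hh.leftInv N W hW) (fun i j => ?_) i j).symm
  simp only [hW.compAntipode]
  exact hh.rightInv_antipode hW i j

/-- The functional `a ↦ conj (f (a*))`. -/
def conjFunctional (f : A →ₗ[ℂ] ℂ) : A →ₗ[ℂ] ℂ where
  toFun a := star (f (star a))
  map_add' a b := by simp
  map_smul' c a := by simp

theorem conjFunctional_apply (f : A →ₗ[ℂ] ℂ) (a : A) : conjFunctional f a = star (f (star a)) := rfl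

/-- The functional `a ↦ conj (h (a*))` is left invariant as well, because conjugate
corepresentations are allowed in `IsHaar`. Like `h`, it therefore agrees with the right invariant
functional `h ∘ S`. -/
theorem IsHaar.apply_star (hh : H.IsHaar h) (hA : ∀ a, H.IsCoef a) (a : A) :
    h (star a) = star (h a) := by
  suffices key : conjFunctional h a = h a by
    rw [conjFunctional_apply] at key
    rw [← key, star_star]
  obtain ⟨N, _, _, W, hW, v, c, rfl⟩ := hA a
  simp only [map_sum, map_smul]
  refine Finset.sum_congr rfl fun i _ => Finset.sum_congr rfl fun j _ => congrArg _ ?_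
  rw [← hh.apply_star_swap hW, ← hW.compAntipode]
  refine eq_of_leftInv_of_rightInv ?_ ((compAntipode_one h).trans hh.map_one) ?_ (fun i j => ?_) i j
  · rw [conjFunctional_apply, star_one, hh.map_one, star_one]
  · intro i j
    have := congrArg star (hh.leftInv N _ hW.conj i j)
    simpa [star_sum, conjFunctional_apply] using this
  · simp only [hW.compAntipode]
    exact hh.rightInv_antipode hW i j

/-- Invariance under the antipode, applied to the tensor product of the conjugate of `W` with `W`,
moves the summation index to the rows. There the sum collapses by unitarity. -/
theorem IsHaar.sum_apply_star_mul (hh : H.IsHaar h) (hW : H.IsCorep W) (i n : N) :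
    ∑ j, h (star (W i j) * W n j) = if n = i then 1 else 0 := by
  have h1 : ∀ j, h (star (W i j) * W n j) = h (star (W j n) * W j i) := by
    intro j
    have := hh.apply_star_swap (hW.conj.tensor hW) (i, n) (j, j)
    simpa [tensor_apply] using this.symm
  simp only [h1]
  rw [← map_sum, hW.sum_star_mul]
  by_cases hni : n = i
  · subst hni; simp [hh.map_one]
  · simp [Matrix.one_apply_ne hni, hni]

/-- The matrix `h (W* T W)` for the matrix `T` of rank one given by `v`. -/
def haarMatrix (h : A →ₗ[ℂ] ℂ) (W : Matrix N N A) (v : N → ℂ) : Matrix N N ℂ :=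
  Matrix.of fun j l => ∑ i, ∑ k, star (v i) * v k * h (star (W i j) * W k l)

theorem haarMatrix_apply (v : N → ℂ) (j l : N) : haarMatrix h W v j l =
    ∑ i, ∑ k, star (v i) * v k * h (star (W i j) * W k l) := rfl

theorem IsHaar.haarMatrix_isHermitian (hh : H.IsHaar h) (hA : ∀ a, H.IsCoef a) (v : N → ℂ) :
    (haarMatrix h W v).IsHermitian := by
  ext j l
  rw [Matrix.conjTranspose_apply, haarMatrix_apply, haarMatrix_apply, Finset.sum_comm, star_sum]
  refine Finset.sum_congr rfl fun i _ => ?_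
  rw [star_sum]
  refine Finset.sum_congr rfl fun k _ => ?_
  rw [star_mul', star_mul', ← hh.apply_star hA, star_mul, star_star, star_star, mul_comm (v k)]

/-- Averaging makes `y` invariant: left invariance on the tensor product of the conjugate of `W`
with `W` says `W* y W = y`. Multiplication by the unitary `W` gives `y W = W y`, to which `φ` is
applied. -/
theorem IsHaar.haarMatrix_commute (hh : H.IsHaar h) (hW : H.IsCorep W) (v : N → ℂ)
    (φ : A →ₗ[ℂ] ℂ) : Commute (haarMatrix h W v) (W.map φ) := by
  set y := haarMatrix h W v with hy
  have h1 : ∀ j l, ∑ m, ∑ n, y m n • (star (W m j) * W n l) = y j l • (1 : A) := by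
    intro j l
    have h2 : ∀ i k, ∑ m, ∑ n, h (star (W i m) * W k n) • (star (W m j) * W n l) =
        h (star (W i j) * W k l) • (1 : A) := by
      intro i k
      have := hh.leftInv _ _ (hW.conj.tensor hW) (i, k) (j, l)
      simpa only [tensor_apply, Matrix.map_apply, Fintype.sum_prod_type] using this
    have h5 : y j l • (1 : A) = ∑ i, ∑ k, (star (v i) * v k) •
        ∑ m, ∑ n, h (star (W i m) * W k n) • (star (W m j) * W n l) := by
      simp only [h2, hy, haarMatrix_apply, Finset.sum_smul, mul_smul (star (v _) * v _)]
    rw [h5]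
    simp only [hy, haarMatrix_apply, Finset.sum_smul, mul_smul (star (v _) * v _),
      Finset.smul_sum]
    exact sum_sum_sum_sum_comm fun m n i k =>
      (star (v i) * v k) • h (star (W i m) * W k n) • (star (W m j) * W n l)
  have h3 : ∀ p l, ∑ n, y p n • W n l = ∑ j, y j l • W p j := by
    intro p l
    have h4 : ∑ j, W p j * (∑ m, ∑ n, y m n • (star (W m j) * W n l)) = ∑ j, y j l • W p j := by
      refine Finset.sum_congr rfl fun j _ => ?_
      rw [h1, mul_smul_comm, mul_one]
    rw [← h4]
    simp only [Finset.mul_sum, mul_smul_comm, ← mul_assoc]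
    rw [Finset.sum_comm (f := fun j m => ∑ n, y m n • (W p j * star (W m j) * W n l))]
    have h5 : ∀ m, ∑ j, ∑ n, y m n • (W p j * star (W m j) * W n l) =
        ∑ n, y m n • ((1 : Matrix N N A) p m * W n l) := by
      intro m
      rw [Finset.sum_comm (f := fun j n => y m n • (W p j * star (W m j) * W n l))]
      simp only [← Finset.smul_sum, ← Finset.sum_mul, hW.sum_mul_star]
    simp only [h5]
    rw [eq_comm, Finset.sum_eq_single p]
    · simp
    · intro m _ hm
      simp [Matrix.one_apply_ne hm.symm]
    · simp
  ext p l
  have h5 := congrArg φ (h3 p l)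
  simp only [map_sum, map_smul, smul_eq_mul] at h5
  rw [Matrix.mul_apply, Matrix.mul_apply]
  simp only [Matrix.map_apply]
  rw [h5]
  exact Finset.sum_congr rfl fun _ _ => mul_comm _ _

/-- As functionals separate points, `d` commutes with `W` itself. It can thus be carried across `W`
inside `h`, and `IsHaar.sum_apply_star_mul` evaluates what remains. The result is the hypothesis of
`posSemidef_of_trace` for the vector `star v`. -/
theorem IsHaar.trace_mul_haarMatrix (hh : H.IsHaar h) (hW : H.IsCorep W) (v : N → ℂ)
    {d : Matrix N N ℂ} (hd : ∀ φ : A →ₗ[ℂ] ℂ, Commute d (W.map φ)) :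
    (d * haarMatrix h W v).trace = star (star v) ⬝ᵥ d.mulVec (star v) := by
  have h1 : ∀ k j, ∑ l, d l j • W k l = ∑ n, d k n • W n j := by
    intro k j
    rw [← sub_eq_zero, ← Module.forall_dual_apply_eq_zero_iff ℂ]
    intro φ
    have := congrFun (congrFun (hd φ).eq k) j
    rw [Matrix.mul_apply, Matrix.mul_apply] at this
    simp only [Matrix.map_apply] at this
    simp only [map_sub, map_sum, map_smul, smul_eq_mul]
    rw [this, sub_eq_zero]
    exact Finset.sum_congr rfl fun _ _ => mul_comm _ _
  have h2 : ∀ i k, ∑ l, ∑ j, d l j * h (star (W i j) * W k l) = d k i := by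
    intro i k
    calc ∑ l, ∑ j, d l j * h (star (W i j) * W k l)
        = ∑ j, h (star (W i j) * ∑ l, d l j • W k l) := by
          rw [Finset.sum_comm]
          simp only [Finset.mul_sum, mul_smul_comm, map_sum, map_smul, smul_eq_mul]
      _ = ∑ n, d k n * ∑ j, h (star (W i j) * W n j) := by
          simp only [h1, Finset.mul_sum, mul_smul_comm, map_sum, map_smul, smul_eq_mul]
          rw [Finset.sum_comm]
      _ = d k i := by
          simp only [hh.sum_apply_star_mul hW]
          simp
  have h3 : (d * haarMatrix h W v).trace = ∑ i, ∑ k, (star (v i) * v k) *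
      ∑ l, ∑ j, d l j * h (star (W i j) * W k l) := by
    simp only [Matrix.trace, Matrix.diag_apply, Matrix.mul_apply, haarMatrix_apply, Finset.mul_sum]
    rw [sum_sum_sum_sum_comm]
    refine Finset.sum_congr rfl fun i _ => Finset.sum_congr rfl fun k _ =>
      Finset.sum_congr rfl fun l _ => Finset.sum_congr rfl fun j _ => ?_
    ring
  rw [h3, Finset.sum_comm]
  simp only [h2, dotProduct, Matrix.mulVec, star_star, Pi.star_apply, Finset.mul_sum]
  refine Finset.sum_congr rfl fun i _ => Finset.sum_congr rfl fun k _ => ?_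
  ring

/-- The Haar functional is positive. -/
theorem IsHaar.nonneg (hh : H.IsHaar h) (hA : ∀ a, H.IsCoef a) (a : A) : 0 ≤ h (star a * a) := by
  obtain ⟨N, _, _, W, hW, v, c, rfl⟩ := hA a
  have hy : (haarMatrix h W v).PosSemidef :=
    posSemidef_of_trace (hh.haarMatrix_isHermitian hA v) (star v) fun d hd =>
      hh.trace_mul_haarMatrix hW v fun φ => hd _ (hh.haarMatrix_commute hW v φ)
  -- For `a = ∑ v i * c j * W i j`, the number `h (a* a)` is the quadratic form of `haarMatrix` at
  -- `c`.
  have h1 := hy.dotProduct_mulVec_nonneg c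
  refine h1.trans (le_of_eq ?_)
  have h2 : star (∑ i, ∑ j, (v i * c j) • W i j) * (∑ i, ∑ j, (v i * c j) • W i j) =
      ∑ i, ∑ k, ∑ j, ∑ l, (star (v i * c j) * (v k * c l)) • (star (W i j) * W k l) := by
    simp only [star_sum, Finset.sum_mul_sum, star_smul, smul_mul_smul_comm]
  rw [h2, ← sum_sum_sum_sum_comm fun j l i k =>
    (star (v i * c j) * (v k * c l)) • (star (W i j) * W k l)]
  simp only [dotProduct, Matrix.mulVec, haarMatrix_apply, Finset.mul_sum, Finset.sum_mul, map_sum,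
    map_smul, smul_eq_mul, Pi.star_apply]
  refine Finset.sum_congr rfl fun i _ => Finset.sum_congr rfl fun k _ =>
    Finset.sum_congr rfl fun l _ => Finset.sum_congr rfl fun j _ => ?_
  rw [star_mul']
  ring

end KacData

end

end QuantumAut

namespace QuantumAut

noncomputable section

open scoped ComplexOrder InnerProductSpace

/-! ### The Gelfand-Naimark-Segal construction -/

/-- A positive functional on a `*`-algebra. -/
structure PosFunctional (A : Type u) [Ring A] [StarRing A] [Algebra ℂ A] [StarModule ℂ A] where
  /-- the underlying linear functional -/
  toLin : A →ₗ[ℂ] ℂ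
  apply_star : ∀ a, toLin (star a) = star (toLin a)
  nonneg : ∀ a, 0 ≤ toLin (star a * a)

namespace PosFunctional

variable {A : Type u} [Ring A] [StarRing A] [Algebra ℂ A] [StarModule ℂ A] (f : PosFunctional A)

/-- The algebra `A` with the inner product given by a positive functional. -/
@[nolint unusedArguments]
def PreGNS (_ : PosFunctional A) : Type u := A

instance : AddCommGroup f.PreGNS := inferInstanceAs (AddCommGroup A)

instance : Module ℂ f.PreGNS := inferInstanceAs (Module ℂ A)

/-- The identity map from `A` to the space of the Gelfand-Naimark-Segal construction. -/
def toPreGNS : A ≃ₗ[ℂ] f.PreGNS := LinearEquiv.refl ℂ _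

/-- The inner product given by a positive functional. -/
abbrev core : PreInnerProductSpace.Core ℂ f.PreGNS where
  inner a b := f.toLin (star (f.toPreGNS.symm a) * f.toPreGNS.symm b)
  conj_inner_symm a b := by
    rw [← Complex.star_def, ← f.apply_star, star_mul, star_star]
  re_inner_nonneg a := (RCLike.nonneg_iff.mp (f.nonneg _)).1
  add_left _ _ _ := by rw [map_add, star_add, add_mul, map_add]
  smul_left := by simp

instance : SeminormedAddCommGroup f.PreGNS :=
  InnerProductSpace.Core.toSeminormedAddCommGroup (c := f.core)

instance : InnerProductSpace ℂ f.PreGNS := InnerProductSpace.ofCore f.core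

theorem inner_def (a b : f.PreGNS) :
    ⟪a, b⟫_ℂ = f.toLin (star (f.toPreGNS.symm a) * f.toPreGNS.symm b) := rfl

/-- Left multiplication. -/
def leftMul (a : A) : f.PreGNS →ₗ[ℂ] f.PreGNS :=
  f.toPreGNS.toLinearMap ∘ₗ LinearMap.mulLeft ℂ a ∘ₗ f.toPreGNS.symm.toLinearMap

theorem leftMul_apply (a : A) (x : f.PreGNS) :
    f.leftMul a x = f.toPreGNS (a * f.toPreGNS.symm x) := rfl

theorem inner_leftMul (a : A) (x y : f.PreGNS) :
    ⟪f.leftMul a x, y⟫_ℂ = ⟪x, f.leftMul (star a) y⟫_ℂ := by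
  rw [inner_def, inner_def, leftMul_apply, leftMul_apply, LinearEquiv.symm_apply_apply,
    LinearEquiv.symm_apply_apply, star_mul, mul_assoc]

theorem leftMul_mul (a b : A) (x : f.PreGNS) :
    f.leftMul (a * b) x = f.leftMul a (f.leftMul b x) := by
  simp only [leftMul_apply, LinearEquiv.symm_apply_apply, mul_assoc]

theorem leftMul_add (a b : A) (x : f.PreGNS) :
    f.leftMul (a + b) x = f.leftMul a x + f.leftMul b x := by
  simp only [leftMul_apply, add_mul, map_add]

theorem leftMul_algebraMap (c : ℂ) (x : f.PreGNS) : f.leftMul (algebraMap ℂ A c) x = c • x := by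
  rw [leftMul_apply, ← Algebra.smul_def, map_smul, LinearEquiv.apply_symm_apply]

theorem le_of_sq_le_mul {r s : ℝ} (hr : 0 ≤ r) (hs : 0 ≤ s) (h : r * r ≤ s * r) : r ≤ s := by
  rcases hr.eq_or_lt with h0 | h0
  · rwa [← h0]
  · exact le_of_mul_le_mul_right h h0

/-- This is the Cauchy-Schwarz inequality for `⟪a x, a x⟫ = ⟪x, a* a x⟫`. It bounds projections by
`1` and passes a bound for `a` on to `a*`, so no norm on `A` is required. -/
theorem norm_leftMul_mul_self (a : A) (x : f.PreGNS) :
    ‖f.leftMul a x‖ * ‖f.leftMul a x‖ ≤ ‖x‖ * ‖f.leftMul (star a) (f.leftMul a x)‖ := by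
  rw [← inner_self_eq_norm_mul_norm (𝕜 := ℂ), inner_leftMul]
  exact (RCLike.re_le_norm _).trans (norm_inner_le_norm _ _)

theorem norm_leftMul_le_of_projection {e : A} (he : e * e = e) (hs : star e = e) (x : f.PreGNS) :
    ‖f.leftMul e x‖ ≤ ‖x‖ := by
  have h := f.norm_leftMul_mul_self e x
  rw [hs, ← leftMul_mul, he] at h
  exact le_of_sq_le_mul (norm_nonneg _) (norm_nonneg _) h

/-- The elements that act by bounded operators. -/
def boundedSubalgebra : StarSubalgebra ℂ A where
  carrier := {a | ∃ C, 0 ≤ C ∧ ∀ x, ‖f.leftMul a x‖ ≤ C * ‖x‖}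
  mul_mem' := by
    rintro a b ⟨C, hC, ha⟩ ⟨D, hD, hb⟩
    refine ⟨C * D, mul_nonneg hC hD, fun x => ?_⟩
    rw [leftMul_mul, mul_assoc]
    exact (ha _).trans (mul_le_mul_of_nonneg_left (hb x) hC)
  add_mem' := by
    rintro a b ⟨C, hC, ha⟩ ⟨D, hD, hb⟩
    refine ⟨C + D, add_nonneg hC hD, fun x => ?_⟩
    rw [leftMul_add, add_mul]
    exact (norm_add_le _ _).trans (add_le_add (ha x) (hb x))
  algebraMap_mem' c := ⟨‖c‖, norm_nonneg _, fun x => by rw [leftMul_algebraMap, norm_smul]⟩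
  star_mem' := by
    rintro a ⟨C, hC, ha⟩
    refine ⟨C, hC, fun x => le_of_sq_le_mul (norm_nonneg _) (by positivity) ?_⟩
    refine (f.norm_leftMul_mul_self (star a) x).trans ?_
    rw [star_star, mul_comm C, mul_assoc]
    exact mul_le_mul_of_nonneg_left (ha _) (norm_nonneg _)

/-- The Hilbert space of the Gelfand-Naimark-Segal construction. -/
abbrev GNS : Type u := UniformSpace.Completion f.PreGNS

section representation

variable (hf : ∀ a, a ∈ f.boundedSubalgebra)

/-- Left multiplication as a bounded operator. -/
def leftMulL (a : A) : f.PreGNS →L[ℂ] f.PreGNS :=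
  (f.leftMul a).mkContinuousOfExistsBound (by
    obtain ⟨C, -, h⟩ := hf a
    exact ⟨C, h⟩)

theorem leftMulL_apply (a : A) (x : f.PreGNS) : f.leftMulL hf a x = f.leftMul a x := rfl

theorem completion_leftMulL_coe (a : A) (x : f.PreGNS) :
    (f.leftMulL hf a).completion (x : f.GNS) = (f.leftMul a x : f.PreGNS) := by
  simp [leftMulL_apply]

theorem ext_on_dense {S T : f.GNS →L[ℂ] f.GNS} (h : ∀ x : f.PreGNS, S (x : f.GNS) = T (x : f.GNS)) :
    S = T := by
  ext c
  induction c using UniformSpace.Completion.induction_on with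
  | hp => exact isClosed_eq S.continuous T.continuous
  | ih c => exact h c

/-- The representation of the Gelfand-Naimark-Segal construction. -/
def representation : A →⋆ₐ[ℂ] (f.GNS →L[ℂ] f.GNS) where
  toFun a := (f.leftMulL hf a).completion
  map_one' := f.ext_on_dense fun x => by
    rw [completion_leftMulL_coe, leftMul_apply, one_mul, LinearEquiv.apply_symm_apply]; rfl
  map_mul' a b := f.ext_on_dense fun x => by
    rw [completion_leftMulL_coe, leftMul_mul, mul_apply_eq_comp,
      completion_leftMulL_coe, completion_leftMulL_coe]
  map_zero' := f.ext_on_dense fun x => by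
    rw [completion_leftMulL_coe, leftMul_apply, zero_mul, map_zero]; rfl
  map_add' a b := f.ext_on_dense fun x => by
    rw [completion_leftMulL_coe, leftMul_add, add_apply,
      completion_leftMulL_coe, completion_leftMulL_coe, UniformSpace.Completion.coe_add]
  commutes' c := f.ext_on_dense fun x => by
    rw [completion_leftMulL_coe, leftMul_algebraMap, UniformSpace.Completion.coe_smul]
    rfl
  map_star' a := by
    rw [ContinuousLinearMap.star_eq_adjoint]
    refine (ContinuousLinearMap.eq_adjoint_iff _ _).mpr fun x y => ?_
    induction x, y using UniformSpace.Completion.induction_on₂ with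
    | hp => apply isClosed_eq <;> fun_prop
    | ih x y =>
      rw [completion_leftMulL_coe, completion_leftMulL_coe, UniformSpace.Completion.inner_coe,
        UniformSpace.Completion.inner_coe, inner_leftMul, star_star]

theorem inner_representation (a : A) :
    ⟪((f.toPreGNS 1 : f.PreGNS) : f.GNS), f.representation hf a (f.toPreGNS 1 : f.PreGNS)⟫_ℂ =
      f.toLin a := by
  change ⟪((f.toPreGNS 1 : f.PreGNS) : f.GNS), (f.leftMulL hf a).completion _⟫_ℂ = _
  rw [completion_leftMulL_coe, UniformSpace.Completion.inner_coe, inner_def, leftMul_apply,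
    LinearEquiv.symm_apply_apply, LinearEquiv.symm_apply_apply, star_one, one_mul, mul_one]

theorem representation_ne_zero {a : A} (ha : f.toLin a ≠ 0) : f.representation hf a ≠ 0 := by
  intro h
  rw [← f.inner_representation hf, h] at ha
  simp at ha

end representation

end PosFunctional

/-! ### Restriction to the range of a projection -/

section compression

variable {H : Type u} [NormedAddCommGroup H] [InnerProductSpace ℂ H] [CompleteSpace H]
  (q : H →L[ℂ] H)

/-- The range of a projection, as the space of its fixed vectors. -/
abbrev fixedSpace : Submodule ℂ H := LinearMap.ker ((1 : H →L[ℂ] H) - q).toLinearMap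

theorem mem_fixedSpace {x : H} : x ∈ fixedSpace q ↔ q x = x := by
  rw [LinearMap.mem_ker]
  change x - q x = 0 ↔ _
  rw [sub_eq_zero, eq_comm]

instance : CompleteSpace (fixedSpace q) :=
  (ContinuousLinearMap.isClosed_ker ((1 : H →L[ℂ] H) - q)).completeSpace_coe

variable {q}

/-- The restriction to the range of `q` of an operator that commutes with `q`. -/
def restrictFixed (T : H →L[ℂ] H) (hT : Commute T q) : fixedSpace q →L[ℂ] fixedSpace q :=
  (T.comp (fixedSpace q).subtypeL).codRestrict _ fun x => by
    rw [mem_fixedSpace]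
    change (q * T) x.1 = T x.1
    rw [← hT.eq]
    exact congrArg T ((mem_fixedSpace q).mp x.2)

theorem restrictFixed_apply (T : H →L[ℂ] H) (hT : Commute T q) (x : fixedSpace q) :
    (restrictFixed T hT x : H) = T x := rfl

theorem nontrivial_fixedSpace (hq : q * q = q) (h : q ≠ 0) : Nontrivial (fixedSpace q) := by
  obtain ⟨x, hx⟩ : ∃ x, q x ≠ 0 := by
    by_contra! hc
    exact h (by ext x; simp [hc x])
  refine ⟨⟨⟨q x, ?_⟩, 0, ?_⟩⟩
  · rw [mem_fixedSpace]
    exact congrArg (fun T : H →L[ℂ] H => T x) hq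
  · exact fun h => hx (congrArg Subtype.val h)

theorem restrictFixed_star (T : H →L[ℂ] H) (hT : Commute T q) (hs : star T = T) :
    star (restrictFixed T hT) = restrictFixed T hT := by
  rw [ContinuousLinearMap.star_eq_adjoint, eq_comm]
  refine (ContinuousLinearMap.eq_adjoint_iff _ _).mpr fun x y => ?_
  have := ContinuousLinearMap.adjoint_inner_left T (y : H) (x : H)
  rw [← ContinuousLinearMap.star_eq_adjoint, hs] at this
  exact this

end compression

end

end QuantumAut

namespace QuantumAut

noncomputable section

open scoped ComplexOrder

namespace MarkedGraph

/-! ### Representations of quantum automorphism groups -/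

variable {X Y : MarkedGraph.{u}}

theorem isQuantumIso_one [DecidableEq X.V] {A : Type v} [Ring A] [StarRing A] :
    IsQuantumIso X X (1 : Matrix X.V X.V A) where
  magic :=
    { idem := fun i j => by by_cases h : i = j <;> simp [Matrix.one_apply, h]
      selfadj := fun i j => by by_cases h : i = j <;> simp [Matrix.one_apply, h]
      row_orth := fun i j k h => by
        by_cases h' : i = j
        · subst h'; simp [Matrix.one_apply_ne h]
        · simp [Matrix.one_apply_ne h']
      col_orth := fun i k j h => by
        by_cases h' : k = j
        · subst h'; simp [Matrix.one_apply_ne h]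
        · simp [Matrix.one_apply_ne h']
      row_sum := fun i => by simp [Matrix.one_apply]
      col_sum := fun i => by simp [Matrix.one_apply] }
  intertwines := by rw [one_mul, mul_one]
  mark x y h := by
    refine Matrix.one_apply_ne ?_
    rintro rfl
    exact h Iff.rfl

/-- For the identity of `X` this supplies the antipode, which sends `u x y` to `u y x` in the
opposite algebra. The counit comes from `isQuantumIso_one`. -/
theorem isQuantumIso_op {A : Type v} [Ring A] [StarRing A] [Algebra ℂ A] {U : Matrix Y.V X.V A}
    (hU : IsQuantumIso X Y U) :
    IsQuantumIso Y X (Matrix.of fun x a => MulOpposite.op (U a x)) where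
  magic :=
    { idem := fun i j => congrArg MulOpposite.op (hU.magic.idem j i)
      selfadj := fun i j => congrArg MulOpposite.op (hU.magic.selfadj j i)
      row_orth := fun i j k h => congrArg MulOpposite.op (hU.magic.col_orth k j i h.symm)
      col_orth := fun i k j h => congrArg MulOpposite.op (hU.magic.row_orth j k i h.symm)
      row_sum := fun i => by simpa using congrArg MulOpposite.op (hU.magic.col_sum i)
      col_sum := fun i => by simpa using congrArg MulOpposite.op (hU.magic.row_sum i) }
  intertwines := by
    ext x a
    have h := congrFun (congrFun hU.intertwines a) x
    have hX : ∀ y z, X.adj A y z = X.adj A z y := fun y z => by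
      by_cases h : X.graph.Adj y z
      · rw [adj_apply_of_adj h, adj_apply_of_adj h.symm]
      · rw [adj_apply_of_not_adj h, adj_apply_of_not_adj fun h' => h h'.symm]
    have hY : ∀ y z, Y.adj A y z = Y.adj A z y := fun y z => by
      by_cases h : Y.graph.Adj y z
      · rw [adj_apply_of_adj h, adj_apply_of_adj h.symm]
      · rw [adj_apply_of_not_adj h, adj_apply_of_not_adj fun h' => h h'.symm]
    have hX' : ∀ y z, X.adj Aᵐᵒᵖ y z = MulOpposite.op (X.adj A z y) := fun y z => by
      rw [hX]
      by_cases h : X.graph.Adj y z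
      · rw [adj_apply_of_adj h, adj_apply_of_adj h, MulOpposite.op_one]
      · rw [adj_apply_of_not_adj h, adj_apply_of_not_adj h, MulOpposite.op_zero]
    have hY' : ∀ y z, Y.adj Aᵐᵒᵖ y z = MulOpposite.op (Y.adj A z y) := fun y z => by
      rw [hY]
      by_cases h : Y.graph.Adj y z
      · rw [adj_apply_of_adj h, adj_apply_of_adj h, MulOpposite.op_one]
      · rw [adj_apply_of_not_adj h, adj_apply_of_not_adj h, MulOpposite.op_zero]
    rw [Matrix.mul_apply, Matrix.mul_apply] at h ⊢
    simp only [hX', hY', Matrix.of_apply, ← MulOpposite.op_mul, ← Finset.op_sum]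
    rw [h]
  mark x a h := by
    rw [Matrix.of_apply, hU.mark a x fun h' => h h'.symm, MulOpposite.op_zero]

open scoped Classical in
/-- The structure of a quantum group of Kac type on the quantum automorphism group. -/
def kacData (X : MarkedGraph.{u}) : KacData X.QuAlgebra where
  comul := X.Qu.comul
  counit := quLift 1 isQuantumIso_one
  antipode := quLift _ (isQuantumIso_op X.quU_isQuantumIso)

open scoped Classical in
theorem kacData_counit_quU (i j : X.V) :
    X.kacData.counit (X.quU i j) = (1 : Matrix X.V X.V ℂ) i j :=
  quLift_quU _ isQuantumIso_one i j

theorem isCorep_quU [DecidableEq X.V] : X.kacData.IsCorep X.quU where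
  comul i j := X.Qu.comul_U i j
  counit := by
    ext i j
    rw [Matrix.map_apply]
    convert kacData_counit_quU i j
  antipode i j := by
    rw [X.quU_isQuantumIso.magic.selfadj]
    exact quLift_quU _ (isQuantumIso_op X.quU_isQuantumIso) i j
  star_mul_self := by
    ext i j
    rw [Matrix.mul_apply]
    simp only [Matrix.conjTranspose_apply, X.quU_isQuantumIso.magic.selfadj]
    by_cases h : i = j
    · subst h
      simp [X.quU_isQuantumIso.magic.idem, X.quU_isQuantumIso.magic.col_sum]
    · rw [Matrix.one_apply_ne h]
      exact Finset.sum_eq_zero fun k _ => X.quU_isQuantumIso.magic.row_orth k i j h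
  mul_star_self := by
    ext i j
    rw [Matrix.mul_apply]
    simp only [Matrix.conjTranspose_apply, X.quU_isQuantumIso.magic.selfadj]
    by_cases h : i = j
    · subst h
      simp [X.quU_isQuantumIso.magic.idem, X.quU_isQuantumIso.magic.row_sum]
    · rw [Matrix.one_apply_ne h]
      exact Finset.sum_eq_zero fun k _ => X.quU_isQuantumIso.magic.col_orth i j k h

theorem isCoef_kacData (a : X.QuAlgebra) : X.kacData.IsCoef a := by
  classical
  exact X.Qu.map_mem (StarAlgHom.id ℂ _) X.kacData.coefSubalgebra
    (fun i j => isCorep_quU.isCoef i j) a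

/-- The Haar functional does not vanish on the nonzero coefficients of the fundamental
representation. -/
theorem haar_quU_ne_zero {h : X.QuAlgebra →ₗ[ℂ] ℂ} (hh : X.kacData.IsHaar h) {x y : X.V}
    (hxy : X.quU x y ≠ 0) : h (X.quU x y) ≠ 0 := by
  classical
  have hU := X.quU_isQuantumIso.magic
  -- Multiplying `∑ t, h (u x t) • u t z = h (u x z) • 1` by `u t z` isolates one term. For `t = x`,
  -- all nonzero coefficients in the row `x` have the Haar value `h (u x x)`, and this value is not
  -- `0` because the row sums up to `1`.
  have key : ∀ t z, X.quU t z ≠ 0 → h (X.quU x t) = h (X.quU x z) := by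
    intro t z htz
    have h1 := congrArg (X.quU t z * ·) (hh.leftInv _ _ isCorep_quU x z)
    simp only [Finset.mul_sum, mul_smul_comm, mul_one] at h1
    rw [Finset.sum_eq_single t, hU.idem] at h1
    · have h2 : (h (X.quU x t) - h (X.quU x z)) • X.quU t z = 0 := by
        rw [sub_smul, h1, sub_self]
      exact sub_eq_zero.mp ((smul_eq_zero.mp h2).resolve_right htz)
    · intro s _ hs
      rw [hU.col_orth t s z hs.symm, smul_zero]
    · simp
  intro h0
  have h1 : ∑ z, h (X.quU x z) = 1 := by rw [← map_sum, hU.row_sum, hh.map_one]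
  refine one_ne_zero (h1.symm.trans (Finset.sum_eq_zero fun z _ => ?_))
  by_cases hz : X.quU x z = 0
  · rw [hz, map_zero]
  · rw [← key x z hz, key x y hxy, h0]

/-- A nonzero coefficient of the fundamental representation is detected by a representation on a
Hilbert space. -/
theorem exists_representation {x y : X.V} (hxy : X.quU x y ≠ 0) :
    ∃ (H : Type u) (_ : NormedAddCommGroup H) (_ : InnerProductSpace ℂ H) (_ : CompleteSpace H)
      (π : X.QuAlgebra →⋆ₐ[ℂ] (H →L[ℂ] H)), π (X.quU x y) ≠ 0 := by
  obtain ⟨h, hh⟩ := X.kacData.exists_isHaar isCoef_kacData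
  let f : PosFunctional X.QuAlgebra :=
    ⟨h, hh.apply_star isCoef_kacData, hh.nonneg isCoef_kacData⟩
  have hf : ∀ a, a ∈ f.boundedSubalgebra :=
    X.Qu.map_mem (StarAlgHom.id ℂ _) f.boundedSubalgebra fun i j =>
      ⟨1, zero_le_one, fun ξ => by
        rw [one_mul]
        exact f.norm_leftMul_le_of_projection (X.quU_isQuantumIso.magic.idem i j)
          (X.quU_isQuantumIso.magic.selfadj i j) ξ⟩
  exact ⟨f.GNS, inferInstance, inferInstance, inferInstance, f.representation hf,
    f.representation_ne_zero hf (haar_quU_ne_zero hh hxy)⟩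

/-! ### Quantum automorphisms and connected components -/

variable (X) in
/-- The vertices are the disjoint union of the connected components. -/
def componentEquiv : (Σ c, (X.component c).V) ≃ X.V :=
  Equiv.sigmaFiberEquiv X.graph.connectedComponentMk

theorem sum_component {M : Type*} [AddCommMonoid M] (f : X.V → M) :
    ∑ c, ∑ y : (X.component c).V, f y.1 = ∑ y, f y := by
  rw [← (componentEquiv X).sum_comp, Fintype.sum_sigma]
  rfl

variable (X) in
/-- Every connected component contains exactly one marked vertex. -/
def IsRooted : Prop :=
  ∀ c : X.graph.ConnectedComponent, ∃! x : (X.component c).V, x ∈ (X.component c).mark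

section rooted

variable (hX : X.IsRooted)

/-- The root of a connected component. -/
def IsRooted.root (c : X.graph.ConnectedComponent) : (X.component c).V := (hX c).choose

theorem IsRooted.root_mem (c : X.graph.ConnectedComponent) : (hX.root c).1 ∈ X.mark :=
  (hX c).choose_spec.1

theorem IsRooted.eq_root {c : X.graph.ConnectedComponent} (x : (X.component c).V)
    (hx : x.1 ∈ X.mark) : x = hX.root c :=
  (hX c).choose_spec.2 x hx

variable {A : Type v} [Ring A] [StarRing A] [Algebra ℂ A] {U : Matrix X.V X.V A}
  (hU : IsQuantumIso X X U)

include hU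

/-- Let `P d` and `P' d` be the sums of the rows `x` and `x'` over the component `d`. No edge joins
two components, so `P c * P' d = 0` for `c ≠ d`. Each family sums up to `1`, whence `P d = P d * P'
d = P' d`. -/
theorem IsQuantumIso.sum_component_eq_of_adj {x x' : X.V} (h : X.graph.Adj x x')
    (d : X.graph.ConnectedComponent) :
    ∑ y : (X.component d).V, U x y.1 = ∑ y : (X.component d).V, U x' y.1 := by
  have h0 : ∀ c d : X.graph.ConnectedComponent, c ≠ d →
      (∑ y : (X.component c).V, U x y.1) * (∑ y : (X.component d).V, U x' y.1) = 0 := by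
    intro c d hcd
    rw [Finset.sum_mul_sum]
    refine Finset.sum_eq_zero fun y _ => Finset.sum_eq_zero fun z _ => hU.mul_eq_zero fun hiff => ?_
    have hyz := hiff.mp h
    have hy : X.graph.connectedComponentMk y.1 = c := y.2
    have hz : X.graph.connectedComponentMk z.1 = d := z.2
    exact hcd (hy.symm.trans ((SimpleGraph.ConnectedComponent.sound hyz.reachable).trans hz))
  have h1 : ∑ y : (X.component d).V, U x y.1 =
      (∑ y : (X.component d).V, U x y.1) * (∑ y : (X.component d).V, U x' y.1) := by
    conv_lhs => rw [← mul_one (∑ y : (X.component d).V, U x y.1), ← hU.magic.row_sum x',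
      ← sum_component fun y => U x' y, Finset.mul_sum]
    exact Finset.sum_eq_single d (fun c _ hc => h0 d c hc.symm)
      fun h => absurd (Finset.mem_univ d) h
  have h2 : ∑ y : (X.component d).V, U x' y.1 =
      (∑ y : (X.component d).V, U x y.1) * (∑ y : (X.component d).V, U x' y.1) := by
    conv_lhs => rw [← one_mul (∑ y : (X.component d).V, U x' y.1), ← hU.magic.row_sum x,
      ← sum_component fun y => U x y, Finset.sum_mul]
    exact Finset.sum_eq_single d (fun c _ hc => h0 c d hc) fun h => absurd (Finset.mem_univ d) h
  rw [h1, ← h2]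

theorem IsQuantumIso.sum_component_eq_of_reachable {x x' : X.V} (h : X.graph.Reachable x x')
    (d : X.graph.ConnectedComponent) :
    ∑ y : (X.component d).V, U x y.1 = ∑ y : (X.component d).V, U x' y.1 := by
  obtain ⟨p⟩ := h
  induction p with
  | nil => rfl
  | cons h _ ih => exact (hU.sum_component_eq_of_adj h d).trans ih

/-- The sum may be computed in the row of the root of `c`, where preservation of marks leaves only
the root of `d`. -/
theorem IsQuantumIso.sum_row {c d : X.graph.ConnectedComponent} (x : (X.component c).V) :
    ∑ y : (X.component d).V, U x.1 y.1 = U (hX.root c).1 (hX.root d).1 := by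
  rw [hU.sum_component_eq_of_reachable (c.reachable_of_mem_supp x.2 (hX.root c).2),
    Finset.sum_eq_single (hX.root d)]
  · intro y _ hy
    refine hU.mark _ _ fun h => hy (hX.eq_root y (h.mp (hX.root_mem c)))
  · simp

theorem IsQuantumIso.sum_col {c d : X.graph.ConnectedComponent} (y : (X.component d).V) :
    ∑ x : (X.component c).V, U x.1 y.1 = U (hX.root c).1 (hX.root d).1 :=
  hU.transpose.sum_row hX y

theorem IsQuantumIso.mul_root {c d : X.graph.ConnectedComponent} (x : (X.component c).V)
    (y : (X.component d).V) : U x.1 y.1 * U (hX.root c).1 (hX.root d).1 = U x.1 y.1 := by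
  rw [← hU.sum_row hX x, Finset.mul_sum, Finset.sum_eq_single y, hU.magic.idem]
  · exact fun z _ hz => hU.magic.row_orth _ _ _ fun h => hz (Subtype.ext h.symm)
  · simp

theorem IsQuantumIso.root_mul {c d : X.graph.ConnectedComponent} (x : (X.component c).V)
    (y : (X.component d).V) : U (hX.root c).1 (hX.root d).1 * U x.1 y.1 = U x.1 y.1 := by
  rw [← hU.sum_row hX x, Finset.sum_mul, Finset.sum_eq_single y, hU.magic.idem]
  · exact fun z _ hz => hU.magic.row_orth _ _ _ fun h => hz (Subtype.ext h)
  · simp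

end rooted

/-- If the block of the fundamental representation that corresponds to two connected components
does not vanish, then these components are quantum isomorphic. -/
theorem IsRooted.quantumIsomorphic (hX : X.IsRooted) {c d : X.graph.ConnectedComponent}
    (h : X.quU (hX.root c).1 (hX.root d).1 ≠ 0) :
    QuantumIsomorphic (X.component d) (X.component c) := by
  have hU := X.quU_isQuantumIso
  obtain ⟨H, _, _, _, π, hπ⟩ := exists_representation h
  set q := π (X.quU (hX.root c).1 (hX.root d).1) with hq
  -- All coefficients of the block lie under `q`, and its rows and columns sum up to `q`. On the
  -- range of `q`, which is a nonzero Hilbert space, the block thus becomes a magic unitary, with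
  -- the bounded operators as coefficient algebra.
  have hqq : q * q = q := by rw [hq, ← map_mul, hU.magic.idem]
  have hl : ∀ (x : (X.component c).V) (y : (X.component d).V),
      q * π (X.quU x.1 y.1) = π (X.quU x.1 y.1) := fun x y => by
    rw [hq, ← map_mul, hU.root_mul hX]
  have hr : ∀ (x : (X.component c).V) (y : (X.component d).V),
      π (X.quU x.1 y.1) * q = π (X.quU x.1 y.1) := fun x y => by
    rw [hq, ← map_mul, hU.mul_root hX]
  have hcomm : ∀ (x : (X.component c).V) (y : (X.component d).V),
      Commute (π (X.quU x.1 y.1)) q := fun x y => (hr x y).trans (hl x y).symm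
  have := nontrivial_fixedSpace hqq hπ
  have hsum : ∀ {ι : Type u} [Fintype ι] (x : ι → (X.component c).V) (y : ι → (X.component d).V),
      ∑ i, π (X.quU (x i).1 (y i).1) = q →
      ∑ i, restrictFixed _ (hcomm (x i) (y i)) = 1 := by
    intro ι _ x y hxy
    ext ξ
    rw [sum_apply, Submodule.coe_sum]
    simp only [restrictFixed_apply]
    rw [← sum_apply, hxy]
    exact (mem_fixedSpace q).mp ξ.2
  have hmul : ∀ (x x' : (X.component c).V) (y y' : (X.component d).V),
      X.quU x.1 y.1 * X.quU x'.1 y'.1 = 0 →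
      restrictFixed _ (hcomm x y) * restrictFixed _ (hcomm x' y') = 0 := by
    intro x x' y y' h0
    ext ξ
    change (π (X.quU x.1 y.1) * π (X.quU x'.1 y'.1)) (ξ : H) = 0
    rw [← map_mul, h0, map_zero]
    rfl
  have hmagic : IsMagic (Matrix.of fun (x : (X.component c).V) (y : (X.component d).V) =>
      restrictFixed _ (hcomm x y)) :=
    { idem := fun x y => by
        ext ξ
        change (π (X.quU x.1 y.1) * π (X.quU x.1 y.1)) (ξ : H) = π (X.quU x.1 y.1) (ξ : H)
        rw [← map_mul, hU.magic.idem]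
      selfadj := fun x y => restrictFixed_star _ (hcomm x y) (by rw [← map_star, hU.magic.selfadj])
      row_orth := fun x y z hyz => hmul _ _ _ _
        (hU.magic.row_orth _ _ _ fun e => hyz (Subtype.ext e))
      col_orth := fun x z y hxz => hmul _ _ _ _
        (hU.magic.col_orth _ _ _ fun e => hxz (Subtype.ext e))
      row_sum := fun x => hsum (fun _ => x) (fun y => y) (by rw [← map_sum, hU.sum_row hX])
      col_sum := fun y => hsum (fun x => x) (fun _ => y) (by rw [← map_sum, hU.sum_col hX]) }
  refine ⟨fixedSpace q →L[ℂ] fixedSpace q, inferInstance, inferInstance, ?_⟩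
  refine ⟨_, hmagic, intertwines_of_mul_eq_zero hmagic fun x x' y y' hxy =>
    hmul _ _ _ _ (hU.mul_eq_zero hxy), fun x y hxy => ?_⟩
  ext ξ
  change π (X.quU x.1 y.1) (ξ : H) = 0
  rw [hU.mark x.1 y.1 hxy, map_zero]
  rfl

end MarkedGraph

end

end QuantumAut

namespace QuantumAut

noncomputable section

theorem IsMagic.submatrix {I J I' J' A : Type*} [Fintype I] [Fintype J] [Fintype I'] [Fintype J']
    [Ring A] [StarRing A] {U : Matrix I J A} (hU : IsMagic U) (e : I' ≃ I) (f : J' ≃ J) :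
    IsMagic (U.submatrix e f) where
  idem _ _ := hU.idem _ _
  selfadj _ _ := hU.selfadj _ _
  row_orth _ _ _ h := hU.row_orth _ _ _ fun h' => h (f.injective h')
  col_orth _ _ _ h := hU.col_orth _ _ _ fun h' => h (e.injective h')
  row_sum i := (f.sum_comp fun j => U (e i) j).trans (hU.row_sum _)
  col_sum j := (e.sum_comp fun i => U i (f j)).trans (hU.col_sum _)

namespace MarkedGraph

/-! ### The decomposition into quantum isomorphism classes of components -/

variable {X : MarkedGraph.{u}}

variable (X) in
/-- The disjoint union of the components in a quantum isomorphism class. -/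
abbrev classSum (l : X.QIClass) : MarkedGraph.{u} := sum fun c : X.classMembers l => X.component c.1

variable (X) in
/-- The vertices are the disjoint union of the vertices of the components in the various quantum
isomorphism classes. -/
def classEquiv : (Σ l, (X.classSum l).V) ≃ X.V where
  toFun p := p.2.2.1
  invFun x := ⟨X.qiClass (X.graph.connectedComponentMk x), ⟨⟨_, rfl⟩, ⟨x, rfl⟩⟩⟩
  left_inv := by
    rintro ⟨l, ⟨⟨c, hc⟩, ⟨x, hx⟩⟩⟩
    obtain rfl : X.graph.connectedComponentMk x = c := hx
    subst hc
    rfl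
  right_inv x := rfl

theorem qiClass_classEquiv (l : X.QIClass) (p : (X.classSum l).V) :
    X.qiClass (X.graph.connectedComponentMk p.2.1) = l := by
  have : X.graph.connectedComponentMk p.2.1 = p.1.1 := p.2.2
  rw [this, p.1.2]

theorem sum_adj_iff {I : Type u} {_ : Fintype I} {X : I → MarkedGraph.{u}} {i j : I} {x : (X i).V}
    {y : (X j).V} : (sum X).graph.Adj ⟨i, x⟩ ⟨j, y⟩ ↔ ∃ h : i = j, (X j).graph.Adj (h ▸ x) y := by
  constructor
  · intro h
    cases h with
    | mk i x y h => exact ⟨rfl, h⟩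
  · rintro ⟨rfl, h⟩
    exact SumAdj.mk i x y h

theorem sum_adj_same {I : Type u} {_ : Fintype I} {X : I → MarkedGraph.{u}} {i : I}
    {x y : (X i).V} :
    (sum X).graph.Adj ⟨i, x⟩ ⟨i, y⟩ ↔ (X i).graph.Adj x y := by
  rw [sum_adj_iff]
  exact ⟨fun ⟨_, h⟩ => h, fun h => ⟨rfl, h⟩⟩

theorem sum_adj_ne {I : Type u} {_ : Fintype I} {X : I → MarkedGraph.{u}} {i j : I} (hij : i ≠ j)
    {x : (X i).V} {y : (X j).V} : ¬ (sum X).graph.Adj ⟨i, x⟩ ⟨j, y⟩ := by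
  rw [sum_adj_iff]
  exact fun ⟨h, _⟩ => hij h

theorem classSum_adj_iff {l : X.QIClass} (p q : (X.classSum l).V) :
    (X.classSum l).graph.Adj p q ↔ X.graph.Adj p.2.1 q.2.1 := by
  obtain ⟨c, x⟩ := p
  obtain ⟨d, y⟩ := q
  by_cases h : c = d
  · subst h
    rw [sum_adj_same]
    rfl
  · refine iff_of_false (sum_adj_ne h) fun hxy => h (Subtype.ext ?_)
    have hx : X.graph.connectedComponentMk x.1 = c.1 := x.2
    have hy : X.graph.connectedComponentMk y.1 = d.1 := y.2
    rw [← hx, ← hy]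
    exact SimpleGraph.ConnectedComponent.sound hxy.reachable

theorem classSum_injective {l : X.QIClass} {p q : (X.classSum l).V} (h : p.2.1 = q.2.1) :
    p = q := by
  have := (classEquiv X).injective (a₁ := ⟨l, p⟩) (a₂ := ⟨l, q⟩) h
  simpa using this

theorem sum_classSum {M : Type*} [AddCommMonoid M] (f : X.V → M) (l : X.QIClass)
    (hf : ∀ x, X.qiClass (X.graph.connectedComponentMk x) ≠ l → f x = 0) :
    ∑ p : (X.classSum l).V, f p.2.1 = ∑ x, f x := by
  rw [← (classEquiv X).sum_comp, Fintype.sum_sigma, Finset.sum_eq_single l]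
  · rfl
  · intro m _ hm
    exact Finset.sum_eq_zero fun p _ => hf _ (by
      rw [classEquiv, Equiv.coe_fn_mk, qiClass_classEquiv]; exact hm)
  · exact fun h => absurd (Finset.mem_univ l) h

section

variable {A : Type v} [Ring A] [StarRing A] [Algebra ℂ A] {U : Matrix X.V X.V A}

/-- The diagonal block that corresponds to a quantum isomorphism class. -/
theorem IsQuantumIso.classBlock (hU : IsQuantumIso X X U)
    (h0 : ∀ x y, X.qiClass (X.graph.connectedComponentMk x) ≠
      X.qiClass (X.graph.connectedComponentMk y) → U x y = 0) (l : X.QIClass) :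
    IsQuantumIso (X.classSum l) (X.classSum l) (Matrix.of fun p q => U p.2.1 q.2.1) := by
  have hm : IsMagic (Matrix.of fun p q : (X.classSum l).V => U p.2.1 q.2.1) :=
    { idem := fun p q => hU.magic.idem _ _
      selfadj := fun p q => hU.magic.selfadj _ _
      row_orth := fun p q r h => hU.magic.row_orth _ _ _ fun h' => h (classSum_injective h')
      col_orth := fun p q r h => hU.magic.col_orth _ _ _ fun h' => h (classSum_injective h')
      row_sum := fun p => by
        rw [← hU.magic.row_sum p.2.1]
        exact sum_classSum (fun y => U p.2.1 y) l fun y hy => h0 _ _ (by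
          rw [qiClass_classEquiv]; exact hy.symm)
      col_sum := fun p => by
        rw [← hU.magic.col_sum p.2.1]
        exact sum_classSum (fun y => U y p.2.1) l fun y hy => h0 _ _ (by
          rw [qiClass_classEquiv]; exact hy) }
  refine ⟨hm, intertwines_of_mul_eq_zero hm fun p q r s h => hU.mul_eq_zero ?_,
    fun p q h => hU.mark _ _ h⟩
  rwa [← classSum_adj_iff, ← classSum_adj_iff]

end

theorem qiClass_eq {c d : X.graph.ConnectedComponent}
    (h : QuantumIsomorphic (X.component c) (X.component d)) : X.qiClass c = X.qiClass d :=
  Quot.sound h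

/-- The fundamental representation of a rooted graph is block diagonal with respect to the quantum
isomorphism classes of the components. -/
theorem IsRooted.quU_eq_zero (hX : X.IsRooted) {x y : X.V}
    (h : X.qiClass (X.graph.connectedComponentMk x) ≠
      X.qiClass (X.graph.connectedComponentMk y)) : X.quU x y = 0 := by
  by_contra hxy
  refine h (qiClass_eq (hX.quantumIsomorphic fun h0 => hxy ?_)).symm
  -- Each coefficient lies under the projection at the roots of its two components, so a nonzero
  -- coefficient makes that projection nonzero.
  have := X.quU_isQuantumIso.mul_root hX (c := X.graph.connectedComponentMk x)
    (d := X.graph.connectedComponentMk y) ⟨x, rfl⟩ ⟨y, rfl⟩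
  rw [← this, h0, mul_zero]

open QuantumPermutationGroup

variable (X) in
/-- The fundamental representation of the free product, indexed by the vertices. -/
def classU : Matrix X.V X.V X.classFreeProd.A :=
  Matrix.of fun x y => freeProdU (fun l => Qu (X.classSum l)) ((classEquiv X).symm x)
    ((classEquiv X).symm y)

theorem classU_apply (p q : Σ l, (X.classSum l).V) :
    X.classU p.2.2.1 q.2.2.1 = freeProdU (fun l => Qu (X.classSum l)) p q :=
  congrArg₂ (freeProdU fun l => Qu (X.classSum l)) ((classEquiv X).symm_apply_apply p)
    ((classEquiv X).symm_apply_apply q)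

theorem classU_same (l : X.QIClass) (p q : (X.classSum l).V) :
    X.classU p.2.1 q.2.1 =
      factorInc (fun l => Qu (X.classSum l)) l ((Qu (X.classSum l)).U p q) :=
  (classU_apply ⟨l, p⟩ ⟨l, q⟩).trans (freeProdU_same (fun l => Qu (X.classSum l)) l p q)

theorem classU_ne {l m : X.QIClass} (h : l ≠ m) (p : (X.classSum l).V) (q : (X.classSum m).V) :
    X.classU p.2.1 q.2.1 = 0 :=
  (classU_apply ⟨l, p⟩ ⟨m, q⟩).trans (freeProdU_ne (fun l => Qu (X.classSum l)) h p q)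

theorem exists_classSum (x : X.V) : ∃ (l : X.QIClass) (p : (X.classSum l).V), p.2.1 = x :=
  ⟨_, ((classEquiv X).symm x).2, rfl⟩

/-- Edges stay within a class and coefficients between classes vanish. The only products left to
check lie in a single factor, where the relations hold by definition. -/
theorem isQuantumIso_classU : IsQuantumIso X X X.classU := by
  have hm : IsMagic X.classU :=
    (freeProdU_magic fun l => Qu (X.classSum l)).submatrix (classEquiv X).symm (classEquiv X).symm
  have ha : ∀ l m (p : (X.classSum l).V) (q : (X.classSum m).V), l ≠ m →
      ¬ X.graph.Adj p.2.1 q.2.1 := fun l m p q hlm h => hlm (by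
    rw [← qiClass_classEquiv l p, ← qiClass_classEquiv m q,
      SimpleGraph.ConnectedComponent.sound h.reachable])
  refine ⟨hm, intertwines_of_mul_eq_zero hm fun a b x y h => ?_, fun a x h => ?_⟩
  · obtain ⟨l, p, rfl⟩ := exists_classSum a
    obtain ⟨m, q, rfl⟩ := exists_classSum b
    obtain ⟨l', p', rfl⟩ := exists_classSum x
    obtain ⟨m', q', rfl⟩ := exists_classSum y
    by_cases hl : l = l'
    · subst hl
      by_cases hmm : m = m'
      · subst hmm
        by_cases hlm : l = m
        · subst hlm
          rw [← classSum_adj_iff, ← classSum_adj_iff] at h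
          rw [classU_same, classU_same]
          exact (map_mul (factorInc (fun l => Qu (X.classSum l)) l) _ _).symm.trans <|
            (congrArg _ ((X.classSum l).quU_isQuantumIso.mul_eq_zero h)).trans (map_zero _)
        · exact absurd (iff_of_false (ha l m p q hlm) (ha l m p' q' hlm)) h
      · rw [classU_ne hmm, mul_zero]
    · rw [classU_ne hl, zero_mul]
  · obtain ⟨l, p, rfl⟩ := exists_classSum a
    obtain ⟨l', p', rfl⟩ := exists_classSum x
    by_cases hl : l = l'
    · subst hl
      rw [classU_same]
      exact (congrArg _ ((X.classSum l).quU_isQuantumIso.mark _ _ h)).trans (map_zero _)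
    · rw [classU_ne hl]

/-- The restriction of the fundamental representation to a class of components. -/
def IsRooted.classHom (hX : X.IsRooted) (l : X.QIClass) : (Qu (X.classSum l)).A →⋆ₐ[ℂ] (Qu X).A :=
  quLift _ (X.quU_isQuantumIso.classBlock (fun _ _ => hX.quU_eq_zero) l)

theorem IsRooted.classHom_U (hX : X.IsRooted) (l : X.QIClass) (p q : (X.classSum l).V) :
    hX.classHom l ((Qu (X.classSum l)).U p q) = X.quU p.2.1 q.2.1 :=
  quLift_quU _ (X.quU_isQuantumIso.classBlock (fun _ _ => hX.quU_eq_zero) l) p q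

/-- The quantum automorphism group of a rooted graph is the free product, over the quantum
isomorphism classes of components, of the quantum automorphism groups of their unions. -/
def IsRooted.matching (hX : X.IsRooted) : Matching X.classFreeProd (Qu X) where
  e := classEquiv X
  toHom := FreeProd.lift hX.classHom
  invHom := quLift X.classU isQuantumIso_classU
  toHom_U := by
    rintro ⟨l, p⟩ ⟨m, q⟩
    change FreeProd.lift hX.classHom (freeProdU (fun l => Qu (X.classSum l)) ⟨l, p⟩ ⟨m, q⟩) =
      X.quU p.2.1 q.2.1
    by_cases h : l = m
    · subst h
      rw [freeProdU_same (fun l => Qu (X.classSum l)) l p q, FreeProd.lift_inc]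
      exact hX.classHom_U l p q
    · rw [freeProdU_ne (fun l => Qu (X.classSum l)) h p q, map_zero]
      refine (hX.quU_eq_zero ?_).symm
      rwa [qiClass_classEquiv l p, qiClass_classEquiv m q]
  invHom_U p q := (quLift_quU X.classU isQuantumIso_classU _ _).trans (classU_apply p q)

/-! ### Relabelling of fundamental representations -/

section relabel

variable {X Y : MarkedGraph.{u}} (e : Y.V ≃ X.V) (h : IsQuantumIso Y Y (X.quU.submatrix e e))

/-- The morphism of quantum groups that relabels the coefficients of the fundamental
representation. -/
def relabelHom : Hom (Qu Y) (Qu X) :=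
  Hom.ofGenerators (P := Qu Y) (Q := Qu X) (quLift (X.quU.submatrix e e) h) fun i j => by
    have hU : ∀ i j : Y.V, quLift (X.quU.submatrix e e) h ((Qu Y).U i j) = (Qu X).U (e i) (e j) :=
      quLift_quU (X.quU.submatrix e e) h
    refine ((congrArg (Qu X).comul (hU i j)).trans ((Qu X).comul_U (e i) (e j))).trans ?_
    refine (e.sum_comp fun k => (Qu X).U (e i) k ⊗ₜ[ℂ] (Qu X).U k (e j)).symm.trans ?_
    exact Finset.sum_congr rfl fun k _ => (congrArg₂ _ (hU i k) (hU k j)).symm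

theorem relabelHom_U (i j : Y.V) : relabelHom e h (Y.quU i j) = X.quU (e i) (e j) :=
  quLift_quU (X.quU.submatrix e e) h i j

theorem relabelHom_surjective : Function.Surjective (relabelHom e h) :=
  surjective_of_range (P := Qu X) _ fun (i j : X.V) => ⟨Y.quU (e.symm i) (e.symm j), by
    rw [relabelHom_U, e.apply_symm_apply, e.apply_symm_apply]; rfl⟩

/-- If the relabelled matrices are quantum automorphisms in both directions, then the quantum
automorphism groups are identified. -/
def relabelMatching (h' : IsQuantumIso X X (Y.quU.submatrix e.symm e.symm)) :
    Matching (Qu Y) (Qu X) where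
  e := e
  toHom := (relabelHom e h).toStarAlgHom
  invHom := quLift (Y.quU.submatrix e.symm e.symm) h'
  toHom_U := relabelHom_U e h
  invHom_U := fun (i j : Y.V) => (quLift_quU _ h' (e i) (e j)).trans (by
    rw [Matrix.submatrix_apply, e.symm_apply_apply, e.symm_apply_apply]; rfl)

theorem relabelHom_bijective (h' : IsQuantumIso X X (Y.quU.submatrix e.symm e.symm)) :
    Function.Bijective (relabelHom e h) :=
  (relabelMatching e h h').hom_bijective

end relabel

/-! ### The operation `Ψ` for a block -/

section block

variable {X : MarkedGraph.{u}} {A : Type v} [Ring A] [StarRing A] [Algebra ℂ A]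
  {U : Matrix X.V X.V A}

theorem psiBlock_adj_iff {x y : X.V} :
    X.psiBlock.graph.Adj x y ↔ X.graph.Adj x y ∧ ¬ (x ∈ X.mark ∧ y ∈ X.mark) := by
  change (X.graph.deleteEdges {e | ∀ v ∈ e, v ∈ X.mark}).Adj x y ↔ _
  simp [SimpleGraph.deleteEdges_adj]

theorem IsQuantumIso.psiBlock (hU : IsQuantumIso X X U) :
    IsQuantumIso X.psiBlock X.psiBlock U := by
  refine ⟨hU.magic, intertwines_of_mul_eq_zero hU.magic fun a b x y h => ?_, hU.mark⟩
  by_cases hax : a ∈ X.mark ↔ x ∈ X.mark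
  · by_cases hby : b ∈ X.mark ↔ y ∈ X.mark
    · refine hU.mul_eq_zero fun h' => h (psiBlock_adj_iff.trans
        (Iff.trans ?_ psiBlock_adj_iff.symm))
      exact h'.and (not_congr (hax.and hby))
    · rw [hU.mark b y hby, mul_zero]
  · rw [hU.mark a x hax, zero_mul]

/-- If the marked vertices form a clique, then the deleted edges are all the pairs of distinct
marked vertices. Marks are preserved by hypothesis, and distinctness by row and column
orthogonality. -/
theorem IsQuantumIso.of_psiBlock (hX : X.graph.IsClique X.mark)
    (hU : IsQuantumIso X.psiBlock X.psiBlock U) : IsQuantumIso X X U := by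
  refine ⟨hU.magic, intertwines_of_mul_eq_zero hU.magic fun a b x y h => ?_, hU.mark⟩
  by_cases hax : a ∈ X.mark ↔ x ∈ X.mark
  · by_cases hby : b ∈ X.mark ↔ y ∈ X.mark
    · by_cases hab : a = b
      · subst hab
        by_cases hxy : x = y
        · subst hxy
          simp at h
        · exact hU.magic.row_orth a x y hxy
      · by_cases hxy : x = y
        · subst hxy
          exact hU.magic.col_orth a b x hab
        · refine hU.mul_eq_zero fun h' => h ?_
          rw [psiBlock_adj_iff, psiBlock_adj_iff, hax, hby] at h'
          by_cases hm : x ∈ X.mark ∧ y ∈ X.mark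
          · exact iff_of_true (hX (hax.mpr hm.1) (hby.mpr hm.2) hab) (hX hm.1 hm.2 hxy)
          · simpa [hm] using h'
    · rw [hU.mark b y hby, mul_zero]
  · rw [hU.mark a x hax, zero_mul]

variable (X) in
/-- The morphism of quantum groups induced by the deletion of the edges between marked vertices. -/
def psiBlockHom : Hom (Qu X.psiBlock) (Qu X) :=
  relabelHom (Equiv.refl X.V) X.quU_isQuantumIso.psiBlock

theorem psiBlockHom_surjective : Function.Surjective X.psiBlockHom :=
  relabelHom_surjective (Y := X.psiBlock) (Equiv.refl X.V) X.quU_isQuantumIso.psiBlock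

theorem psiBlockHom_bijective (hX : X.graph.IsClique X.mark) :
    Function.Bijective X.psiBlockHom :=
  relabelHom_bijective (Y := X.psiBlock) (Equiv.refl X.V) X.quU_isQuantumIso.psiBlock
    (X.psiBlock.quU_isQuantumIso.of_psiBlock hX)

/-- A walk to the block, stopped at its first marked vertex, uses no deleted edge, so every
component has a mark. Two marks cannot be joined by a nontrivial path after the deletion: such a
path would stay in the block, and its first edge would be a deleted one. -/
theorem isRooted_psiBlock (hG : X.graph.Connected) (hB : IsBlock X.graph X.mark) :
    X.psiBlock.IsRooted := by
  have hK := (isBlock_iff hG).mp hB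
  have := hG.nonempty
  obtain ⟨q, hq⟩ := Maximal.nonempty_of_inseparable hK
  have hex : ∀ {x q : X.V} (p : X.graph.Walk x q), q ∈ X.mark →
      ∃ q' ∈ X.mark, X.psiBlock.graph.Reachable x q' := by
    intro x q p hq
    induction p with
    | nil => exact ⟨_, hq, .rfl⟩
    | @cons x y q h p ih =>
      obtain ⟨q', hq', hr⟩ := ih hq
      by_cases hx : x ∈ X.mark
      · exact ⟨x, hx, .rfl⟩
      · have ha : X.psiBlock.graph.Adj x y := psiBlock_adj_iff.mpr ⟨h, fun h' => hx h'.1⟩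
        exact ⟨q', hq', ha.reachable.trans hr⟩
  have huniq : ∀ {x y : X.V}, x ∈ X.mark → y ∈ X.mark → X.psiBlock.graph.Reachable x y →
      x = y := by
    classical
    intro x y hx hy hxy
    obtain ⟨p, hp⟩ := hxy.exists_isPath
    cases p with
    | nil => rfl
    | @cons _ z _ h p =>
      exfalso
      have hle : X.psiBlock.graph ≤ X.graph := fun a b hab => (psiBlock_adj_iff.mp hab).1
      have hp' := hp.mapLe hle
      have hz : z ∈ X.mark := mem_of_isPath hK hx hy hp' (by
        erw [SimpleGraph.Walk.support_mapLe_eq_support]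
        exact List.mem_cons_of_mem _ p.start_mem_support)
      exact (psiBlock_adj_iff.mp h).2 ⟨hx, hz⟩
  intro c
  obtain ⟨x, rfl⟩ := c.exists_rep
  obtain ⟨p⟩ := hG.preconnected x q
  obtain ⟨q', hq', hr⟩ := hex p hq
  refine ⟨⟨q', SimpleGraph.ConnectedComponent.sound hr.symm⟩, hq', ?_⟩
  rintro ⟨y, hy⟩ hym
  exact Subtype.ext (huniq hym hq' ((SimpleGraph.ConnectedComponent.exact hy).trans hr))

end block

end MarkedGraph

theorem IsMagic.fromBlocks {I J A : Type*} [Fintype I] [Fintype J] [Ring A] [StarRing A]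
    {P : Matrix I I A} {Q : Matrix J J A} (hP : IsMagic P) (hQ : IsMagic Q) :
    IsMagic (Matrix.fromBlocks P 0 0 Q) where
  idem := by rintro (i | i) (j | j) <;> simp [hP.idem, hQ.idem]
  selfadj := by rintro (i | i) (j | j) <;> simp [hP.selfadj, hQ.selfadj]
  row_orth := by
    rintro (i | i) (j | j) (k | k) h <;> simp only [Matrix.fromBlocks_apply₁₁,
      Matrix.fromBlocks_apply₁₂, Matrix.fromBlocks_apply₂₁, Matrix.fromBlocks_apply₂₂,
      Matrix.zero_apply, mul_zero, zero_mul]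
    · exact hP.row_orth _ _ _ fun h' => h (congrArg _ h')
    · exact hQ.row_orth _ _ _ fun h' => h (congrArg _ h')
  col_orth := by
    rintro (i | i) (k | k) (j | j) h <;> simp only [Matrix.fromBlocks_apply₁₁,
      Matrix.fromBlocks_apply₁₂, Matrix.fromBlocks_apply₂₁, Matrix.fromBlocks_apply₂₂,
      Matrix.zero_apply, mul_zero, zero_mul]
    · exact hP.col_orth _ _ _ fun h' => h (congrArg _ h')
    · exact hQ.col_orth _ _ _ fun h' => h (congrArg _ h')
  row_sum := by rintro (i | i) <;> simp [hP.row_sum, hQ.row_sum]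
  col_sum := by rintro (i | i) <;> simp [hP.col_sum, hQ.col_sum]

namespace MarkedGraph

open QuantumPermutationGroup

variable {X : MarkedGraph.{u}} {A : Type v} [Ring A] [StarRing A] [Algebra ℂ A]
  {U : Matrix X.V X.V A}

/-! ### The action on the set of connected components -/

theorem sum_component_eq_sum_ite {M : Type*} [AddCommMonoid M] (f : X.V → M)
    (d : X.graph.ConnectedComponent) [DecidablePred fun y => X.graph.connectedComponentMk y = d] :
    ∑ y : (X.component d).V, f y.1 =
      ∑ y, if X.graph.connectedComponentMk y = d then f y else 0 := by
  rw [← Finset.sum_filter]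
  exact (Finset.sum_subtype _ (fun y => by
    simp [SimpleGraph.ConnectedComponent.mem_supp_iff]) f).symm

/-- The matrix of the action on the set of connected components. -/
def compU (U : Matrix X.V X.V A) : Matrix X.graph.ConnectedComponent X.graph.ConnectedComponent A :=
  Matrix.of fun c d => ∑ y : (X.component d).V, U c.out y.1

section compU

variable (hU : IsQuantumIso X X U) {c d : X.graph.ConnectedComponent}

include hU

theorem IsQuantumIso.compU_eq {x : X.V} (hx : X.graph.connectedComponentMk x = c) :
    compU U c d = ∑ y : (X.component d).V, U x y.1 :=
  hU.sum_component_eq_of_reachable (SimpleGraph.ConnectedComponent.exact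
    ((Quot.out_eq c).trans hx.symm)) d

theorem IsQuantumIso.mul_compU {x y : X.V} (hx : X.graph.connectedComponentMk x = c)
    (hy : X.graph.connectedComponentMk y = d) : U x y * compU U c d = U x y := by
  rw [hU.compU_eq hx, Finset.mul_sum]
  refine (Finset.sum_eq_single (⟨y, hy⟩ : (X.component d).V) ?_ ?_).trans ?_
  rotate_right
  · exact hU.magic.idem _ _
  · exact fun z _ hz => hU.magic.row_orth _ _ _ fun h => hz (Subtype.ext h.symm)
  · exact fun h => (h (Finset.mem_univ (α := (X.component d).V) _)).elim

theorem IsQuantumIso.compU_mul_eq_zero_of_ne {x y : X.V} (hx : X.graph.connectedComponentMk x = c)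
    (hy : X.graph.connectedComponentMk y ≠ d) : compU U c d * U x y = 0 := by
  rw [hU.compU_eq hx, Finset.sum_mul]
  exact Finset.sum_eq_zero fun z _ => hU.magic.row_orth _ _ _ fun h => hy (h ▸ z.2)

theorem IsQuantumIso.star_compU : star (compU U c d) = compU U c d := by
  rw [compU, Matrix.of_apply, star_sum]
  exact Finset.sum_congr rfl fun y _ => hU.magic.selfadj _ _

/-- Let `P` be the row sum over `d` and `P'` the column sum over `c`. Then `P * P' = P` and `P' * P
= P'`, and both are self-adjoint, so taking adjoints gives `P = P'`. This makes the definition of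
`compU`, which sums along rows, symmetric in rows and columns. -/
theorem IsQuantumIso.compU_transpose : compU U.transpose d c = compU U c d := by
  have h1 : compU U c d * compU U.transpose d c = compU U c d := by
    conv_lhs => rw [compU, Matrix.of_apply, Finset.sum_mul]
    refine Finset.sum_congr rfl fun y _ => ?_
    rw [hU.transpose.compU_eq y.2, Finset.mul_sum]
    refine (Finset.sum_eq_single (⟨c.out, Quot.out_eq c⟩ : (X.component c).V) ?_ ?_).trans ?_
    rotate_right
    · exact hU.magic.idem _ _
    · exact fun z _ hz => hU.magic.col_orth _ _ _ fun h => hz (Subtype.ext h.symm)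
    · exact fun h => (h (Finset.mem_univ (α := (X.component c).V) _)).elim
  have h2 : compU U.transpose d c * compU U c d = compU U.transpose d c := by
    conv_lhs => rw [compU, Matrix.of_apply, Finset.sum_mul]
    exact Finset.sum_congr rfl fun x _ => hU.mul_compU x.2 (Quot.out_eq d)
  rw [← h2, ← hU.star_compU, ← hU.transpose.star_compU, ← star_mul, h1]

theorem IsQuantumIso.compU_eq_sum_col {y : X.V} (hy : X.graph.connectedComponentMk y = d) :
    compU U c d = ∑ x : (X.component c).V, U x.1 y := by
  rw [← hU.compU_transpose, hU.transpose.compU_eq hy]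
  rfl

theorem IsQuantumIso.compU_mul_eq_zero_of_ne' {x y : X.V}
    (hx : X.graph.connectedComponentMk x ≠ c) (hy : X.graph.connectedComponentMk y = d) :
    compU U c d * U x y = 0 := by
  rw [hU.compU_eq_sum_col hy, Finset.sum_mul]
  exact Finset.sum_eq_zero fun z _ => hU.magic.col_orth _ _ _ fun h => hx (h ▸ z.2)

theorem IsQuantumIso.isMagic_compU : IsMagic (compU U) where
  idem c d := by
    conv_lhs => rw [compU, Matrix.of_apply, Finset.sum_mul]
    exact Finset.sum_congr rfl fun y _ => hU.mul_compU (Quot.out_eq c) y.2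
  selfadj c d := hU.star_compU
  row_orth c d e h := by
    conv_lhs => rw [compU, Matrix.of_apply, Matrix.of_apply, Finset.mul_sum]
    refine Finset.sum_eq_zero fun y _ => ?_
    refine hU.compU_mul_eq_zero_of_ne (Quot.out_eq c) ?_
    rw [show X.graph.connectedComponentMk y.1 = e from y.2]
    exact h.symm
  col_orth c e d h := by
    rw [hU.compU_eq_sum_col (c := e) (Quot.out_eq d), Finset.mul_sum]
    refine Finset.sum_eq_zero fun x _ => ?_
    refine hU.compU_mul_eq_zero_of_ne' ?_ (Quot.out_eq d)
    rw [show X.graph.connectedComponentMk x.1 = e from x.2]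
    exact h.symm
  row_sum c := (sum_component fun y => U c.out y).trans (hU.magic.row_sum _)
  col_sum d := by
    simp only [hU.compU_eq_sum_col (Quot.out_eq d)]
    exact (sum_component fun x => U x d.out).trans (hU.magic.col_sum _)

end compU

/-! ### The operation `Ψ` for a cut vertex -/

section cut

variable (X) (r : X.V)

/-- The graph without the vertex `r`. -/
def delete : MarkedGraph.{u} where
  V := ({r}ᶜ : Set X.V)
  fintype := Fintype.ofFinite _
  graph := X.graph.induce {r}ᶜ
  mark := ∅

/-- Adjacency in `cutGraph`. -/
def CutAdj : (X.delete r).graph.ConnectedComponent ⊕ (X.delete r).V →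
    (X.delete r).graph.ConnectedComponent ⊕ (X.delete r).V → Prop
  | .inl _, .inl _ => False
  | .inl c, .inr z => (X.delete r).graph.connectedComponentMk z = c ∧ X.graph.Adj r z.1
  | .inr z, .inl c => (X.delete r).graph.connectedComponentMk z = c ∧ X.graph.Adj r z.1
  | .inr z, .inr w => X.graph.Adj z.1 w.1

/-- The graph obtained when the vertex `r` is replaced with one root for each connected component
of the graph without `r`. -/
def cutGraph : MarkedGraph.{u} where
  V := (X.delete r).graph.ConnectedComponent ⊕ (X.delete r).V
  graph :=
    { Adj := CutAdj X r
      symm := ⟨by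
        rintro (c | z) (d | w) h
        · exact h
        · exact h
        · exact h
        · exact SimpleGraph.Adj.symm h⟩
      loopless := ⟨by
        rintro (c | z) h
        · exact h
        · exact X.graph.loopless.irrefl z.1 h⟩ }
  mark := Set.range Sum.inl

variable {X r}

theorem delete_mk_eq {z w : (X.delete r).V} (h : X.graph.Adj z.1 w.1) :
    (X.delete r).graph.connectedComponentMk z = (X.delete r).graph.connectedComponentMk w :=
  SimpleGraph.ConnectedComponent.sound (SimpleGraph.Adj.reachable h)

theorem sum_eq_add_sum_delete {M : Type*} [AddCommMonoid M] (f : X.V → M) :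
    ∑ x, f x = f r + ∑ z : (X.delete r).V, f z.1 := by
  classical
  rw [← Finset.add_sum_erase _ f (Finset.mem_univ r)]
  exact congrArg _ (Finset.sum_subtype _ (fun x => by simp) f)

/-- The component that contains a vertex. -/
def cutComponent (p : (X.cutGraph r).V) : (X.delete r).graph.ConnectedComponent :=
  Sum.elim id (X.delete r).graph.connectedComponentMk p

theorem cutComponent_eq_of_reachable {p q : (X.cutGraph r).V}
    (h : (X.cutGraph r).graph.Reachable p q) : cutComponent p = cutComponent q := by
  obtain ⟨w⟩ := h
  induction w with
  | nil => rfl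
  | @cons p q _ h _ ih =>
    refine Eq.trans ?_ ih
    rcases p with c | z <;> rcases q with d | w
    · exact h.elim
    · exact h.1.symm
    · exact h.1
    · exact delete_mk_eq h

/-- A walk of `X` from `z` to `r` remains in the component of `z` until it first meets `r`. Its last
step before that becomes an edge to the root of this component. -/
theorem cutGraph_reachable (hG : X.graph.Connected) (z : (X.delete r).V) :
    (X.cutGraph r).graph.Reachable (Sum.inr z)
      (Sum.inl ((X.delete r).graph.connectedComponentMk z)) := by
  have key : ∀ {x y : X.V} (_ : X.graph.Walk x y) (hx : x ∈ ({r}ᶜ : Set X.V)), y = r →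
      (X.cutGraph r).graph.Reachable (Sum.inr ⟨x, hx⟩)
        (Sum.inl ((X.delete r).graph.connectedComponentMk ⟨x, hx⟩)) := by
    intro x y p
    induction p with
    | nil => exact fun hx hy => absurd hy hx
    | @cons x w _ h p ih =>
      intro hx hy
      by_cases hw : w = r
      · subst hw
        have : (X.cutGraph w).graph.Adj (Sum.inr ⟨x, hx⟩)
          (Sum.inl ((X.delete w).graph.connectedComponentMk ⟨x, hx⟩)) := ⟨rfl, h.symm⟩
        exact this.reachable
      · have : (X.cutGraph r).graph.Adj (Sum.inr ⟨x, hx⟩) (Sum.inr ⟨w, hw⟩) := h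
        refine this.reachable.trans ?_
        rw [delete_mk_eq (z := ⟨x, hx⟩) (w := ⟨w, hw⟩) h]
        exact ih hw hy
  obtain ⟨p⟩ := hG.preconnected z.1 r
  exact key p z.2 rfl

theorem cutGraph_reachable_inl (hG : X.graph.Connected) (p : (X.cutGraph r).V) :
    (X.cutGraph r).graph.Reachable p (Sum.inl (cutComponent p)) := by
  rcases p with c | z
  · exact .rfl
  · exact cutGraph_reachable hG z

theorem isRooted_of (hex : ∀ x, ∃ y ∈ X.mark, X.graph.Reachable x y)
    (huniq : ∀ x ∈ X.mark, ∀ y ∈ X.mark, X.graph.Reachable x y → x = y) : X.IsRooted := by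
  intro c
  obtain ⟨x, rfl⟩ := c.exists_rep
  obtain ⟨y, hy, hr⟩ := hex x
  refine ⟨⟨y, SimpleGraph.ConnectedComponent.sound hr.symm⟩, hy, ?_⟩
  rintro ⟨z, hz⟩ hzm
  exact Subtype.ext (huniq z hzm y hy ((SimpleGraph.ConnectedComponent.exact hz).trans hr))

variable (hr : X.mark = {r}) (hU : IsQuantumIso X X U)

include hr hU

theorem IsQuantumIso.apply_root_left (z : (X.delete r).V) : U r z.1 = 0 :=
  hU.mark _ _ (by rw [hr]; exact fun h => z.2 (h.mp rfl))

theorem IsQuantumIso.apply_root_right (z : (X.delete r).V) : U z.1 r = 0 :=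
  hU.mark _ _ (by rw [hr]; exact fun h => z.2 (h.mpr rfl))

theorem IsQuantumIso.apply_root_root : U r r = 1 := by
  rw [← hU.magic.row_sum r, sum_eq_add_sum_delete (r := r)]
  simp [hU.apply_root_left hr]

theorem IsQuantumIso.delete :
    IsQuantumIso (X.delete r) (X.delete r) (Matrix.of fun z w => U z.1 w.1) := by
  have hm : IsMagic (Matrix.of fun z w : (X.delete r).V => U z.1 w.1) :=
    { idem := fun _ _ => hU.magic.idem _ _
      selfadj := fun _ _ => hU.magic.selfadj _ _
      row_orth := fun _ _ _ h => hU.magic.row_orth _ _ _ fun h' => h (Subtype.ext h')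
      col_orth := fun _ _ _ h => hU.magic.col_orth _ _ _ fun h' => h (Subtype.ext h')
      row_sum := fun z => by
        have := hU.magic.row_sum z.1
        rwa [sum_eq_add_sum_delete (r := r), hU.apply_root_right hr, zero_add] at this
      col_sum := fun z => by
        have := hU.magic.col_sum z.1
        rwa [sum_eq_add_sum_delete (r := r), hU.apply_root_left hr, zero_add] at this }
  exact ⟨hm, intertwines_of_mul_eq_zero hm fun a b x y h => hU.mul_eq_zero h,
    fun a x h => absurd Iff.rfl h⟩

omit hr hU in
variable (r) (U) in
/-- The matrix on the vertices of `cutGraph` that is defined by a matrix on the vertices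
of `X`. -/
def cutU : Matrix (X.cutGraph r).V (X.cutGraph r).V A :=
  Matrix.fromBlocks (compU (X := X.delete r) (Matrix.of fun z w => U z.1 w.1)) 0 0
    (Matrix.of fun z w => U z.1 w.1)

theorem IsQuantumIso.cutU : IsQuantumIso (X.cutGraph r) (X.cutGraph r) (cutU U r) := by
  have hW := hU.delete hr
  have hm : IsMagic (MarkedGraph.cutU U r) := hW.isMagic_compU.fromBlocks hW.magic
  -- If `z ∈ c` and `w ∈ d`, adjacency to the roots is adjacency to `r`, which is respected because
  -- `u r r = 1`. If exactly one of the memberships holds, the projection for `(c, d)` is orthogonal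
  -- to `u z w`; if neither holds, there is no edge on either side.
  have key : ∀ (c d : (X.delete r).graph.ConnectedComponent) (z w : (X.delete r).V),
      ¬ (((X.delete r).graph.connectedComponentMk z = c ∧ X.graph.Adj r z.1) ↔
        ((X.delete r).graph.connectedComponentMk w = d ∧ X.graph.Adj r w.1)) →
      compU (X := X.delete r) (Matrix.of fun z w => U z.1 w.1) c d * U z.1 w.1 = 0 := by
    intro c d z w h
    by_cases hz : (X.delete r).graph.connectedComponentMk z = c
    · by_cases hw : (X.delete r).graph.connectedComponentMk w = d
      · have := hU.mul_eq_zero (a := r) (b := z.1) (x := r) (y := w.1) (by simpa [hz, hw] using h)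
        rw [hU.apply_root_root hr, one_mul] at this
        rw [this, mul_zero]
      · exact hW.compU_mul_eq_zero_of_ne hz hw
    · by_cases hw : (X.delete r).graph.connectedComponentMk w = d
      · exact hW.compU_mul_eq_zero_of_ne' hz hw
      · simp [hz, hw] at h
  refine ⟨hm, intertwines_of_mul_eq_zero hm ?_, ?_⟩
  · rintro (a | a) (b | b) (x | x) (y | y) h <;>
      simp only [MarkedGraph.cutU, Matrix.fromBlocks_apply₁₁,
      Matrix.fromBlocks_apply₁₂, Matrix.fromBlocks_apply₂₁, Matrix.fromBlocks_apply₂₂,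
      Matrix.zero_apply, mul_zero, zero_mul]
    · exact absurd Iff.rfl h
    · exact key a x b y h
    -- The opposite order of the two factors is obtained by taking adjoints.
    · have := congrArg star (key b y a x h)
      rwa [star_mul, hW.star_compU, hU.magic.selfadj, star_zero] at this
    · exact hU.mul_eq_zero h
  · rintro (a | a) (x | x) h
    · exact absurd (iff_of_true ⟨a, rfl⟩ ⟨x, rfl⟩) h
    · rfl
    · rfl
    · refine absurd (iff_of_false ?_ ?_) h <;> rintro ⟨c, hc⟩ <;> simp at hc

end cut

section cut

variable {X : MarkedGraph.{u}} {A : Type v} [Ring A] [StarRing A] [Algebra ℂ A]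
  {r : X.V}

theorem isRooted_cutGraph (hG : X.graph.Connected) : (X.cutGraph r).IsRooted := by
  refine isRooted_of (fun p => ⟨_, ⟨_, rfl⟩, cutGraph_reachable_inl hG p⟩) ?_
  rintro _ ⟨c, rfl⟩ _ ⟨d, rfl⟩ h
  exact congrArg Sum.inl (cutComponent_eq_of_reachable h)

variable (X r) in
/-- The vertices of `X` are `r` and the vertices of `X.delete r`. -/
def deleteEquiv : Unit ⊕ (X.delete r).V ≃ X.V :=
  Equiv.ofBijective (Sum.elim (fun _ => r) fun z => z.1) (by
    constructor
    · rintro (⟨⟩ | z) (⟨⟩ | w) h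
      · rfl
      · exact absurd h.symm w.2
      · exact absurd h z.2
      · exact congrArg Sum.inr (Subtype.ext h)
    · intro x
      by_cases hx : x = r
      · exact ⟨Sum.inl (), hx.symm⟩
      · exact ⟨Sum.inr ⟨x, hx⟩, rfl⟩)

variable {N : Matrix (X.cutGraph r).V (X.cutGraph r).V A}

variable (N) in
/-- The matrix on the vertices of `X` that is defined by a matrix on the vertices of
`cutGraph`. -/
def glueU : Matrix X.V X.V A :=
  (Matrix.fromBlocks (1 : Matrix Unit Unit A) 0 0
    (Matrix.of fun z w => N (Sum.inr z) (Sum.inr w))).submatrix (deleteEquiv X r).symm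
      (deleteEquiv X r).symm

theorem glueU_apply (p q : Unit ⊕ (X.delete r).V) :
    glueU N (deleteEquiv X r p) (deleteEquiv X r q) =
      Matrix.fromBlocks (1 : Matrix Unit Unit A) 0 0
        (Matrix.of fun z w => N (Sum.inr z) (Sum.inr w)) p q := by
  rw [glueU, Matrix.submatrix_apply, Equiv.symm_apply_apply, Equiv.symm_apply_apply]

theorem glueU_root_root : glueU N r r = 1 := glueU_apply (Sum.inl ()) (Sum.inl ())

theorem glueU_root_left (z : (X.delete r).V) : glueU N r z.1 = 0 :=
  glueU_apply (Sum.inl ()) (Sum.inr z)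

theorem glueU_root_right (z : (X.delete r).V) : glueU N z.1 r = 0 :=
  glueU_apply (Sum.inr z) (Sum.inl ())

theorem glueU_delete (z w : (X.delete r).V) : glueU N z.1 w.1 = N (Sum.inr z) (Sum.inr w) :=
  glueU_apply (Sum.inr z) (Sum.inr w)

variable (r) in
theorem delete_cases {p : X.V → Prop} (x : X.V) (root : p r)
    (delete : ∀ z : (X.delete r).V, p z.1) : p x := by
  by_cases hx : x = r
  · exact hx ▸ root
  · exact delete ⟨x, hx⟩

variable (hN : IsQuantumIso (X.cutGraph r) (X.cutGraph r) N)

include hN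

theorem IsQuantumIso.cutGraph_inl_inr (c : (X.delete r).graph.ConnectedComponent)
    (z : (X.delete r).V) : N (Sum.inl c) (Sum.inr z) = 0 :=
  hN.mark _ _ fun h => by
    obtain ⟨d, hd⟩ := h.mp ⟨c, rfl⟩
    simp at hd

theorem IsQuantumIso.cutGraph_inr_inl (c : (X.delete r).graph.ConnectedComponent)
    (z : (X.delete r).V) : N (Sum.inr z) (Sum.inl c) = 0 :=
  hN.mark _ _ fun h => by
    obtain ⟨d, hd⟩ := h.mpr ⟨c, rfl⟩
    simp at hd

theorem IsQuantumIso.isMagic_glueU : IsMagic (glueU N) := by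
  refine IsMagic.submatrix (IsMagic.fromBlocks ?_ ?_) _ _
  · exact
      { idem := fun _ _ => by simp
        selfadj := fun _ _ => by simp
        row_orth := fun _ _ _ h => absurd rfl h
        col_orth := fun _ _ _ h => absurd rfl h
        row_sum := fun _ => by simp
        col_sum := fun _ => by simp }
  · exact
      { idem := fun _ _ => hN.magic.idem _ _
        selfadj := fun _ _ => hN.magic.selfadj _ _
        row_orth := fun _ _ _ h => hN.magic.row_orth _ _ _ fun h' => h (Sum.inr_injective h')
        col_orth := fun _ _ _ h => hN.magic.col_orth _ _ _ fun h' => h (Sum.inr_injective h')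
        row_sum := fun z => by
          have := (Fintype.sum_sum_type _).symm.trans (hN.magic.row_sum (Sum.inr z))
          rwa [Finset.sum_eq_zero fun c _ => hN.cutGraph_inr_inl c z, zero_add] at this
        col_sum := fun z => by
          have := (Fintype.sum_sum_type _).symm.trans (hN.magic.col_sum (Sum.inr z))
          rwa [Finset.sum_eq_zero fun c _ => hN.cutGraph_inl_inr c z, zero_add] at this }

/-- Suppose that `z` is adjacent to `r`, hence to the root of its component. Inserting the row of
that root before the coefficient `(z, w)`, a surviving product requires a root adjacent to `w`, so
`w` is adjacent to `r` as well. The transpose covers the other case. -/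
theorem IsQuantumIso.cutGraph_eq_zero {z w : (X.delete r).V}
    (h : ¬ (X.graph.Adj r z.1 ↔ X.graph.Adj r w.1)) : N (Sum.inr z) (Sum.inr w) = 0 := by
  have key : ∀ {N : Matrix (X.cutGraph r).V (X.cutGraph r).V A},
      IsQuantumIso (X.cutGraph r) (X.cutGraph r) N → ∀ {z w : (X.delete r).V},
      X.graph.Adj r z.1 → ¬ X.graph.Adj r w.1 → N (Sum.inr z) (Sum.inr w) = 0 := by
    intro N hN z w hz hw
    have h1 := hN.magic.row_sum (Sum.inl ((X.delete r).graph.connectedComponentMk z))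
    refine (one_mul _).symm.trans ?_
    rw [← h1, Finset.sum_mul]
    refine Finset.sum_eq_zero fun p _ => ?_
    rcases p with d | y
    · refine hN.mul_eq_zero fun h => ?_
      have hz' : (X.cutGraph r).graph.Adj
        (Sum.inl ((X.delete r).graph.connectedComponentMk z)) (Sum.inr z) := ⟨rfl, hz⟩
      exact hw (h.mp hz').2
    · rw [hN.cutGraph_inl_inr, zero_mul]
  by_cases hz : X.graph.Adj r z.1
  · exact key hN hz fun hw => h (iff_of_true hz hw)
  · by_cases hw : X.graph.Adj r w.1
    · exact key hN.transpose hw hz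
    · exact absurd (iff_of_false hz hw) h

theorem IsQuantumIso.glueU (hr : X.mark = {r}) : IsQuantumIso X X (MarkedGraph.glueU N) := by
  have hm := hN.isMagic_glueU
  refine ⟨hm, intertwines_of_mul_eq_zero hm fun a b x y h => ?_, fun a x h => ?_⟩
  · induction a using delete_cases r <;> induction x using delete_cases r
    · rw [glueU_root_root, one_mul]
      induction b using delete_cases r <;> induction y using delete_cases r
      · exact absurd Iff.rfl h
      · exact glueU_root_left _
      · exact glueU_root_right _
      · rw [glueU_delete]
        exact hN.cutGraph_eq_zero h
    · rw [glueU_root_left, zero_mul]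
    · rw [glueU_root_right, zero_mul]
    · induction b using delete_cases r <;> induction y using delete_cases r
      · rw [glueU_delete, hN.cutGraph_eq_zero, zero_mul]
        rwa [X.graph.adj_comm, X.graph.adj_comm _ r] at h
      · rw [glueU_root_left, mul_zero]
      · rw [glueU_root_right, mul_zero]
      · rw [glueU_delete, glueU_delete]
        exact hN.mul_eq_zero h
  · rw [hr] at h
    induction a using delete_cases r <;> induction x using delete_cases r
    · exact absurd Iff.rfl h
    · exact glueU_root_left _
    · exact glueU_root_right _
    · rename_i a x
      exact absurd (iff_of_false a.2 x.2) h

/-- The vertex `c.out` and the root of `c` are in one component of the cut graph, so their rows have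
equal sums over each component. Marks reduce these sums to the ordinary vertices and to the root,
respectively. Hence the coefficients at roots are determined by the others, which makes `cutHom`
injective. -/
theorem IsQuantumIso.compU_cutGraph (hG : X.graph.Connected)
    (c d : (X.delete r).graph.ConnectedComponent) :
    compU (X := X.delete r) (Matrix.of fun z w => N (Sum.inr z) (Sum.inr w)) c d =
      N (Sum.inl c) (Sum.inl d) := by
  classical
  have hrc : (X.cutGraph r).graph.Reachable (Sum.inr c.out) (Sum.inl c) := by
    have := cutGraph_reachable hG (r := r) c.out
    rwa [show (X.delete r).graph.connectedComponentMk c.out = c from Quot.out_eq c] at this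
  have hmk : ∀ p : (X.cutGraph r).V, (X.cutGraph r).graph.connectedComponentMk p =
      (X.cutGraph r).graph.connectedComponentMk (Sum.inl d) ↔ cutComponent p = d := fun p =>
    ⟨fun h => cutComponent_eq_of_reachable (SimpleGraph.ConnectedComponent.exact h), fun h =>
      SimpleGraph.ConnectedComponent.sound (h ▸ cutGraph_reachable_inl hG p)⟩
  have h := hN.sum_component_eq_of_reachable hrc
    ((X.cutGraph r).graph.connectedComponentMk (Sum.inl d))
  rw [sum_component_eq_sum_ite (fun y => N (Sum.inr c.out) y),
    sum_component_eq_sum_ite (fun y => N (Sum.inl c) y)] at h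
  simp only [hmk] at h
  have h := (Fintype.sum_sum_type _).symm.trans (h.trans (Fintype.sum_sum_type _))
  simp only [hN.cutGraph_inr_inl, hN.cutGraph_inl_inr, ite_self, Finset.sum_const_zero, zero_add,
    add_zero] at h
  refine Eq.trans ?_ (h.trans ?_)
  · exact sum_component_eq_sum_ite (X := X.delete r) (fun w => N (Sum.inr c.out) (Sum.inr w)) d
  · refine (Finset.sum_eq_single d ?_ ?_).trans (if_pos rfl)
    · exact fun e _ he => if_neg he
    · exact fun h => (h (Finset.mem_univ _)).elim

end cut

variable {X : MarkedGraph.{u}} {r : X.V}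

/-! ### The quantum groups of a graph and of its cut graph -/

section hom

variable (hr : X.mark = {r})

/-- The `*`-morphism that underlies `cutHom`. -/
def cutStarHom : (Qu (X.cutGraph r)).A →⋆ₐ[ℂ] (Qu X).A :=
  quLift (cutU X.quU r) (X.quU_isQuantumIso.cutU hr)

theorem cutStarHom_quU (p q : (X.cutGraph r).V) :
    cutStarHom hr ((X.cutGraph r).quU p q) = cutU X.quU r p q :=
  quLift_quU (cutU X.quU r) (X.quU_isQuantumIso.cutU hr) p q

include hr in
theorem comul_quU_delete (z w : (X.delete r).V) : (Qu X).comul (X.quU z.1 w.1) =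
    ∑ y : (X.delete r).V, X.quU z.1 y.1 ⊗ₜ[ℂ] X.quU y.1 w.1 := by
  refine ((Qu X).comul_U z.1 w.1).trans ?_
  refine (sum_eq_add_sum_delete (r := r) fun y => X.quU z.1 y ⊗ₜ[ℂ] X.quU y w.1).trans ?_
  rw [X.quU_isQuantumIso.apply_root_right hr, TensorProduct.zero_tmul, zero_add]

include hr in
theorem comul_cutU (p q : (X.cutGraph r).V) :
    (Qu X).comul (cutU X.quU r p q) = ∑ k, cutU X.quU r p k ⊗ₜ[ℂ] cutU X.quU r k q := by
  have hU := X.quU_isQuantumIso.delete hr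
  refine Eq.trans ?_ (Fintype.sum_sum_type fun k => cutU X.quU r p k ⊗ₜ[ℂ] cutU X.quU r k q).symm
  rcases p with c | z <;> rcases q with d | w <;>
    simp only [cutU, Matrix.fromBlocks_apply₁₁,
      Matrix.fromBlocks_apply₁₂, Matrix.fromBlocks_apply₂₁, Matrix.fromBlocks_apply₂₂,
      Matrix.zero_apply, TensorProduct.zero_tmul, TensorProduct.tmul_zero, Finset.sum_const_zero,
      add_zero, zero_add]
  · have h : ∀ y : (X.delete r).V, (∑ w : ((X.delete r).component d).V, X.quU y.1 w.1.1) =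
        compU (X := X.delete r) (Matrix.of fun z w => X.quU z.1 w.1)
          ((X.delete r).graph.connectedComponentMk y) d := fun y => (hU.compU_eq rfl).symm
    have h1 : (Qu X).comul (compU (X := X.delete r) (Matrix.of fun z w => X.quU z.1 w.1) c d) =
        ∑ w : ((X.delete r).component d).V, ∑ y : (X.delete r).V,
          X.quU c.out.1 y.1 ⊗ₜ[ℂ] X.quU y.1 w.1.1 :=
      (map_sum (Qu X).comul (fun w : ((X.delete r).component d).V => X.quU c.out.1 w.1.1) _).trans
        (Finset.sum_congr rfl fun w _ => comul_quU_delete hr c.out w.1)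
    refine h1.trans (Finset.sum_comm.trans ?_)
    -- The inner sum over the component `d` depends on `y` only through its component. Grouping the
    -- vertices `y` by components then yields the comultiplication rule for `compU`.
    refine (Finset.sum_congr rfl fun y _ =>
      (TensorProduct.tmul_sum _ _ _).symm.trans (congrArg _ (h y))).trans ?_
    refine (sum_component (X := X.delete r) fun y => X.quU c.out.1 y.1 ⊗ₜ[ℂ]
      compU (X := X.delete r) (Matrix.of fun z w => X.quU z.1 w.1)
        ((X.delete r).graph.connectedComponentMk y) d).symm.trans ?_
    refine Finset.sum_congr rfl fun e _ => ?_
    rw [compU, Matrix.of_apply, TensorProduct.sum_tmul]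
    refine Finset.sum_congr rfl fun y _ => ?_
    rw [show (X.delete r).graph.connectedComponentMk y.1 = e from y.2]
    rfl
  · exact map_zero _
  · exact map_zero _
  · exact comul_quU_delete hr z w

/-- The morphism from the quantum automorphism group of `cutGraph`. -/
def cutHom : Hom (Qu (X.cutGraph r)) (Qu X) :=
  Hom.ofGenerators (P := Qu (X.cutGraph r)) (Q := Qu X) (cutStarHom hr) fun i j =>
    (congrArg (Qu X).comul (cutStarHom_quU hr i j)).trans ((comul_cutU hr i j).trans
      (Finset.sum_congr rfl fun k _ =>
        (congrArg₂ _ (cutStarHom_quU hr i k) (cutStarHom_quU hr k j)).symm))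

variable (r) in
/-- The inverse of `cutHom`. -/
def glueStarHom : (Qu X).A →⋆ₐ[ℂ] (Qu (X.cutGraph r)).A :=
  quLift (glueU (X.cutGraph r).quU) ((X.cutGraph r).quU_isQuantumIso.glueU hr)

theorem glueStarHom_quU (x y : X.V) :
    glueStarHom r hr (X.quU x y) = glueU (X.cutGraph r).quU x y :=
  quLift_quU (glueU (X.cutGraph r).quU) ((X.cutGraph r).quU_isQuantumIso.glueU hr) x y

theorem cutHom_bijective (hG : X.graph.Connected) : Function.Bijective (cutHom hr) := by
  have hN := (X.cutGraph r).quU_isQuantumIso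
  have hU := X.quU_isQuantumIso
  have h0 : glueStarHom r hr 0 = 0 := map_zero _
  have h1 : (glueStarHom r hr).comp (cutStarHom hr) = StarAlgHom.id ℂ (Qu (X.cutGraph r)).A := by
    refine hom_ext fun p q => ?_
    refine (congrArg (glueStarHom r hr) (cutStarHom_quU hr p q)).trans ?_
    change _ = (X.cutGraph r).quU p q
    rcases p with c | z <;> rcases q with d | w
    · rw [← hN.compU_cutGraph hG]
      refine (map_sum (glueStarHom r hr)
        (fun w : ((X.delete r).component d).V => X.quU c.out.1 w.1.1) _).trans ?_
      refine Finset.sum_congr rfl fun w _ => ?_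
      exact (glueStarHom_quU hr c.out.1 w.1.1).trans
        (glueU_delete (N := (X.cutGraph r).quU) c.out w.1)
    · have h := hN.cutGraph_inl_inr c w
      exact h0.trans h.symm
    · have h := hN.cutGraph_inr_inl d z
      exact h0.trans h.symm
    · exact (glueStarHom_quU hr z.1 w.1).trans (glueU_delete (N := (X.cutGraph r).quU) z w)
  have h2 : (cutStarHom hr).comp (glueStarHom r hr) = StarAlgHom.id ℂ (Qu X).A := by
    refine hom_ext fun (x y : X.V) => ?_
    refine (congrArg (cutStarHom hr) (glueStarHom_quU hr x y)).trans ?_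
    change _ = X.quU x y
    induction x using delete_cases r <;> induction y using delete_cases r
    · rw [glueU_root_root, hU.apply_root_root hr]
      exact map_one _
    · rw [glueU_root_left, hU.apply_root_left hr]
      exact map_zero _
    · rw [glueU_root_right, hU.apply_root_right hr]
      exact map_zero _
    · rw [glueU_delete]
      exact cutStarHom_quU hr _ _
  exact Function.bijective_iff_has_inverse.mpr ⟨glueStarHom r hr,
    fun a => DFunLike.congr_fun h1 a, fun a => DFunLike.congr_fun h2 a⟩

end hom

/-! ### Comparison of `cutGraph` with `psiCut` -/

theorem psiCut_adj_iff {V : Type u} [Fintype V] {G : SimpleGraph V} {r : V}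
    {p q : (psiCut G r).V} : (psiCut G r).graph.Adj p q ↔ p.1 = q.1 ∧ G.Adj p.2.1 q.2.1 := by
  obtain ⟨c, x⟩ := p
  obtain ⟨d, y⟩ := q
  by_cases h : c = d
  · subst h
    refine sum_adj_same.trans ?_
    exact ⟨fun h => ⟨rfl, h⟩, fun h => h.2⟩
  · exact iff_of_false (sum_adj_ne h) fun h' => h h'.1

variable (X r) in
/-- The vertices of `cutGraph` as vertices of `psiCut`. -/
def toPsiCut (p : (X.cutGraph r).V) : (psiCut X.graph r).V :=
  ⟨cutComponent p, match p with
    | .inl _ => ⟨r, Or.inr rfl⟩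
    | .inr z => ⟨z.1, Or.inl ⟨z, rfl, rfl⟩⟩⟩

theorem toPsiCut_bijective : Function.Bijective (toPsiCut X r) := by
  constructor
  · intro p q h
    have h1 : cutComponent p = cutComponent q := congrArg Sigma.fst h
    have h2 : (toPsiCut X r p).2.1 = (toPsiCut X r q).2.1 := by rw [h]
    rcases p with c | z <;> rcases q with d | w
    · exact congrArg Sum.inl h1
    · exact absurd h2.symm w.2
    · exact absurd h2 z.2
    · exact congrArg Sum.inr (Subtype.ext h2)
  · rintro ⟨c, ⟨x, ⟨z, hz, rfl⟩ | rfl⟩⟩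
    · obtain rfl := hz
      exact ⟨Sum.inr z, rfl⟩
    · exact ⟨Sum.inl c, rfl⟩

theorem isomorphic_psiCut : Isomorphic (X.cutGraph r) (psiCut X.graph r) := by
  refine ⟨⟨Equiv.ofBijective _ toPsiCut_bijective, fun {p q} => ?_⟩, fun p => ?_⟩
  · refine psiCut_adj_iff.trans ?_
    rcases p with c | z <;> rcases q with d | w
    · exact iff_of_false (fun h => X.graph.loopless.irrefl r h.2) id
    · exact ⟨fun h => ⟨h.1.symm, h.2⟩, fun h => ⟨h.1.symm, h.2⟩⟩
    · exact ⟨fun h => ⟨h.1, h.2.symm⟩, fun h => ⟨h.1, h.2.symm⟩⟩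
    · exact ⟨fun h => h.2, fun h => ⟨delete_mk_eq h, h⟩⟩
  · rcases p with c | z
    · exact iff_of_true rfl ⟨c, rfl⟩
    · refine iff_of_false z.2 ?_
      rintro ⟨c, hc⟩
      simp at hc

/-! ### Isomorphic marked graphs -/

section isomorphic

variable {X Y : MarkedGraph.{u}}

theorem Isomorphic.symm (h : Isomorphic X Y) : Isomorphic Y X := by
  obtain ⟨f, hf⟩ := h
  exact ⟨f.symm, fun y => by rw [← hf, f.apply_symm_apply]⟩

theorem Isomorphic.trans {Z : MarkedGraph.{u}} (h : Isomorphic X Y) (h' : Isomorphic Y Z) :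
    Isomorphic X Z := by
  obtain ⟨f, hf⟩ := h
  obtain ⟨g, hg⟩ := h'
  exact ⟨f.trans g, fun x => (hg (f x)).trans (hf x)⟩

theorem IsRooted.of_isomorphic (hX : X.IsRooted) (h : Isomorphic X Y) : Y.IsRooted := by
  obtain ⟨f, hf⟩ := h
  refine isRooted_of (fun y => ?_) fun y hy z hz hyz => ?_
  · refine ⟨f (hX.root (X.graph.connectedComponentMk (f.symm y))).1,
      (hf _).mpr (hX.root_mem _), ?_⟩
    have h := SimpleGraph.ConnectedComponent.reachable_of_mem_supp
      (X.graph.connectedComponentMk (f.symm y)) rfl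
      (hX.root (X.graph.connectedComponentMk (f.symm y))).2
    simpa using h.map f.toHom
  · obtain ⟨y, rfl⟩ := f.surjective y
    obtain ⟨z, rfl⟩ := f.surjective z
    have h : X.graph.connectedComponentMk y = X.graph.connectedComponentMk z :=
      SimpleGraph.ConnectedComponent.sound (f.reachable_iff.mp hyz)
    have h1 := hX.eq_root (c := X.graph.connectedComponentMk z) ⟨y, h⟩ ((hf y).mp hy)
    have h2 := hX.eq_root (c := X.graph.connectedComponentMk z) ⟨z, rfl⟩ ((hf z).mp hz)
    exact congrArg f (congrArg Subtype.val (h1.trans h2.symm))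

variable {A : Type v} [Ring A] [StarRing A] [Algebra ℂ A]

theorem IsQuantumIso.submatrix {U : Matrix X.V X.V A} (hU : IsQuantumIso X X U)
    (f : Y.graph ≃g X.graph) (hf : ∀ y, f y ∈ X.mark ↔ y ∈ Y.mark) :
    IsQuantumIso Y Y (U.submatrix f f) := by
  have hm := hU.magic.submatrix f.toEquiv f.toEquiv
  refine ⟨hm, intertwines_of_mul_eq_zero hm fun a b x y h => hU.mul_eq_zero ?_,
    fun a x h => hU.mark _ _ ?_⟩
  · exact fun h' => h (f.map_adj_iff.symm.trans (h'.trans f.map_adj_iff))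
  · rwa [hf, hf]

/-- Isomorphic marked graphs have the same quantum automorphism group. -/
def isoMatching (f : X.graph ≃g Y.graph) (hf : ∀ x, f x ∈ Y.mark ↔ x ∈ X.mark) :
    Matching (Qu X) (Qu Y) :=
  relabelMatching f.toEquiv (Y.quU_isQuantumIso.submatrix f hf)
    (X.quU_isQuantumIso.submatrix f.symm fun y => by rw [← hf, f.apply_symm_apply])

end isomorphic

/-! ### Free wreath products -/

section copies

variable {C : MarkedGraph.{u}} {J : Type u} [Fintype J]

variable (C J) in
/-- The disjoint union of copies of `C`, indexed by `J`. -/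
def copies : MarkedGraph.{u} where
  V := C.V × J
  graph :=
    { Adj := fun p q => p.2 = q.2 ∧ C.graph.Adj p.1 q.1
      symm := ⟨fun _ _ h => ⟨h.1.symm, h.2.symm⟩⟩
      loopless := ⟨fun p h => C.graph.loopless.irrefl p.1 h.2⟩ }
  mark := {p | p.1 ∈ C.mark}

theorem copies_reachable (hC : C.graph.Connected) (x y : C.V) (j : J) :
    (copies C J).graph.Reachable (x, j) (y, j) := by
  obtain ⟨p⟩ := hC.preconnected x y
  induction p with
  | nil => exact .rfl
  | @cons x z _ h p ih =>
    have : (copies C J).graph.Adj (x, j) (z, j) := ⟨rfl, h⟩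
    exact this.reachable.trans ih

theorem snd_eq_of_copies_reachable {p q : (copies C J).V}
    (h : (copies C J).graph.Reachable p q) : p.2 = q.2 := by
  obtain ⟨w⟩ := h
  induction w with
  | nil => rfl
  | cons h _ ih => exact h.1.trans ih

variable {A : Type v} [Ring A] [StarRing A] [Algebra ℂ A]
  {N : Matrix (copies C J).V (copies C J).V A}
  (hN : IsQuantumIso (copies C J) (copies C J) N)
  (hC : C.graph.Connected) {ρ : C.V} (hρ : C.mark = {ρ})

include hN

theorem IsQuantumIso.sum_copies_eq (hC : C.graph.Connected) (x x' : C.V) (i j : J) :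
    ∑ y, N (x, i) (y, j) = ∑ y, N (x', i) (y, j) := by
  classical
  have hne : Nonempty C.V := ⟨x⟩
  obtain ⟨z⟩ := hne
  have hmk : ∀ p : (copies C J).V, (copies C J).graph.connectedComponentMk p =
      (copies C J).graph.connectedComponentMk (z, j) ↔ p.2 = j := fun p =>
    ⟨fun h => snd_eq_of_copies_reachable (SimpleGraph.ConnectedComponent.exact h), fun h =>
      SimpleGraph.ConnectedComponent.sound (h ▸ copies_reachable hC p.1 z p.2)⟩
  have hsum : ∀ p : (copies C J).V, ∑ q : ((copies C J).component
      ((copies C J).graph.connectedComponentMk (z, j))).V, N p q.1 = ∑ y, N p (y, j) := by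
    intro p
    rw [sum_component_eq_sum_ite (fun q => N p q)]
    simp only [hmk]
    refine (Fintype.sum_prod_type _).trans (Finset.sum_congr rfl fun y _ => ?_)
    exact (Finset.sum_eq_single j (fun k _ hk => if_neg hk)
      fun h => (h (Finset.mem_univ j)).elim).trans (if_pos rfl)
  have := hN.sum_component_eq_of_reachable (copies_reachable hC x x' i)
    ((copies C J).graph.connectedComponentMk (z, j))
  exact (hsum _).symm.trans (this.trans (hsum _))

include hC hρ

theorem IsQuantumIso.sum_copies_row (x : C.V) (i j : J) :
    ∑ y, N (x, i) (y, j) = N (ρ, i) (ρ, j) := by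
  rw [hN.sum_copies_eq hC x ρ]
  refine Finset.sum_eq_single ρ (fun y _ hy => hN.mark _ _ fun h => hy ?_)
    fun h => (h (Finset.mem_univ ρ)).elim
  have h1 : y ∈ C.mark := h.mp (show ρ ∈ C.mark by rw [hρ]; rfl)
  rwa [hρ] at h1

theorem IsQuantumIso.sum_copies_col (y : C.V) (i j : J) :
    ∑ x, N (x, i) (y, j) = N (ρ, i) (ρ, j) :=
  hN.transpose.sum_copies_row hC hρ y j i

theorem IsQuantumIso.root_mul_copies (x y : C.V) (i j : J) :
    N (ρ, i) (ρ, j) * N (x, i) (y, j) = N (x, i) (y, j) := by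
  rw [← hN.sum_copies_row hC hρ x i j, Finset.sum_mul]
  refine (Finset.sum_eq_single y (fun z _ hz => ?_)
    fun h => (h (Finset.mem_univ y)).elim).trans (hN.magic.idem _ _)
  exact hN.magic.row_orth _ _ _ fun h => hz (congrArg Prod.fst h)

theorem IsQuantumIso.copies_mul_root (x y : C.V) (i j : J) :
    N (x, i) (y, j) * N (ρ, i) (ρ, j) = N (x, i) (y, j) := by
  rw [← hN.sum_copies_row hC hρ x i j, Finset.mul_sum]
  refine (Finset.sum_eq_single y (fun z _ hz => ?_)
    fun h => (h (Finset.mem_univ y)).elim).trans (hN.magic.idem _ _)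
  exact hN.magic.row_orth _ _ _ fun h => hz (congrArg Prod.fst h).symm

omit hC hρ in
theorem IsQuantumIso.copies_root_orth {i j k : J} (h : j ≠ k) :
    N (ρ, i) (ρ, j) * N (ρ, i) (ρ, k) = 0 :=
  hN.magic.row_orth _ _ _ fun h' => h (congrArg Prod.snd h')

/-- Each coefficient absorbs the root coefficient of its pair of copies, and the root coefficients
for different target copies are orthogonal. -/
theorem IsQuantumIso.copies_mul_copies {x y z w : C.V} {i j k : J} (h : j ≠ k) :
    N (x, i) (y, j) * N (z, i) (w, k) = 0 := by
  rw [← hN.copies_mul_root hC hρ, ← hN.root_mul_copies hC hρ z w, mul_assoc,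
    ← mul_assoc (N (ρ, i) (ρ, j)), hN.copies_root_orth h, zero_mul, mul_zero]

omit hC hρ in
theorem IsQuantumIso.sum_copies (x : C.V) (i : J) : ∑ y, ∑ k, N (x, i) (y, k) = 1 :=
  (Fintype.sum_prod_type _).symm.trans (hN.magic.row_sum (x, i))

theorem IsQuantumIso.sum_copies_root (i : J) : ∑ k, N (ρ, i) (ρ, k) = 1 := by
  rw [← hN.sum_copies ρ i, Finset.sum_comm]
  exact Finset.sum_congr rfl fun k _ => (hN.sum_copies_row hC hρ ρ i k).symm

/-- The magic unitary that describes the action on the set of copies. -/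
theorem IsQuantumIso.rootBlock : IsQuantumIso (⟨J, ⊥, Set.univ⟩ : MarkedGraph.{u})
    (⟨J, ⊥, Set.univ⟩ : MarkedGraph.{u}) (Matrix.of fun i j => N (ρ, i) (ρ, j)) := by
  have hm : IsMagic (Matrix.of fun i j : J => N (ρ, i) (ρ, j)) :=
    { idem := fun _ _ => hN.magic.idem _ _
      selfadj := fun _ _ => hN.magic.selfadj _ _
      row_orth := fun _ _ _ h => hN.copies_root_orth h
      col_orth := fun _ _ _ h => hN.transpose.copies_root_orth h
      row_sum := fun i => hN.sum_copies_root hC hρ i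
      col_sum := fun i => hN.transpose.sum_copies_root hC hρ i }
  exact ⟨hm, intertwines_of_mul_eq_zero hm fun a b x y h => absurd (iff_of_false id id) h,
    fun a x h => absurd (iff_of_true trivial trivial) h⟩

theorem IsQuantumIso.sum_copies_mul (x y z w : C.V) (i : J) :
    (∑ k, N (x, i) (y, k)) * (∑ k, N (z, i) (w, k)) = ∑ k, N (x, i) (y, k) * N (z, i) (w, k) := by
  rw [Finset.sum_mul_sum]
  refine Finset.sum_congr rfl fun k _ => ?_
  exact Finset.sum_eq_single k (fun l _ hl => hN.copies_mul_copies hC hρ hl.symm)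
    fun h => (h (Finset.mem_univ k)).elim

/-- The magic unitary that describes the action of the `i`th copy of `Qu C`. -/
theorem IsQuantumIso.copyBlock (i : J) :
    IsQuantumIso C C (Matrix.of fun x y => ∑ k, N (x, i) (y, k)) := by
  have hm : IsMagic (Matrix.of fun x y : C.V => ∑ k, N (x, i) (y, k)) :=
    { idem := fun x y => (hN.sum_copies_mul hC hρ x y x y i).trans
        (Finset.sum_congr rfl fun k _ => hN.magic.idem _ _)
      selfadj := fun x y => (star_sum _ _).trans
        (Finset.sum_congr rfl fun k _ => hN.magic.selfadj _ _)
      row_orth := fun x y z h => (hN.sum_copies_mul hC hρ x y x z i).trans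
        (Finset.sum_eq_zero fun k _ => hN.magic.row_orth _ _ _ fun h' => h (congrArg Prod.fst h'))
      col_orth := fun x z y h => (hN.sum_copies_mul hC hρ x y z y i).trans
        (Finset.sum_eq_zero fun k _ => hN.magic.col_orth _ _ _ fun h' => h (congrArg Prod.fst h'))
      row_sum := fun x => hN.sum_copies x i
      -- Only one source copy `i` is summed over, so this is not a column sum of `N`. Connectedness
      -- and the root reduce the sum to the row sum `∑ k, N (ρ, i) (ρ, k)`.
      col_sum := fun y => Finset.sum_comm.trans ((Finset.sum_congr rfl fun k _ =>
        hN.sum_copies_col hC hρ y i k).trans (hN.sum_copies_root hC hρ i)) }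
  refine ⟨hm, intertwines_of_mul_eq_zero hm fun a b x y h => ?_, fun a x h => ?_⟩
  · refine (hN.sum_copies_mul hC hρ a x b y i).trans (Finset.sum_eq_zero fun k _ => ?_)
    refine hN.mul_eq_zero fun h' => h ?_
    exact ⟨fun hab => (h'.mp ⟨rfl, hab⟩).2, fun hxy => (h'.mpr ⟨rfl, hxy⟩).2⟩
  · exact Finset.sum_eq_zero fun k _ => hN.mark _ _ h

/-- This is the factorisation of a coefficient as `s i j * ν i (u x y)`. Together with the same
identity for the reversed product, it shows that the two factors commute. -/
theorem IsQuantumIso.root_mul_sum_copies (x y : C.V) (i j : J) :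
    N (ρ, i) (ρ, j) * ∑ k, N (x, i) (y, k) = N (x, i) (y, j) := by
  rw [Finset.mul_sum]
  exact (Finset.sum_eq_single j (fun l _ hl => hN.copies_mul_copies hC hρ hl.symm)
    fun h => (h (Finset.mem_univ j)).elim).trans (hN.root_mul_copies hC hρ x y i j)

theorem IsQuantumIso.sum_copies_mul_root (x y : C.V) (i j : J) :
    (∑ k, N (x, i) (y, k)) * N (ρ, i) (ρ, j) = N (x, i) (y, j) := by
  rw [Finset.sum_mul]
  exact (Finset.sum_eq_single j (fun l _ hl => hN.copies_mul_copies hC hρ hl)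
    fun h => (h (Finset.mem_univ j)).elim).trans (hN.copies_mul_root hC hρ x y i j)

end copies

section wreath

variable {C : MarkedGraph.{u}} {J : Type u} [Fintype J]

theorem wreathU_mul_eq_zero (P S : QuantumPermutationGroup.{u}) {a b x y : P.ι} {i j k l : S.ι}
    (h : ¬ (i = j ↔ k = l) ∨ i = j ∧ P.U a x * P.U b y = 0) :
    wreathU P S (a, i) (x, k) * wreathU P S (b, j) (y, l) = 0 := by
  simp only [wreathU_apply]
  by_cases hij : i = j
  · subst hij
    rw [mul_assoc, ← mul_assoc (nu P S i _), (nu_commute P S i l _).eq, mul_assoc,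
      ← map_mul, ← mul_assoc, ← map_mul]
    rcases h with h | ⟨-, h⟩
    · rw [S.magic.row_orth i k l fun hkl => h (iff_of_true rfl hkl), map_zero, zero_mul]
    · rw [h, map_zero, mul_zero]
  · obtain rfl : k = l := by
      by_contra hkl
      rcases h with h | ⟨h, -⟩
      · exact h (iff_of_false hij hkl)
      · exact hij h
    rw [← (nu_commute P S i k _).eq, mul_assoc, ← mul_assoc (sigma P S _), ← map_mul,
      S.magic.col_orth i j k hij, map_zero, zero_mul, mul_zero]

theorem wreathU_eq_zero (P S : QuantumPermutationGroup.{u}) {a x : P.ι} {i k : S.ι}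
    (h : P.U a x = 0) : wreathU P S (a, i) (x, k) = 0 := by
  rw [wreathU_apply, h, map_zero, mul_zero]

theorem isQuantumIso_wreathU :
    IsQuantumIso (copies C J) (copies C J) (wreathU (Qu C) (sPlus J)) := by
  have hC := C.quU_isQuantumIso
  have hm := wreathU_magic (Qu C) (sPlus J)
  refine ⟨hm, intertwines_of_mul_eq_zero hm ?_, ?_⟩
  · rintro ⟨a, i⟩ ⟨b, j⟩ ⟨x, k⟩ ⟨y, l⟩ h
    change ¬ ((i = j ∧ C.graph.Adj a b) ↔ (k = l ∧ C.graph.Adj x y)) at h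
    refine wreathU_mul_eq_zero (Qu C) (sPlus J) ?_
    by_cases hij : i = j
    · by_cases hkl : k = l
      · exact Or.inr ⟨hij, hC.mul_eq_zero fun h' => h (by simp [hij, hkl, h'])⟩
      · exact Or.inl fun h' => hkl (h'.mp hij)
    · by_cases hkl : k = l
      · exact Or.inl fun h' => hij (h'.mpr hkl)
      · exact absurd (by simp [hij, hkl]) h
  · rintro ⟨a, i⟩ ⟨x, k⟩ h
    exact wreathU_eq_zero (Qu C) (sPlus J) (hC.mark a x h)

variable (hC : C.graph.Connected) {ρ : C.V} (hρ : C.mark = {ρ})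

/-- The copy with index `i` of `Qu C` in the quantum automorphism group of the disjoint union. -/
def copyHom (i : J) : (Qu C).A →⋆ₐ[ℂ] (Qu (copies C J)).A :=
  quLift _ ((copies C J).quU_isQuantumIso.copyBlock hC hρ i)

theorem copyHom_U (i : J) (x y : C.V) :
    copyHom hC hρ i ((Qu C).U x y) = ∑ k, (copies C J).quU (x, i) (y, k) :=
  quLift_quU _ ((copies C J).quU_isQuantumIso.copyBlock hC hρ i) x y

variable (J) in
/-- The quantum permutation group of the set of copies in the quantum automorphism group of the
disjoint union. -/
def rootHom : (sPlus J).A →⋆ₐ[ℂ] (Qu (copies C J)).A :=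
  quLift (X := ⟨J, ⊥, Set.univ⟩) _ ((copies C J).quU_isQuantumIso.rootBlock hC hρ)

theorem rootHom_U (i j : J) :
    rootHom J hC hρ ((sPlus J).U i j) = (copies C J).quU (ρ, i) (ρ, j) :=
  quLift_quU (X := ⟨J, ⊥, Set.univ⟩) _ ((copies C J).quU_isQuantumIso.rootBlock hC hρ) i j

theorem copyHom_commute (i j : J) (a : (Qu C).A) :
    Commute (copyHom hC hρ i a) (rootHom J hC hρ ((sPlus J).U i j)) := by
  have hN := (copies C J).quU_isQuantumIso
  have hs : star (rootHom J hC hρ ((sPlus J).U i j)) = rootHom J hC hρ ((sPlus J).U i j) :=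
    (map_star _ _).symm.trans (congrArg _ ((sPlus J).magic.selfadj i j))
  -- The commutant of a self-adjoint element is a `*`-subalgebra, so it suffices to treat
  -- generators, for which both products equal the same coefficient of the fundamental
  -- representation.
  have := (Qu C).map_mem (copyHom hC hρ i)
    (StarSubalgebra.centralizer ℂ {rootHom J hC hρ ((sPlus J).U i j)}) (fun x y => by
      rw [StarSubalgebra.mem_centralizer_iff]
      rintro _ rfl
      rw [hs, and_self, rootHom_U]
      exact (congrArg _ (copyHom_U hC hρ i x y)).trans
        ((hN.root_mul_sum_copies hC hρ x y i j).trans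
        ((hN.sum_copies_mul_root hC hρ x y i j).symm.trans
        (congrArg (· * _) (copyHom_U hC hρ i x y).symm)))) a
  rw [StarSubalgebra.mem_centralizer_iff] at this
  exact (this _ rfl).1.symm

/-- The quantum automorphism group of a disjoint union of copies of a connected rooted graph is a
free wreath product. -/
def wreathMatching [Nonempty (Qu C).ι] :
    Matching (wreath (Qu C) (sPlus J)) (Qu (copies C J)) where
  e := Equiv.refl (C.V × J)
  toHom := wreathLift (Qu C) (sPlus J) (copyHom hC hρ) (rootHom J hC hρ) (copyHom_commute hC hρ)
  invHom := quLift (wreathU (Qu C) (sPlus J)) isQuantumIso_wreathU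
  toHom_U := by
    rintro ⟨x, i⟩ ⟨y, j⟩
    change wreathLift (Qu C) (sPlus J) (copyHom hC hρ) (rootHom J hC hρ) (copyHom_commute hC hρ)
      (sigma (Qu C) (sPlus J) ((sPlus J).U i j) * nu (Qu C) (sPlus J) i ((Qu C).U x y)) = _
    refine (map_mul _ _ _).trans ?_
    refine (congrArg₂ _ ((wreathLift_sigma _ _ (copyHom_commute hC hρ) _).trans
      (rootHom_U hC hρ i j)) ((wreathLift_nu _ _ (copyHom_commute hC hρ) i _).trans
      (copyHom_U hC hρ i x y))).trans ?_
    exact (copies C J).quU_isQuantumIso.root_mul_sum_copies hC hρ x y i j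
  invHom_U := fun (p q : (copies C J).V) =>
    quLift_quU (wreathU (Qu C) (sPlus J)) isQuantumIso_wreathU p q

end wreath

/-! ### Classes of isomorphic components and the final assembly -/

section classes

variable {X : MarkedGraph.{u}}

/-- Equal classes in a `Quot` are joined by a chain of quantum isomorphisms. Isomorphism is an
equivalence relation, so it passes along the chain without any appeal to transitivity of quantum
isomorphism. -/
theorem isomorphic_of_qiClass_eq
    (H : ∀ c d, (X.component c).QuantumIsomorphic (X.component d) →
      (X.component c).Isomorphic (X.component d)) {c d : X.graph.ConnectedComponent}
    (h : X.qiClass c = X.qiClass d) : (X.component c).Isomorphic (X.component d) := by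
  have h' := Quot.eqvGen_exact h
  clear h
  induction h' with
  | rel c d h => exact H c d h
  | refl c => exact ⟨.refl, fun _ => Iff.rfl⟩
  | symm c d _ ih => exact ih.symm
  | trans c d e _ _ ih ih' => exact ih.trans ih'

theorem connected_component (c : X.graph.ConnectedComponent) : (X.component c).graph.Connected :=
  c.connected_toSimpleGraph

theorem IsRooted.component_mark (hX : X.IsRooted) (c : X.graph.ConnectedComponent) :
    (X.component c).mark = {hX.root c} := by
  ext x
  exact ⟨fun hx => hX.eq_root x hx, fun hx => hx ▸ hX.root_mem c⟩

/-- The disjoint union of copies of `C` is isomorphic to the disjoint union of graphs that are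
isomorphic to `C`. -/
def copiesIso {C : MarkedGraph.{u}} {J : Type u} [Fintype J] {D : J → MarkedGraph.{u}}
    (f : ∀ j, C.graph ≃g (D j).graph) : (copies C J).graph ≃g (sum D).graph where
  toEquiv := ((Equiv.prodComm C.V J).trans (Equiv.sigmaEquivProd J C.V).symm).trans
    (Equiv.sigmaCongrRight fun j => (f j).toEquiv)
  map_rel_iff' := by
    rintro ⟨x, i⟩ ⟨y, j⟩
    change (sum D).graph.Adj ⟨i, f i x⟩ ⟨j, f j y⟩ ↔ i = j ∧ C.graph.Adj x y
    by_cases h : i = j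
    · subst h
      refine sum_adj_same.trans ((f i).map_adj_iff.trans ?_)
      simp
    · exact iff_of_false (sum_adj_ne h) fun h' => h h'.1

/-- If quantum isomorphic components are isomorphic, then the factors are free wreath products. -/
theorem IsRooted.nonempty_wreathMatching (hX : X.IsRooted)
    (H : ∀ c d, (X.component c).QuantumIsomorphic (X.component d) →
      (X.component c).Isomorphic (X.component d)) {c : X.graph.ConnectedComponent} {l : X.QIClass}
    (hc : X.qiClass c = l) :
    Nonempty (Matching (wreath (Qu (X.component c)) (sPlus (X.classMembers l)))
      (Qu (X.classSum l))) := by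
  choose f hf using fun d : X.classMembers l => isomorphic_of_qiClass_eq H (hc.trans d.2.symm)
  exact ⟨(wreathMatching (connected_component c) (hX.component_mark c)).trans
    (isoMatching (copiesIso f) fun p => hf p.2 p.1)⟩

/-- The two parts of the theorem differ only in the target `T`. All that depends on the anchor is a
surjective `ψ` from the quantum group of the rooted graph, which is bijective under the condition
`p`. -/
theorem IsRooted.exists_hom (hX : X.IsRooted) {T : QuantumPermutationGroup.{u}} {p : Prop}
    (ψ : Hom (Qu X) T) (hs : Function.Surjective ψ) (hb : p → Function.Bijective ψ) :
    ∃ φ : Hom X.classFreeProd T, Function.Surjective φ ∧ (p → Function.Bijective φ) ∧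
      ((∀ c d, (X.component c).QuantumIsomorphic (X.component d) →
          (X.component c).Isomorphic (X.component d)) →
        ∀ rep : X.QIClass → X.graph.ConnectedComponent, (∀ l, X.qiClass (rep l) = l) →
          ∃ (θ : Hom (X.wreathFreeProd rep) X.classFreeProd) (φ' : Hom (X.wreathFreeProd rep) T),
            Function.Bijective θ ∧ (∀ a, φ' a = φ (θ a)) ∧
            Function.Surjective φ' ∧ (p → Function.Bijective φ')) := by
  have hm := hX.matching.hom_bijective
  refine ⟨ψ.comp hX.matching.hom, hs.comp hm.surjective, fun h => (hb h).comp hm,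
    fun H rep hrep => ?_⟩
  have m := fun l => Classical.choice (hX.nonempty_wreathMatching H (hrep l))
  have hθ := (Matching.freeProd m).hom_bijective
  exact ⟨(Matching.freeProd m).hom, (ψ.comp hX.matching.hom).comp (Matching.freeProd m).hom, hθ,
    fun _ => rfl, (hs.comp hm.surjective).comp hθ.surjective, fun h => ((hb h).comp hm).comp hθ⟩

end classes

/-- The morphism to the quantum automorphism group of an anchored graph `(G, Q)` from that of
`Ψ(G, Q)`. -/
theorem exists_psi_hom {X : MarkedGraph.{u}} (hG : X.graph.Connected)
    (hQ : IsAnchor X.graph X.mark) :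
    X.psi.IsRooted ∧ ∃ ψ : Hom (Qu X.psi) (Qu X), Function.Surjective ψ ∧
      (X.graph.IsClique X.mark → Function.Bijective ψ) := by
  by_cases h : ∃ r, IsCutVertex X.graph r ∧ X.mark = {r}
  · have hr := h.choose_spec.2
    rw [show X.psi = psiCut X.graph h.choose from dif_pos h]
    have hiso : Isomorphic (X.cutGraph h.choose) (psiCut X.graph h.choose) := isomorphic_psiCut
    obtain ⟨f, hf⟩ := hiso.symm
    -- For a cut vertex the morphism is bijective with no further condition.
    have hb := (cutHom_bijective hr hG).comp (isoMatching f hf).hom_bijective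
    exact ⟨(isRooted_cutGraph hG).of_isomorphic hiso,
      (cutHom hr).comp (isoMatching f hf).hom, hb.surjective, fun _ => hb⟩
  · rw [show X.psi = X.psiBlock from dif_neg h]
    exact ⟨isRooted_psiBlock hG (hQ.resolve_left h), X.psiBlockHom, psiBlockHom_surjective,
      psiBlockHom_bijective⟩

/-- The quantum automorphism group of a connected graph preserves the canonical anchor. -/
theorem exists_hom_quGraph {V : Type u} [Fintype V] {G : SimpleGraph V} (hG : G.Connected)
    {Q : Set V} (hQ : IsCanonicalAnchor G Q) :
    ∃ φ : Hom (Qu ⟨V, G, Q⟩) (quGraph G), Function.Bijective φ := by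
  have h1 := (⟨V, G, Set.univ⟩ : MarkedGraph.{u}).quU_isQuantumIso
  have h2 := (⟨V, G, Q⟩ : MarkedGraph.{u}).quU_isQuantumIso
  -- A coefficient of `Qu(G)` between the canonical anchor and its complement would contradict
  -- `IsQuantumIso.mem_canonicalAnchor_iff` if it were nonzero. So the relations that stabilise `Q`
  -- hold already.
  have h : IsQuantumIso ⟨V, G, Q⟩ ⟨V, G, Q⟩ (quU ⟨V, G, Set.univ⟩) :=
    ⟨h1.magic, h1.intertwines, fun x y hxy => by
      by_contra h0
      exact hxy (h1.mem_canonicalAnchor_iff hG hQ h0)⟩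
  have h' : IsQuantumIso ⟨V, G, Set.univ⟩ ⟨V, G, Set.univ⟩ (quU ⟨V, G, Q⟩) :=
    ⟨h2.magic, h2.intertwines, fun x y hxy => absurd (iff_of_true trivial trivial) hxy⟩
  exact ⟨relabelHom (X := ⟨V, G, Set.univ⟩) (Y := ⟨V, G, Q⟩) (Equiv.refl V) h,
    relabelHom_bijective (X := ⟨V, G, Set.univ⟩) (Y := ⟨V, G, Q⟩) (Equiv.refl V) h h'⟩

end MarkedGraph

end

end QuantumAut

theorem mainTheorem7 {V : Type u} [Fintype V] (G : SimpleGraph V) (hG : G.Connected) :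
    (∀ (Q : Set V) (X : MarkedGraph.{u}), IsAnchor G Q → X = MarkedGraph.psi ⟨V, G, Q⟩ →
      ∃ φ : QuantumPermutationGroup.Hom X.classFreeProd (MarkedGraph.Qu ⟨V, G, Q⟩),
        Function.Surjective φ ∧ (G.IsClique Q → Function.Bijective φ) ∧
        ((∀ c d, (X.component c).QuantumIsomorphic (X.component d) →
            (X.component c).Isomorphic (X.component d)) →
          ∀ rep : X.QIClass → X.graph.ConnectedComponent, (∀ l, X.qiClass (rep l) = l) →
            ∃ (θ : QuantumPermutationGroup.Hom (X.wreathFreeProd rep) X.classFreeProd)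
              (φ' : QuantumPermutationGroup.Hom (X.wreathFreeProd rep) (MarkedGraph.Qu ⟨V, G, Q⟩)),
              Function.Bijective θ ∧ (∀ a, φ' a = φ (θ a)) ∧
              Function.Surjective φ' ∧ (G.IsClique Q → Function.Bijective φ'))) ∧
    (∃! Q : Set V, IsCanonicalAnchor G Q) ∧
    (∀ (Q : Set V) (X : MarkedGraph.{u}), IsCanonicalAnchor G Q → X = MarkedGraph.psi ⟨V, G, Q⟩ →
      ∃ φ : QuantumPermutationGroup.Hom X.classFreeProd (quGraph G),
        Function.Surjective φ ∧ (G.IsClique Q → Function.Bijective φ) ∧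
        ((∀ c d, (X.component c).QuantumIsomorphic (X.component d) →
            (X.component c).Isomorphic (X.component d)) →
          ∀ rep : X.QIClass → X.graph.ConnectedComponent, (∀ l, X.qiClass (rep l) = l) →
            ∃ (θ : QuantumPermutationGroup.Hom (X.wreathFreeProd rep) X.classFreeProd)
              (φ' : QuantumPermutationGroup.Hom (X.wreathFreeProd rep) (quGraph G)),
              Function.Bijective θ ∧ (∀ a, φ' a = φ (θ a)) ∧
              Function.Surjective φ' ∧ (G.IsClique Q → Function.Bijective φ'))) := by
  refine ⟨?_, existsUnique_isCanonicalAnchor hG, ?_⟩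
  · rintro Q X hQ rfl
    obtain ⟨hX, ψ, hs, hb⟩ := MarkedGraph.exists_psi_hom (X := ⟨V, G, Q⟩) hG hQ
    exact hX.exists_hom ψ hs hb
  · rintro Q X hQ rfl
    obtain ⟨hX, ψ, hs, hb⟩ := MarkedGraph.exists_psi_hom (X := ⟨V, G, Q⟩) hG hQ.isAnchor
    obtain ⟨χ, hχ⟩ := MarkedGraph.exists_hom_quGraph hG hQ
    exact hX.exists_hom (χ.comp ψ) (hχ.surjective.comp hs) fun h => hχ.comp (hb h)
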